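/- Throughout, a language is a first-order language (with equality) with function and relation symbols of arbitrary finite arity, together with a numbering of its symbols for which it is decidable whether a number codes a function (relation) symbol and of which arity; formulas are Gödel numbered accordingly. A theory $T$ is a set of sentences of a language $L(T)$, $T\vdash\varphi$ means that $\varphi$ is provable from $T$ in classical first-order logic, $T$ is consistent if $T\nvdash\bot$, and $T$ is incomplete if there is a sentence $\varphi$ of $L(T)$ with $T\nvdash\varphi$ and $T\nvdash\neg\varphi$. A theory is recursively axiomatizable if it has the same theorems as some recursive set of sentences, and decidable if the set of its theorems is recursive. An extension of $T$ in the same language is a theory in $L(T)$ that proves all theorems of $T$. A translation $I$ of $L(T)$ into $L(S)$ consists of an $L(S)$-formula $\delta_I(x)$, an $L(S)$-formula $=_I$ in two variables, an $L(S)$-formula $R_I$ of the same arity for each relation symbol $R$ of $L(T)$, and an $L(S)$-formula $F_I$ of arity $k+1$ for each $k$-ary function symbol $F$ of $L(T)$; the assignments $R\mapsto R_I$ and $F\mapsto F_I$ are required to be recursive (which is automatic if $L(T)$ has finitely many symbols). The translation $\varphi^I$ of an $L(T)$-formula $\varphi$ is obtained by unravelling nested terms so that function symbols occur only in the form $F(\bar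 x)=y$, replacing $F(\bar x)=y$, $R(\bar x)$, $x=y$ by $F_I(\bar x,y)$, $R_I(\bar x)$, $x=_I y$, and restricting all quantifiers to $\delta_I$. $T$ is interpretable in $S$ if there is such an $I$ for which $S$ proves that each $F_I$ is total on $\delta_I$ and $S$ proves $\varphi^I$ for every theorem $\varphi$ of $T$ (including the axioms of equality). Proposition. Let $T$ be a recursively axiomatizable consistent theory. The following are equivalent: (1) $\mathsf{G1}$ holds for $T$: every recursively axiomatizable consistent theory $S$ (in any language) in which $T$ is interpretable is incomplete. (2) $T$ is essentially incomplete: every recursively axiomatizable consistent extension of $T$ in the same language is incomplete. (3) $T$ is essentially undecidable: every recursively axiomatizable consistent extension of $T$ in the same language is undecidable. -/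

import Mathlib

namespace G1

open FirstOrder.Language

universe u v

/-- An arithmetization of a first-order language: its function and relation symbols are numbered
injectively, in such a way that one can effectively decide whether a number codes a function
symbol (a relation symbol), and of which arity. Since `funcArity` is a function, symbols of
different arities have different codes, so injectivity is only asked arity by arity. -/
class Arithmetization (L : FirstOrder.Language.{u, v}) where
  funcCode : ∀ {n : ℕ}, L.Functions n → ℕ
  relCode : ∀ {n : ℕ}, L.Relations n → ℕ
  funcCode_injective : ∀ n : ℕ, Function.Injective (funcCode (n := n))
  relCode_injective : ∀ n : ℕ, Function.Injective (relCode (n := n))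
  funcArity : ℕ → Option ℕ
  relArity : ℕ → Option ℕ
  funcArity_computable : Computable funcArity
  relArity_computable : Computable relArity
  funcArity_eq_some : ∀ c n : ℕ, funcArity c = some n ↔ ∃ f : L.Functions n, funcCode f = c
  relArity_eq_some : ∀ c n : ℕ, relArity c = some n ↔ ∃ R : L.Relations n, relCode R = c

/-- Terms of `L` whose variables are among `x₀, …, x_{n-1}`. -/
abbrev Tm (L : FirstOrder.Language.{u, v}) (n : ℕ) := L.Term (Empty ⊕ Fin n)

/-- Formulas of `L` whose free variables are among `x₀, …, x_{n-1}`. For `n = 0` these are the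
sentences of `L`. The quantifier in `∀' φ` with `φ : Fm L (n + 1)` binds `x_n`. -/
abbrev Fm (L : FirstOrder.Language.{u, v}) (n : ℕ) := L.BoundedFormula Empty n

section Calculus

variable {L : FirstOrder.Language.{u, v}}

/-- The variable `x_i` as a term. -/
def tvar {n : ℕ} (i : Fin n) : Tm L n := Term.var (Sum.inr i)

/-- Simultaneous substitution of `σ i` for `x_i` in a term. -/
def substTm {m n : ℕ} (σ : Fin m → Tm L n) (t : Tm L m) : Tm L n :=
  t.subst (Sum.elim (fun e => e.elim) σ)

/-- The extension of a substitution under a quantifier: the newly bound variable `x_m` becomes the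
newly bound variable `x_n`, so that no variable is captured. -/
def liftSubst {m n : ℕ} (σ : Fin m → Tm L n) : Fin (m + 1) → Tm L (n + 1) :=
  Fin.snoc (α := fun _ => Tm L (n + 1))
    (fun i => (σ i).relabel (Sum.map id Fin.castSucc)) (tvar (Fin.last n))

/-- Simultaneous, capture-avoiding substitution of `σ i` for the free variable `x_i`. -/
def substFm : ∀ {m n : ℕ}, (Fin m → Tm L n) → Fm L m → Fm L n
  | _, _, _, .falsum => .falsum
  | _, _, σ, .equal t s => .equal (substTm σ t) (substTm σ s)
  | _, _, σ, .rel R ts => .rel R (fun i => substTm σ (ts i))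
  | _, _, σ, .imp φ ψ => .imp (substFm σ φ) (substFm σ ψ)
  | _, _, σ, .all φ => .all (substFm (liftSubst σ) φ)

/-- A formula in `x₀, …, x_{n-1}` seen as a formula in `x₀, …, x_n`. -/
def weaken {n : ℕ} (φ : Fm L n) : Fm L (n + 1) :=
  substFm (fun i => tvar i.castSucc) φ

/-- A sentence seen as a formula in `x₀, …, x_{n-1}`. -/
def ofSentence (n : ℕ) (φ : L.Sentence) : Fm L n :=
  substFm (fun i : Fin 0 => i.elim0) φ

/-- Substitution of the term `t` for the last variable `x_n`. -/
def inst {n : ℕ} (φ : Fm L (n + 1)) (t : Tm L n) : Fm L n :=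
  substFm (Fin.snoc (α := fun _ => Tm L n) tvar t) φ

/-- Provability from the axioms `T` in a Hilbert-style calculus for classical first-order logic
with equality (over nonempty domains). The inference rules are modus ponens and generalization. -/
inductive Provable (T : L.Theory) : ∀ {n : ℕ}, Fm L n → Prop
  | ax (n : ℕ) {φ : L.Sentence} : φ ∈ T → Provable T (ofSentence n φ)
  | imp_intro {n : ℕ} (φ ψ : Fm L n) : Provable T (φ.imp (ψ.imp φ))
  | imp_distrib {n : ℕ} (φ ψ χ : Fm L n) :
      Provable T ((φ.imp (ψ.imp χ)).imp ((φ.imp ψ).imp (φ.imp χ)))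
  | not_not_elim {n : ℕ} (φ : Fm L n) : Provable T (φ.not.not.imp φ)
  | all_elim {n : ℕ} (φ : Fm L (n + 1)) (t : Tm L n) : Provable T (φ.all.imp (inst φ t))
  | all_distrib {n : ℕ} (φ : Fm L n) (ψ : Fm L (n + 1)) :
      Provable T (((weaken φ).imp ψ).all.imp (φ.imp ψ.all))
  | exists_self (n : ℕ) :
      Provable T (BoundedFormula.equal (tvar (Fin.last n)) (tvar (Fin.last n)) : Fm L (n + 1)).ex
  | eq_refl {n : ℕ} (t : Tm L n) : Provable T (BoundedFormula.equal t t : Fm L n)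
  | eq_subst {n : ℕ} (φ : Fm L (n + 1)) (t s : Tm L n) :
      Provable T ((BoundedFormula.equal t s : Fm L n).imp ((inst φ t).imp (inst φ s)))
  | mp {n : ℕ} {φ ψ : Fm L n} : Provable T (φ.imp ψ) → Provable T φ → Provable T ψ
  | gen {n : ℕ} {φ : Fm L (n + 1)} : Provable T φ → Provable T φ.all

/-- `T ⊢ φ` for a sentence `φ`. -/
def Proves (T : L.Theory) (φ : L.Sentence) : Prop := Provable T (n := 0) φ

/-- No contradiction is provable in `T`. -/
def Consistent (T : L.Theory) : Prop := ¬ Proves T ⊥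

/-- Some sentence is independent of `T`. -/
def Incomplete (T : L.Theory) : Prop := ∃ φ : L.Sentence, ¬ Proves T φ ∧ ¬ Proves T φ.not

/-- `S` extends `T` (in the same language): every theorem of `T` is a theorem of `S`. -/
def Extends (S T : L.Theory) : Prop := ∀ φ : L.Sentence, Proves T φ → Proves S φ

end Calculus

section Goedel

variable {L : FirstOrder.Language.{u, v}} [Arithmetization L]

/-- The Gödel number of a term. -/
def codeTm {n : ℕ} : Tm L n → ℕ
  | .var (.inl e) => e.elim
  | .var (.inr i) => 2 * (i : ℕ)
  | .func f ts =>
      2 * Nat.pair (Arithmetization.funcCode f)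
        (Encodable.encode (List.ofFn fun i => codeTm (ts i))) + 1

/-- The Gödel number of a formula. -/
def code : ∀ {n : ℕ}, Fm L n → ℕ
  | _, .falsum => 0
  | _, .equal t s => 4 * Nat.pair (codeTm t) (codeTm s) + 1
  | _, .rel R ts =>
      4 * Nat.pair (Arithmetization.relCode R)
        (Encodable.encode (List.ofFn fun i => codeTm (ts i))) + 2
  | _, .imp φ ψ => 4 * Nat.pair (code φ) (code ψ) + 3
  | _, .all φ => 4 * code φ + 4

/-- The set of Gödel numbers of the sentences in `A` is recursive. -/
def RecursiveSet (A : Set L.Sentence) : Prop :=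
  ComputablePred fun c : ℕ => ∃ φ ∈ A, code (n := 0) φ = c

/-- `T` is decidable: the set of its theorems is recursive. -/
def DecidableTheory (T : L.Theory) : Prop := RecursiveSet {φ : L.Sentence | Proves T φ}

/-- `T` has a recursive set of axioms: its theorems are those of some recursive set `A`. -/
def RecursivelyAxiomatizable (T : L.Theory) : Prop :=
  ∃ A : L.Theory, RecursiveSet A ∧ ∀ φ : L.Sentence, Proves A φ ↔ Proves T φ

/-- Every recursively axiomatizable consistent extension of `T` in the same language is
incomplete. -/
def EssentiallyIncomplete (T : L.Theory) : Prop :=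
  ∀ S : L.Theory, RecursivelyAxiomatizable S → Consistent S → Extends S T → Incomplete S

/-- Every recursively axiomatizable consistent extension of `T` in the same language is
undecidable. -/
def EssentiallyUndecidable (T : L.Theory) : Prop :=
  ∀ S : L.Theory, RecursivelyAxiomatizable S → Consistent S → Extends S T → ¬ DecidableTheory S

end Goedel

section Interpretation

variable {L L' : FirstOrder.Language.{u, v}}

/-- A (one-dimensional, parameter-free, one-piece) translation of `L` into `L'`: a domain formula,
a formula for equality, a formula of the same arity for each relation symbol, and a formula of
arity `k + 1` for each function symbol of arity `k` (the last variable is the value). -/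
structure Translation (L L' : FirstOrder.Language.{u, v}) where
  dom : Fm L' 1
  eq : Fm L' 2
  rel : ∀ {n : ℕ}, L.Relations n → Fm L' n
  func : ∀ {n : ℕ}, L.Functions n → Fm L' (n + 1)

/-- Conjunction of a list of formulas. -/
def conj {n : ℕ} (l : List (Fm L n)) : Fm L n := l.foldr (fun φ ψ => φ ⊓ ψ) ⊤

namespace Translation

variable (I : Translation L L')

/-- `δ(x_i)`. -/
def domAt {n : ℕ} (i : Fin n) : Fm L' n := substFm (fun _ => tvar i) I.dom

/-- `∃ x_m ∈ δ, …, ∃ x_{m+k-1} ∈ δ, φ`. -/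
def bexs {m : ℕ} : ∀ k : ℕ, Fm L' (m + k) → Fm L' m
  | 0, φ => φ
  | k + 1, φ => bexs k (I.domAt (Fin.last (m + k)) ⊓ φ).ex

/-- `∀ x_m ∈ δ, …, ∀ x_{m+k-1} ∈ δ, φ`. -/
def balls {m : ℕ} : ∀ k : ℕ, Fm L' (m + k) → Fm L' m
  | 0, φ => φ
  | k + 1, φ => balls k ((I.domAt (Fin.last (m + k))).imp φ).all

/-- The translation of `t = x_y`, where the variables `x_i` of `t` are renamed to `x_{e i}`.
Nested terms are unravelled: `F(t₀, …, t_{k-1}) = x_y` becomes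
`∃ z₀, …, z_{k-1} ∈ δ, t₀ = z₀ ∧ … ∧ t_{k-1} = z_{k-1} ∧ F_I(z₀, …, z_{k-1}, x_y)`. -/
def graph {n : ℕ} : Tm L n → ∀ {m : ℕ}, (Fin n → Fin m) → Fin m → Fm L' m
  | .var (.inl a), _, _, _ => a.elim
  | .var (.inr i), _, e, y => BoundedFormula.equal (tvar (e i)) (tvar y)
  | @Term.func _ _ k f ts, m, e, y =>
      I.bexs k
        (conj (List.ofFn fun i : Fin k =>
            graph (ts i) (fun j => Fin.castAdd k (e j)) (Fin.natAdd m i)) ⊓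
          substFm (Fin.snoc (α := fun _ => Tm L' (m + k))
            (fun i : Fin k => tvar (Fin.natAdd m i)) (tvar (Fin.castAdd k y))) (I.func f))

/-- `∃ z₀, …, z_{k-1} ∈ δ, t₀ = z₀ ∧ … ∧ t_{k-1} = z_{k-1} ∧ P(z₀, …, z_{k-1})`: the translation of
an atomic formula with arguments `ts` whose predicate is translated by `P`. -/
def atom {n k : ℕ} (P : Fm L' k) (ts : Fin k → Tm L n) : Fm L' n :=
  I.bexs k
    (conj (List.ofFn fun i : Fin k => I.graph (ts i) (Fin.castAdd k) (Fin.natAdd n i)) ⊓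
      substFm (fun i : Fin k => tvar (Fin.natAdd n i)) P)

/-- The translation `φ^I`: terms are unravelled and all quantifiers are restricted to `δ`. -/
def onFm : ∀ {n : ℕ}, Fm L n → Fm L' n
  | _, .falsum => .falsum
  | _, .equal t s => I.atom I.eq ![t, s]
  | _, .rel R ts => I.atom (I.rel R) ts
  | _, .imp φ ψ => .imp (onFm φ) (onFm ψ)
  | n, .all φ => .all ((I.domAt (Fin.last n)).imp (onFm φ))

/-- `∀ x₀ ∈ δ, …, ∀ x_{k-1} ∈ δ, ∃ y ∈ δ, F_I(x₀, …, x_{k-1}, y)`. -/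
def total {k : ℕ} (f : L.Functions k) : L'.Sentence :=
  I.balls (m := 0) k
    (I.domAt (Fin.last (0 + k)) ⊓
      substFm (fun i : Fin (k + 1) => tvar (Fin.cast (by omega) i)) (I.func f)).ex

/-- The translation is effective: the formula assigned to a symbol is computable from the symbol.
Every translation of a language with finitely many symbols is effective, see
`isRecursive_of_finite`. -/
def IsRecursive [Arithmetization L] [Arithmetization L'] : Prop :=
  (∃ g : ℕ → ℕ, Computable g ∧ ∀ (n : ℕ) (R : L.Relations n),
    g (Arithmetization.relCode R) = code (I.rel R)) ∧
  ∃ h : ℕ → ℕ, Computable h ∧ ∀ (n : ℕ) (f : L.Functions n),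
    h (Arithmetization.funcCode f) = code (I.func f)

theorem exists_computable_eqOn (s : Finset ℕ) (f : ℕ → ℕ) :
    ∃ g : ℕ → ℕ, Computable g ∧ ∀ c ∈ s, g c = f c := by
  induction s using Finset.induction with
  | empty => exact ⟨fun _ => 0, Computable.const 0, by simp⟩
  | insert a s ha ih =>
    obtain ⟨g, hg, h⟩ := ih
    refine ⟨fun c => if c = a then f a else g c, ?_, ?_⟩
    · refine (Computable.cond (c := fun c => decide (c = a)) ?_ (Computable.const (f a)) hg).of_eq
        (fun c => by simp [Bool.cond_decide])
      exact (Primrec.eq.comp Primrec.id (Primrec.const a)).decide.to_comp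
    · intro c hc
      rcases Finset.mem_insert.1 hc with rfl | hc
      · simp
      · by_cases hca : c = a
        · simp [hca]
        · simp [hca, h c hc]

theorem exists_computable_of_finite {A : ℕ → Type*} [Finite (Σ n, A n)] (c d : ∀ n, A n → ℕ)
    (hcd : ∀ n a m b, c n a = c m b → d n a = d m b) :
    ∃ g : ℕ → ℕ, Computable g ∧ ∀ n (a : A n), g (c n a) = d n a := by
  classical
  obtain ⟨g, hg, h⟩ := exists_computable_eqOn
    (Set.finite_range fun p : Σ n, A n => c p.1 p.2).toFinset
    (fun k => if hk : ∃ p : Σ n, A n, c p.1 p.2 = k then d hk.choose.1 hk.choose.2 else 0)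
  refine ⟨g, hg, fun n a => ?_⟩
  have hk : ∃ p : Σ n, A n, c p.1 p.2 = c n a := ⟨⟨n, a⟩, rfl⟩
  rw [h _ (by simpa using hk), dif_pos hk]
  exact hcd _ _ _ _ hk.choose_spec

theorem isRecursive_of_finite [Arithmetization L] [Arithmetization L']
    [Finite (Σ n, L.Functions n)] [Finite (Σ n, L.Relations n)] : I.IsRecursive := by
  refine ⟨exists_computable_of_finite (fun _ R => Arithmetization.relCode R)
      (fun _ R => code (I.rel R)) ?_,
    exists_computable_of_finite (fun _ f => Arithmetization.funcCode f)
      (fun _ f => code (I.func f)) ?_⟩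
  · intro n a m b h
    have ha := (Arithmetization.relArity_eq_some (L := L) _ n).2 ⟨a, rfl⟩
    have hb := (Arithmetization.relArity_eq_some (L := L) _ m).2 ⟨b, rfl⟩
    rw [h, hb] at ha
    obtain rfl := Option.some.inj ha
    rw [Arithmetization.relCode_injective _ h]
  · intro n a m b h
    have ha := (Arithmetization.funcArity_eq_some (L := L) _ n).2 ⟨a, rfl⟩
    have hb := (Arithmetization.funcArity_eq_some (L := L) _ m).2 ⟨b, rfl⟩
    rw [h, hb] at ha
    obtain rfl := Option.some.inj ha
    rw [Arithmetization.funcCode_injective _ h]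

/-- `I` is an interpretation of `T` in `S`: `S` proves that the translations of the function symbols
are total on `δ`, and `S` proves the translations of all theorems of `T` (the axioms of equality are
among these). -/
def IsInterpretation (T : L.Theory) (S : L'.Theory) : Prop :=
  (∀ (k : ℕ) (f : L.Functions k), Proves S (I.total f)) ∧
  ∀ φ : L.Sentence, Proves T φ → Proves S (I.onFm (n := 0) φ)

end Translation

/-- `T` is interpretable in `S`. -/
def Interpretable [Arithmetization L] [Arithmetization L'] (T : L.Theory) (S : L'.Theory) : Prop :=
  ∃ I : Translation L L', I.IsRecursive ∧ I.IsInterpretation T S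

/-- Gödel's first incompleteness theorem holds for `T`: every recursively axiomatizable consistent
theory (in any arithmetized language) in which `T` is interpretable is incomplete. -/
def G1Holds [Arithmetization L] (T : L.Theory) : Prop :=
  ∀ (L' : FirstOrder.Language.{u, v}) [Arithmetization L'] (S : L'.Theory),
    RecursivelyAxiomatizable S → Consistent S → Interpretable T S → Incomplete S

end Interpretation

end G1

namespace G1

open FirstOrder.Language

universe u v w

/-! ### Simultaneous substitution, and closure of provability under it -/

section Substitution

variable {L : FirstOrder.Language.{u, v}} {T : L.Theory}

/-! The three properties are proved equivalent in a cycle.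

(1) ⇒ (2) holds because the identity translation is recursive and interprets `T` in every extension
of `T` in the same language.

(2) ⇒ (3) is Lindenbaum's argument. If a consistent extension `S` of `T` were decidable, one could
run through the sentences in the order of their codes and add each one that `S` together with the
earlier choices does not refute. Each choice is a question about provability in `S`, so the
resulting consistent complete extension is recursive, contradicting (2). The carriers are
`recursiveSet_lindenbaumExtension`, `consistent_lindenbaumExtension` and
`not_incomplete_lindenbaumExtension`.

(3) ⇒ (1): suppose that `I` interprets `T` in a consistent, recursively axiomatizable, complete
theory `S`. Let `M` be a model of `S`; by completeness of `S`, truth in `M` is provability in `S`.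
In `M` the translation defines an `L`-structure `N`, the quotient of the domain formula by the
translated equality (`IsInterpretation.exists_defines`), and `N ⊨ φ` iff `M ⊨ φ^I` iff `S ⊢ φ^I`. So
the theory of `N` is a consistent extension of `T`. It can be enumerated, and it contains exactly
one of `φ` and `¬φ`, so it is recursive by Post's theorem (`recursiveSet_of_defines`). This
contradicts (3).

To enumerate the theory of `N`, the map `φ ↦ φ^I`, with its unravelling of nested terms, is never
computed on codes. The relation `Unnested` pairs formulas whose atoms are already flat with their
translations; it is generated by simple rules, hence enumerable. Then `N ⊨ φ` iff some unnested pair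
`(φ', ψ)` satisfies `⊢ φ' → φ` and `S ⊢ ψ`; the identity translation supplies a suitable `φ'` for
every `φ`.

Two bodies of general theory support this: soundness and completeness of the calculus
(`Proves.sound`, `proves_of_models`), which replace formal derivations by arguments in models, and
an arithmetization of syntax leading to the enumeration of theorems (`isEnumerable_theorems`). -/

@[simp] theorem substTm_tvar {m n : ℕ} (σ : Fin m → Tm L n) (i : Fin m) :
    substTm σ (tvar i) = σ i := rfl

theorem substTm_func {m n k : ℕ} (σ : Fin m → Tm L n) (f : L.Functions k) (ts : Fin k → Tm L m) :
    substTm σ (Term.func f ts) = Term.func f fun i => substTm σ (ts i) := rfl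

theorem substTm_substTm {m n k : ℕ} (τ : Fin n → Tm L k) (σ : Fin m → Tm L n) (t : Tm L m) :
    substTm τ (substTm σ t) = substTm (fun i => substTm τ (σ i)) t := by
  induction t with
  | var x =>
    rcases x with e | i
    · exact e.elim
    · rfl
  | func f ts ih => simp only [substTm_func, ih]

theorem substTm_id {n : ℕ} (t : Tm L n) : substTm tvar t = t := by
  induction t with
  | var x =>
    rcases x with e | i
    · exact e.elim
    · rfl
  | func f ts ih => simp only [substTm_func, ih]

theorem relabel_castSucc {n : ℕ} (t : Tm L n) :
    (t.relabel (Sum.map id Fin.castSucc) : Tm L (n + 1)) =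
      substTm (fun i => tvar i.castSucc) t := by
  induction t with
  | var x =>
    rcases x with e | i
    · exact e.elim
    · rfl
  | func f ts ih => simp only [substTm_func, Term.relabel, ih]

theorem liftSubst_castSucc {m n : ℕ} (σ : Fin m → Tm L n) (i : Fin m) :
    liftSubst σ i.castSucc = substTm (fun i => tvar i.castSucc) (σ i) := by
  simp [liftSubst, relabel_castSucc]

@[simp] theorem liftSubst_last {m n : ℕ} (σ : Fin m → Tm L n) :
    liftSubst σ (Fin.last m) = tvar (Fin.last n) := by
  simp [liftSubst]

theorem substTm_liftSubst {m n k : ℕ} (τ : Fin n → Tm L k) (σ : Fin m → Tm L n) :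
    (fun i => substTm (liftSubst τ) (liftSubst σ i)) = liftSubst fun i => substTm τ (σ i) := by
  funext i
  refine Fin.lastCases ?_ (fun i => ?_) i
  · simp
  · simp only [liftSubst_castSucc, substTm_substTm, substTm_tvar]

theorem liftSubst_tvar {n : ℕ} : liftSubst (tvar : Fin n → Tm L n) = tvar := by
  funext i
  refine Fin.lastCases ?_ (fun i => ?_) i
  · simp
  · simp [liftSubst_castSucc]

/-- Lifting commutes with composition (`substTm_liftSubst`). The substitutions stay universally
quantified in the induction because the contexts change under a quantifier. -/
theorem substFm_substFm {m : ℕ} (φ : Fm L m) : ∀ {n k : ℕ} (τ : Fin n → Tm L k)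
    (σ : Fin m → Tm L n), substFm τ (substFm σ φ) = substFm (fun i => substTm τ (σ i)) φ := by
  induction φ with
  | falsum => intros; rfl
  | equal t s => intros; simp only [substFm, substTm_substTm]
  | rel R ts => intros; simp only [substFm, substTm_substTm]
  | imp φ ψ ih₁ ih₂ => intros; simp only [substFm, ih₁, ih₂]
  | all φ ih => intros; simp only [substFm, ih, substTm_liftSubst]

theorem substFm_id {n : ℕ} (φ : Fm L n) : substFm tvar φ = φ := by
  induction φ with
  | falsum => rfl
  | equal t s => simp only [substFm, substTm_id]
  | rel R ts => simp only [substFm, substTm_id]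
  | imp φ ψ ih₁ ih₂ => simp only [substFm, ih₁, ih₂]
  | all φ ih => simp only [substFm, liftSubst_tvar, ih]

theorem weaken_substFm {m n : ℕ} (σ : Fin m → Tm L n) (φ : Fm L m) :
    weaken (substFm σ φ) = substFm (liftSubst σ) (weaken φ) := by
  simp only [weaken, substFm_substFm, substTm_tvar, liftSubst_castSucc]

theorem inst_substFm {m n : ℕ} (τ : Fin (m + 1) → Tm L (n + 1)) (φ : Fm L (m + 1)) (t : Tm L n) :
    inst (substFm τ φ) t = substFm (fun i => substTm (Fin.snoc (α := fun _ => Tm L n) tvar t)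
      (τ i)) φ := by
  simp only [inst, substFm_substFm]

theorem substTm_snoc_castSucc {n : ℕ} (s t : Tm L n) :
    substTm (Fin.snoc (α := fun _ => Tm L n) tvar t)
      (substTm (fun i => tvar i.castSucc) s) = s := by
  rw [substTm_substTm]
  simp [substTm_id]

/-- Lifting leaves a free slot for the last variable, and instantiation fills it with `t`. This is
how a universal formula under an assignment of variables is instantiated in the Henkin construction.
-/
theorem inst_liftSubst {m n : ℕ} (σ : Fin m → Tm L n) (φ : Fm L (m + 1)) (t : Tm L n) :
    inst (substFm (liftSubst σ) φ) t = substFm (Fin.snoc (α := fun _ => Tm L n) σ t) φ := by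
  rw [inst_substFm]
  congr 1
  funext i
  refine Fin.lastCases ?_ (fun i => ?_) i
  · simp
  · simp [liftSubst_castSucc, substTm_snoc_castSucc]

theorem substFm_inst {m n : ℕ} (σ : Fin m → Tm L n) (φ : Fm L (m + 1)) (t : Tm L m) :
    substFm σ (inst φ t) = inst (substFm (liftSubst σ) φ) (substTm σ t) := by
  rw [inst_liftSubst, inst, substFm_substFm]
  congr 1
  funext i
  refine Fin.lastCases ?_ (fun i => ?_) i
  · simp
  · simp

theorem substFm_ofSentence {m n : ℕ} (σ : Fin m → Tm L n) (φ : L.Sentence) :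
    substFm σ (ofSentence m φ) = ofSentence n φ := by
  simp only [ofSentence, substFm_substFm]
  congr 1
  funext i
  exact i.elim0

theorem ofSentence_zero (φ : L.Sentence) : ofSentence 0 φ = φ := by
  have h : (fun i : Fin 0 => i.elim0) = (tvar : Fin 0 → Tm L 0) := funext fun i => i.elim0
  rw [ofSentence, h, substFm_id]

/-- Provability is closed under substitution. -/
theorem Provable.subst {m : ℕ} {φ : Fm L m} (h : Provable T φ) :
    ∀ {n : ℕ} (σ : Fin m → Tm L n), Provable T (substFm σ φ) := by
  induction h with
  | ax n hφ => intro k σ; rw [substFm_ofSentence]; exact .ax _ hφ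
  | imp_intro φ ψ => intro k σ; exact .imp_intro _ _
  | imp_distrib φ ψ χ => intro k σ; exact .imp_distrib _ _ _
  | not_not_elim φ => intro k σ; exact .not_not_elim _
  | all_elim φ t =>
    intro k σ
    simp only [substFm, substFm_inst]
    exact .all_elim _ _
  | all_distrib φ ψ =>
    intro k σ
    simp only [substFm, ← weaken_substFm]
    exact .all_distrib _ _
  | exists_self n =>
    intro k σ
    have := Provable.exists_self (T := T) k
    simpa only [BoundedFormula.ex, BoundedFormula.not, substFm, substTm_tvar, liftSubst_last,
      Bot.bot] using this
  | eq_refl t => intro k σ; exact .eq_refl _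
  | eq_subst φ t s =>
    intro k σ
    simp only [substFm, substFm_inst]
    exact .eq_subst _ _ _
  | mp _ _ ih₁ ih₂ => intro k σ; exact .mp (ih₁ σ) (ih₂ σ)
  | gen _ ih => intro k σ; exact .gen (ih _)

end Substitution

/-! ### Propositional derivations and the deduction theorem -/

section Deduction

variable {L : FirstOrder.Language.{u, v}} {T : L.Theory} {n : ℕ} {θ φ ψ χ : Fm L n}

theorem Provable.imp_const (h : Provable T φ) (θ : Fm L n) : Provable T (θ.imp φ) :=
  .mp (.imp_intro _ _) h

theorem Provable.imp_mp (h₁ : Provable T (θ.imp (φ.imp ψ))) (h₂ : Provable T (θ.imp φ)) :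
    Provable T (θ.imp ψ) :=
  .mp (.mp (.imp_distrib _ _ _) h₁) h₂

theorem Provable.imp_self (θ : Fm L n) : Provable T (θ.imp θ) :=
  .imp_mp (ψ := θ) (φ := θ.imp θ) (.imp_intro _ _) (.imp_intro _ _)

theorem Provable.imp_trans (h₁ : Provable T (θ.imp φ)) (h₂ : Provable T (φ.imp ψ)) :
    Provable T (θ.imp ψ) :=
  .imp_mp (h₂.imp_const _) h₁

theorem Provable.imp_swap (h : Provable T (θ.imp (φ.imp ψ))) : Provable T (φ.imp (θ.imp ψ)) :=
  .imp_trans (.imp_intro _ _) (.mp (.imp_distrib _ _ _) h)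

theorem Provable.ex_falso (φ : Fm L n) : Provable T ((⊥ : Fm L n).imp φ) :=
  .imp_trans (.imp_intro _ _) (.not_not_elim _)

theorem Provable.imp_comp (h : Provable T (φ.imp ψ)) (χ : Fm L n) :
    Provable T ((ψ.imp χ).imp (φ.imp χ)) :=
  .imp_swap (.imp_trans h (.imp_swap (.imp_self _)))

theorem Provable.by_contra (h : Provable T (φ.not.imp ⊥)) : Provable T φ :=
  .mp (.not_not_elim _) h

/-- The conjunction unfolds to `¬(φ → ¬ψ)`, and `¬φ` yields `φ → ¬ψ` by ex falso. -/
theorem Provable.and_left (φ ψ : Fm L n) : Provable T ((φ ⊓ ψ).imp φ) := by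
  have h : Provable T (φ.not.imp (φ.imp ψ.not)) :=
    .imp_swap (.imp_trans (.imp_swap (.imp_self φ.not))
      (.mp (.imp_distrib _ _ _) (.imp_const (.ex_falso _) _)))
  exact .imp_trans (.imp_comp h _) (.not_not_elim _)

theorem Provable.and_right (φ ψ : Fm L n) : Provable T ((φ ⊓ ψ).imp ψ) :=
  .imp_trans (.imp_comp (.imp_intro ψ.not φ) _) (.not_not_elim _)

theorem Provable.and_intro (φ ψ : Fm L n) : Provable T (φ.imp (ψ.imp (φ ⊓ ψ))) := by
  exact .imp_trans (.imp_swap (.imp_self (φ.imp ψ.not)))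
    (.imp_trans (.imp_distrib _ _ _) (.imp_comp (.imp_intro _ _) _))

theorem Provable.curry (h : Provable T ((θ ⊓ φ).imp ψ)) : Provable T (θ.imp (φ.imp ψ)) :=
  .imp_trans (.and_intro θ φ) (.mp (.imp_distrib _ _ _) (h.imp_const _))

theorem Provable.gen_imp {ψ : Fm L (n + 1)} (h : Provable T ((weaken φ).imp ψ)) :
    Provable T (φ.imp ψ.all) :=
  .mp (.all_distrib _ _) (.gen h)

/-- The domain is nonempty, so a dummy variable can be dropped. -/
theorem Provable.of_weaken_imp_bot (h : Provable T ((weaken φ).imp ⊥)) : Provable T (φ.imp ⊥) :=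
  -- By `h`, the formula `φ` implies `∀ x, ¬ x = x`, which is what `exists_self` denies.
  .imp_mp ((Provable.exists_self n).imp_const _)
    (.gen_imp (.imp_trans h (.ex_falso _)))

theorem weaken_ofSentence (n : ℕ) (φ : L.Sentence) :
    weaken (ofSentence n φ) = ofSentence (n + 1) φ := substFm_ofSentence _ _

theorem Proves.ofSentence_imp {θ φ : L.Sentence} (h : Proves T (θ.imp φ)) (n : ℕ) :
    Provable T ((ofSentence n θ).imp (ofSentence n φ)) :=
  Provable.subst h _

/-- If every axiom of `S` follows in `T` from some member of a directed family of sentences, then so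
does every theorem of `S`. -/
theorem Provable.directed_deduction {ι : Type*} [LinearOrder ι] [Nonempty ι] {S : L.Theory}
    (Θ : ι → L.Sentence) (hmono : ∀ i j, i ≤ j → Proves T ((Θ j).imp (Θ i)))
    (hax : ∀ φ ∈ S, ∃ i, Proves T ((Θ i).imp φ)) {n : ℕ} {φ : Fm L n} (h : Provable S φ) :
    ∃ i, Provable T ((ofSentence n (Θ i)).imp φ) := by
  obtain ⟨i₀⟩ := ‹Nonempty ι›
  induction h with
  | ax n hφ => exact (hax _ hφ).imp fun i hi => hi.ofSentence_imp _
  | imp_intro φ ψ => exact ⟨i₀, .imp_const (.imp_intro _ _) _⟩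
  | imp_distrib φ ψ χ => exact ⟨i₀, .imp_const (.imp_distrib _ _ _) _⟩
  | not_not_elim φ => exact ⟨i₀, .imp_const (.not_not_elim _) _⟩
  | all_elim φ t => exact ⟨i₀, .imp_const (.all_elim _ _) _⟩
  | all_distrib φ ψ => exact ⟨i₀, .imp_const (.all_distrib _ _) _⟩
  | exists_self n => exact ⟨i₀, .imp_const (.exists_self _) _⟩
  | eq_refl t => exact ⟨i₀, .imp_const (.eq_refl _) _⟩
  | eq_subst φ t s => exact ⟨i₀, .imp_const (.eq_subst _ _ _) _⟩
  | mp _ _ ih₁ ih₂ =>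
    obtain ⟨i, hi⟩ := ih₁
    obtain ⟨j, hj⟩ := ih₂
    -- The two premises may rest on different members of the family; the one with the larger index
    -- implies both.
    exact ⟨max i j, .imp_mp (.imp_trans ((hmono i _ (le_max_left i j)).ofSentence_imp _) hi)
      (.imp_trans ((hmono j _ (le_max_right i j)).ofSentence_imp _) hj)⟩
  | gen _ ih =>
    obtain ⟨i, hi⟩ := ih
    -- `Θ i` is a sentence, hence invariant under weakening, so generalization passes under the
    -- implication.
    exact ⟨i, .gen_imp (by rwa [weaken_ofSentence])⟩

/-- The deduction theorem: `Provable.directed_deduction` for a constant family. -/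
theorem Provable.of_insert {θ : L.Sentence} {n : ℕ} {φ : Fm L n} (h : Provable (insert θ T) φ) :
    Provable T ((ofSentence n θ).imp φ) := by
  obtain ⟨_, h⟩ := h.directed_deduction (T := T) (fun _ : Unit => θ)
    (fun _ _ _ => .imp_self _) fun φ hφ => ⟨(), by
      rcases hφ with rfl | hφ
      · exact .imp_self _
      · exact .imp_const (by simpa only [ofSentence_zero] using Provable.ax (T := T) 0 hφ) _⟩
  exact h

theorem Proves.of_mem {φ : L.Sentence} (h : φ ∈ T) : Proves T φ := by
  have := Provable.ax (T := T) 0 h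
  rwa [ofSentence_zero] at this

end Deduction

/-! ### Soundness of the calculus -/

section Soundness

variable {L : FirstOrder.Language.{u, v}} {T : L.Theory} {M : Type w} [L.Structure M]

/-- The value of a term under an assignment of the variables `x₀, …, x_{n-1}`. -/
abbrev evalTm {n : ℕ} (t : Tm L n) (v : Fin n → M) : M := t.realize (Sum.elim default v)

/-- Truth of a formula under an assignment of the variables `x₀, …, x_{n-1}`. -/
abbrev Sat {n : ℕ} (φ : Fm L n) (v : Fin n → M) : Prop := φ.Realize default v

@[simp] theorem evalTm_tvar {n : ℕ} (i : Fin n) (v : Fin n → M) :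
    evalTm (tvar i : Tm L n) v = v i := rfl

theorem evalTm_substTm {m n : ℕ} (σ : Fin m → Tm L n) (t : Tm L m) (v : Fin n → M) :
    evalTm (substTm σ t) v = evalTm t fun i => evalTm (σ i) v := by
  rw [evalTm, substTm, Term.realize_subst]
  congr 1
  funext x
  rcases x with e | i
  · exact e.elim
  · rfl

theorem evalTm_liftSubst {m n : ℕ} (σ : Fin m → Tm L n) (v : Fin n → M) (a : M) :
    (fun i => evalTm (liftSubst σ i) (Fin.snoc v a : Fin (n + 1) → M)) =
      (Fin.snoc (fun i => evalTm (σ i) v) a : Fin (m + 1) → M) := by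
  funext i
  refine Fin.lastCases ?_ (fun i => ?_) i
  · simp
  · simp [liftSubst_castSucc, evalTm_substTm]

-- The substitution lemma; under a quantifier it reduces to `evalTm_liftSubst`, which is where the
-- absence of capture enters.
@[simp] theorem sat_substFm {m : ℕ} (φ : Fm L m) : ∀ {n : ℕ} (σ : Fin m → Tm L n) (v : Fin n → M),
    Sat (substFm σ φ) v ↔ Sat φ fun i => evalTm (σ i) v := by
  induction φ with
  | falsum => intros; rfl
  | equal t s =>
    intro n σ v
    exact Eq.congr (evalTm_substTm σ t v) (evalTm_substTm σ s v)
  | rel R ts =>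
    intro n σ v
    have h : (fun i => evalTm (substTm σ (ts i)) v) =
        fun i => evalTm (ts i) fun i => evalTm (σ i) v := funext fun i => evalTm_substTm σ (ts i) v
    exact iff_of_eq (congrArg _ h)
  | imp φ ψ ih₁ ih₂ => intro n σ v; exact imp_congr (ih₁ σ v) (ih₂ σ v)
  | all φ ih =>
    intro n σ v
    refine forall_congr' fun a => ?_
    rw [← evalTm_liftSubst]
    exact ih _ _

theorem sat_inst {n : ℕ} (φ : Fm L (n + 1)) (t : Tm L n) (v : Fin n → M) :
    Sat (inst φ t) v ↔ Sat φ (Fin.snoc v (evalTm t v) : Fin (n + 1) → M) := by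
  rw [inst, sat_substFm]
  have h : (fun i => evalTm (Fin.snoc (α := fun _ => Tm L n) tvar t i) v) =
      (Fin.snoc v (evalTm t v) : Fin (n + 1) → M) := by
    funext i
    refine Fin.lastCases ?_ (fun i => ?_) i <;> simp
  rw [h]

theorem sat_weaken {n : ℕ} (φ : Fm L n) (v : Fin n → M) (a : M) :
    Sat (weaken φ) (Fin.snoc v a : Fin (n + 1) → M) ↔ Sat φ v := by
  simp [weaken]

theorem sat_ofSentence {n : ℕ} (φ : L.Sentence) (v : Fin n → M) :
    Sat (ofSentence n φ) v ↔ M ⊨ φ := by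
  rw [ofSentence, sat_substFm, Sentence.Realize, Formula.Realize, Subsingleton.elim (fun _ => _)]

theorem Provable.sound [Nonempty M] (hM : ∀ φ ∈ T, M ⊨ φ) {n : ℕ} {φ : Fm L n}
    (h : Provable T φ) : ∀ v : Fin n → M, Sat φ v := by
  induction h with
  | ax n hφ => intro v; rw [sat_ofSentence]; exact hM _ hφ
  | imp_intro φ ψ => intro v h _; exact h
  | imp_distrib φ ψ χ => intro v h₁ h₂ h; exact h₁ h (h₂ h)
  | not_not_elim φ => intro v h; exact not_not.1 h
  | all_elim φ t => intro v h; exact (sat_inst _ _ _).2 (h _)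
  | all_distrib φ ψ => intro v h₁ h a; exact h₁ a ((sat_weaken _ _ _).2 h)
  | exists_self n =>
    intro v
    obtain ⟨a⟩ := ‹Nonempty M›
    exact BoundedFormula.realize_ex.2 ⟨a, rfl⟩
  | eq_refl t => intro v; rfl
  | eq_subst φ t s =>
    intro v (h : evalTm t v = evalTm s v)
    change Sat (inst φ t) v → Sat (inst φ s) v
    rw [sat_inst, sat_inst, h]
    exact id
  | mp _ _ ih₁ ih₂ => intro v; exact ih₁ v (ih₂ v)
  | gen _ ih => intro v a; exact ih _

theorem Proves.sound [Nonempty M] (hM : ∀ φ ∈ T, M ⊨ φ) {φ : L.Sentence} (h : Proves T φ) :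
    M ⊨ φ := by
  have := Provable.sound hM h default
  exact this

end Soundness

end G1

namespace G1

open FirstOrder.Language Filter

universe u v w

/-! ### Derived rules for equality -/

section Equality

variable {L : FirstOrder.Language.{u, v}} {T : L.Theory}

/-- Replacement of equals by equals, simultaneously for all free variables. -/
theorem Provable.leibniz {n k : ℕ} {θ : Fm L k} {σ τ : Fin n → Tm L k}
    (h : ∀ i, Provable T (θ.imp (.equal (σ i) (τ i)))) (φ : Fm L n)
    (hφ : Provable T (θ.imp (substFm σ φ))) : Provable T (θ.imp (substFm τ φ)) := by
  classical
  -- The axiom `eq_subst` replaces in one variable only, so the variables are treated one at a time: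
  -- those in `s` have already been moved from `σ` to `τ`.
  have key : ∀ s : Finset (Fin n),
      Provable T (θ.imp (substFm (fun i => if i ∈ s then τ i else σ i) φ)) := by
    intro s
    induction s using Finset.induction with
    | empty => simpa using hφ
    | insert a s ha ih =>
      -- A fresh variable `x_k` sits at position `a`; instantiating it by `σ a` or by `τ a` gives
      -- the formula before or after this replacement.
      let ρ : Fin n → Tm L (k + 1) := fun i => if i = a then tvar (Fin.last k) else
        substTm (fun i => tvar i.castSucc) (if i ∈ s then τ i else σ i)
      have h₁ : inst (substFm ρ φ) (σ a) =
          substFm (fun i => if i ∈ s then τ i else σ i) φ := by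
        rw [inst, substFm_substFm]
        congr 1
        funext i
        by_cases hi : i = a
        · subst hi
          simp [ρ, ha]
        · simp [ρ, hi, substTm_snoc_castSucc]
      have h₂ : inst (substFm ρ φ) (τ a) =
          substFm (fun i => if i ∈ insert a s then τ i else σ i) φ := by
        rw [inst, substFm_substFm]
        congr 1
        funext i
        by_cases hi : i = a
        · subst hi
          simp [ρ]
        · simp [ρ, hi, substTm_snoc_castSucc]
      have h₃ := Provable.eq_subst (T := T) (substFm ρ φ) (σ a) (τ a)
      rw [h₁, h₂] at h₃
      exact .imp_mp (.imp_trans (h a) h₃) ih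
  simpa using key Finset.univ

/-- Leibniz for `x₀ = x₁`: the pair `(t, t)` becomes `(s, t)`. -/
theorem Provable.imp_eq_symm {k : ℕ} {θ : Fm L k} {t s : Tm L k}
    (h : Provable T (θ.imp (.equal t s))) : Provable T (θ.imp (.equal s t)) := by
  have := Provable.leibniz (T := T) (θ := θ) (σ := ![t, t]) (τ := ![s, t])
    (by
      intro i
      fin_cases i
      · exact h
      · exact .imp_const (.eq_refl _) _)
    (.equal (tvar 0) (tvar 1)) (.imp_const (.eq_refl _) _)
  exact this

/-- Leibniz for `x₀ = x₁`: the pair `(t, s)` becomes `(t, r)`. -/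
theorem Provable.imp_eq_trans {k : ℕ} {θ : Fm L k} {t s r : Tm L k}
    (h₁ : Provable T (θ.imp (.equal t s))) (h₂ : Provable T (θ.imp (.equal s r))) :
    Provable T (θ.imp (.equal t r)) := by
  have := Provable.leibniz (T := T) (θ := θ) (σ := ![t, s]) (τ := ![t, r])
    (by
      intro i
      fin_cases i
      · exact .imp_const (.eq_refl _) _
      · exact h₂)
    (.equal (tvar 0) (tvar 1)) h₁
  exact this

end Equality

/-! ### Completeness: Henkin chains of formulas in growing contexts -/

section Henkin

variable {L : FirstOrder.Language.{u, v}} {T : L.Theory}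

/-- If `θ` does not refute `φ`, add `φ`. If it refutes `φ = ∀χ`, add `¬χ` for the new variable
`x_k`: were this inconsistent, `θ` would imply `χ(x_k)` without mentioning `x_k`, hence `∀χ`. Since
each step enlarges the context by one, variables serve as Henkin witnesses and the language is never
extended. -/
theorem exists_henkin_step {k : ℕ} (θ : Fm L k) (hθ : ¬ Provable T (θ.imp ⊥)) (φ : Fm L k) :
    ∃ θ' : Fm L (k + 1), ¬ Provable T (θ'.imp ⊥) ∧ Provable T (θ'.imp (weaken θ)) ∧
      (Provable T (θ'.imp (weaken φ)) ∨ Provable T (θ'.imp (weaken φ).not) ∧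
        ∀ χ, φ = .all χ → Provable T (θ'.imp χ.not)) := by
  by_cases h : Provable T (θ.imp φ.not)
  · by_cases hχ : ∃ χ, φ = .all χ
    · obtain ⟨χ, rfl⟩ := hχ
      refine ⟨weaken θ ⊓ χ.not, fun hbot => hθ ?_, .and_left _ _, .inr ⟨?_, ?_⟩⟩
      · exact .imp_mp h (.gen_imp (.imp_trans hbot.curry (.not_not_elim _)))
      · exact .imp_trans (.and_left _ _) (h.subst _)
      · rintro χ' h'
        cases h'
        exact .and_right _ _
    · refine ⟨weaken θ, fun hbot => hθ hbot.of_weaken_imp_bot, .imp_self _, .inr ⟨h.subst _, ?_⟩⟩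
      exact fun χ h' => absurd ⟨χ, h'⟩ hχ
  · refine ⟨weaken (θ ⊓ φ), fun hbot => h hbot.of_weaken_imp_bot.curry, ?_, .inl ?_⟩
    · exact .and_left _ _
    · exact .and_right _ _

/-- The formulas of a context embedded into a larger context. -/
def embed {n k : ℕ} (h : n ≤ k) (φ : Fm L n) : Fm L k :=
  substFm (fun i => tvar (Fin.castLE h i)) φ

/-- A sequence of consistent formulas in growing contexts which decides all formulas and
provides all falsified universal formulas with counterexamples among the variables. -/
structure HenkinChain (T : L.Theory) where
  seq : ∀ k, Fm L k
  consistent : ∀ k, ¬ Provable T ((seq k).imp ⊥)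
  mono : ∀ k, Provable T ((seq (k + 1)).imp (weaken (seq k)))
  decides : ∀ {n : ℕ} (φ : Fm L n), ∃ k, ∃ h : n ≤ k,
    Provable T ((seq (k + 1)).imp (weaken (embed h φ))) ∨
    Provable T ((seq (k + 1)).imp (weaken (embed h φ)).not) ∧
      ∀ χ, embed h φ = .all χ → Provable T ((seq (k + 1)).imp χ.not)

theorem exists_henkinChain [∀ n, Countable (Fm L n)] (hT : Consistent T) :
    Nonempty (HenkinChain T) := by
  have hsurj : ∀ n, ∃ d : ℕ → Fm L n, Function.Surjective d := fun n => exists_surjective_nat _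
  choose d hd using hsurj
  choose step hstep₁ hstep₂ hstep₃ using @exists_henkin_step L T
  -- Stage `k = Nat.pair n c` treats the `c`-th formula in context `n`; since `n ≤ k`, that formula
  -- embeds into the current context.
  let target : ∀ k, Fm L k := fun k => embed (Nat.unpair_left_le k) (d k.unpair.1 k.unpair.2)
  let chain : ∀ k, {θ : Fm L k // ¬ Provable T (θ.imp ⊥)} := fun k =>
    Nat.rec ⟨⊤, fun h => hT (.mp h (.imp_self _))⟩
      (fun k θ => ⟨step θ.1 θ.2 (target k), hstep₁ _ _ _⟩) k
  refine ⟨⟨fun k => (chain k).1, fun k => (chain k).2, fun k => hstep₂ _ _ _, fun {n} φ => ?_⟩⟩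
  obtain ⟨c, hc⟩ := hd n φ
  have h₁ : n = (Nat.pair n c).unpair.1 := by simp
  have h₂ : c = (Nat.pair n c).unpair.2 := by simp
  -- The type of `φ` depends on `n`, so `n` cannot be rewritten directly to the unpaired component;
  -- the equation is stated for general `n'`, `c'` and proved by substitution.
  have key : ∀ n' c' (h' : n' ≤ Nat.pair n c), n = n' → c = c' →
      embed (Nat.left_le_pair n c) φ = embed h' (d n' c') := by
    rintro n' c' h' rfl rfl
    rw [hc]
  refine ⟨Nat.pair n c, Nat.left_le_pair _ _, ?_⟩
  rw [key _ _ (Nat.unpair_left_le _) h₁ h₂]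
  exact hstep₃ _ _ _

/-! ### The term model of a Henkin chain -/

namespace HenkinChain

/-- A sequence of variables as a substitution. -/
def vars {n k : ℕ} (v : Fin n → ℕ) (h : ∀ i, v i < k) : Fin n → Tm L k := fun i => tvar ⟨v i, h i⟩

theorem vars_snoc {n k : ℕ} (v : Fin n → ℕ) (h : ∀ i, v i < k) (j : ℕ) (hj : j < k)
    (h' : ∀ i, (Fin.snoc v j : Fin (n + 1) → ℕ) i < k) :
    (vars (Fin.snoc v j) h' : Fin (n + 1) → Tm L k) =
      Fin.snoc (α := fun _ => Tm L k) (vars v h) (tvar ⟨j, hj⟩) := by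
  funext i
  refine Fin.lastCases ?_ (fun i => ?_) i <;> simp [vars]

theorem snoc_lt {n k : ℕ} {v : Fin n → ℕ} (h : ∀ i, v i < k) {j : ℕ} (hj : j < k) :
    ∀ i, (Fin.snoc v j : Fin (n + 1) → ℕ) i < k := by
  intro i
  refine Fin.lastCases ?_ (fun i => ?_) i
  · simpa
  · simpa using h i

theorem weaken_substFm_vars {n k : ℕ} (v : Fin n → ℕ) (h : ∀ i, v i < k) (φ : Fm L n) :
    weaken (substFm (vars v h) φ) =
      substFm (vars v fun i => (h i).trans (Nat.lt_succ_self k)) φ := by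
  rw [weaken, substFm_substFm]
  rfl

theorem embed_substFm_vars {n k m : ℕ} (v : Fin n → ℕ) (h : ∀ i, v i < k) (hk : k ≤ m)
    (φ : Fm L n) :
    embed hk (substFm (vars v h) φ) = substFm (vars v fun i => (h i).trans_le hk) φ := by
  rw [embed, substFm_substFm]
  rfl

theorem liftSubst_vars {n k : ℕ} (v : Fin n → ℕ) (h : ∀ i, v i < k) :
    liftSubst (vars v h : Fin n → Tm L k) = vars (Fin.snoc v k : Fin (n + 1) → ℕ)
      (snoc_lt (fun i => (h i).trans (Nat.lt_succ_self k)) (Nat.lt_succ_self k)) := by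
  funext i
  refine Fin.lastCases ?_ (fun i => ?_) i
  · simp [vars]; rfl
  · simp [liftSubst_castSucc, vars]

theorem eventually_lt {n : ℕ} (v : Fin n → ℕ) : ∀ᶠ k in atTop, ∀ i, v i < k :=
  eventually_all.2 fun i => eventually_gt_atTop (v i)

variable (C : HenkinChain T)

/-- The formula `φ` is eventually forced when `x_{v i}` is substituted for `x_i`. -/
def Forces {n : ℕ} (φ : Fm L n) (v : Fin n → ℕ) : Prop :=
  ∀ᶠ k in atTop, ∀ h : ∀ i, v i < k, Provable T ((C.seq k).imp (substFm (vars v h) φ))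

/-- It is eventually forced that the value of `t` is `x_j`, when `x_{v i}` is substituted
for `x_i`. -/
def ForcesVal {n : ℕ} (t : Tm L n) (v : Fin n → ℕ) (j : ℕ) : Prop :=
  ∀ᶠ k in atTop, ∀ (h : ∀ i, v i < k) (hj : j < k),
    Provable T ((C.seq k).imp (.equal (substTm (vars v h) t) (tvar ⟨j, hj⟩)))

variable {C}

/-- The stages grow in strength, so what one of them implies, all later ones imply. -/
theorem Forces.of_stage {n : ℕ} {φ : Fm L n} {v : Fin n → ℕ} (k : ℕ) (h : ∀ i, v i < k)
    (hφ : Provable T ((C.seq k).imp (substFm (vars v h) φ))) : C.Forces φ v := by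
  refine eventually_atTop.2 ⟨k, fun m hm => ?_⟩
  induction m, hm using Nat.le_induction with
  | base => exact fun _ => hφ
  | succ m hm ih =>
    intro _
    have := (ih fun i => (h i).trans_le hm).subst fun i => tvar i.castSucc
    refine .imp_trans (C.mono m) ?_
    rw [← weaken_substFm_vars v (fun i => (h i).trans_le hm)]
    exact this

theorem Forces.of_provable {n : ℕ} {φ : Fm L n} (h : Provable T φ) (v : Fin n → ℕ) :
    C.Forces φ v :=
  Eventually.of_forall fun _ _ => .imp_const (h.subst _) _

theorem Forces.mp {n : ℕ} {φ ψ : Fm L n} {v : Fin n → ℕ} (h₁ : C.Forces (φ.imp ψ) v)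
    (h₂ : C.Forces φ v) : C.Forces ψ v := by
  filter_upwards [h₁, h₂] with k h₁ h₂ h
  exact .imp_mp (h₁ h) (h₂ h)

theorem not_forces_bot {n : ℕ} (v : Fin n → ℕ) : ¬ C.Forces (⊥ : Fm L n) v := by
  intro h
  obtain ⟨k, hk, hv⟩ := (h.and (eventually_lt v)).exists
  exact C.consistent k (hk hv)

/-- After substitution of the variables `v`, the formula lives in one of the contexts of the chain,
and the chain decides it there. -/
theorem forces_or_forces_not {n : ℕ} (φ : Fm L n) (v : Fin n → ℕ) :
    C.Forces φ v ∨ C.Forces φ.not v := by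
  obtain ⟨m, hm⟩ := (eventually_lt v).exists
  obtain ⟨k, hk, h⟩ := C.decides (substFm (vars v hm) φ)
  rw [embed_substFm_vars, weaken_substFm_vars] at h
  rcases h with h | ⟨h, _⟩
  · exact .inl (.of_stage _ _ h)
  · exact .inr (.of_stage _ _ h)

theorem forces_imp {n : ℕ} {φ ψ : Fm L n} {v : Fin n → ℕ} :
    C.Forces (φ.imp ψ) v ↔ (C.Forces φ v → C.Forces ψ v) := by
  refine ⟨Forces.mp, fun h => ?_⟩
  rcases forces_or_forces_not φ v with hφ | hφ
  · exact .mp (.of_provable (.imp_intro _ _) _) (h hφ)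
  · filter_upwards [hφ] with k hφ hv
    exact .imp_trans (hφ hv) (.mp (.imp_distrib _ _ _) (.imp_const (.ex_falso _) _))

theorem forces_all {n : ℕ} {χ : Fm L (n + 1)} {v : Fin n → ℕ} :
    C.Forces χ.all v ↔ ∀ j, C.Forces χ (Fin.snoc v j : Fin (n + 1) → ℕ) := by
  constructor
  · intro h j
    filter_upwards [h, eventually_lt v, eventually_gt_atTop j] with k hk hv hj h'
    have h₁ := Provable.all_elim (T := T) (substFm (liftSubst (vars v hv)) χ) (tvar ⟨j, hj⟩)
    rw [inst_liftSubst, ← vars_snoc v hv j hj h'] at h₁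
    exact .imp_trans (hk hv) h₁
  · intro h
    obtain ⟨m, hm⟩ := (eventually_lt v).exists
    obtain ⟨k, hk, h'⟩ := C.decides (substFm (vars v hm) χ.all)
    rw [embed_substFm_vars, weaken_substFm_vars] at h'
    rcases h' with h' | ⟨_, h'⟩
    · exact .of_stage _ _ h'
    · exfalso
      -- The stage that refutes the universal formula provides `x_k` as a counterexample, against `h
      -- k`.
      have h₁ := h' _ rfl
      rw [liftSubst_vars] at h₁
      have h₂ : C.Forces χ.not (Fin.snoc v k : Fin (n + 1) → ℕ) := .of_stage _ _ h₁
      exact not_forces_bot _ (h₂.mp (h k))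

/-- If `t ≠ x_j` were forced for all `j`, then so would be `∀ y, t ≠ y`; its instance at `t`
contradicts reflexivity. -/
theorem exists_forcesVal {n : ℕ} (t : Tm L n) (v : Fin n → ℕ) : ∃ j, C.ForcesVal t v j := by
  by_contra hcon
  let ε : Fm L (n + 1) := .equal (substTm (fun i => tvar i.castSucc) t) (tvar (Fin.last n))
  have hsub : ∀ {k : ℕ} (h : ∀ i, v i < k) (s : Tm L k),
      substFm (Fin.snoc (α := fun _ => Tm L k) (vars v h) s) ε =
        .equal (substTm (vars v h) t) s := by
    intro k h s
    simp [ε, substFm, substTm_substTm]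
  have h : ∀ j, C.Forces ε.not (Fin.snoc v j : Fin (n + 1) → ℕ) := by
    intro j
    refine (forces_or_forces_not ε _).resolve_left fun hε => hcon ⟨j, ?_⟩
    filter_upwards [hε] with k hk hv hj
    have := hk (snoc_lt hv hj)
    rwa [vars_snoc v hv j hj, hsub] at this
  obtain ⟨k, hk, hv⟩ := ((forces_all.2 h).and (eventually_lt v)).exists
  have h₁ := Provable.all_elim (T := T) (substFm (liftSubst (vars v hv)) ε.not)
    (substTm (vars v hv) t)
  rw [inst_liftSubst] at h₁
  refine C.consistent k (.imp_mp (φ := .equal (substTm (vars v hv) t) (substTm (vars v hv) t))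
    ?_ (.imp_const (.eq_refl _) _))
  rw [← hsub]
  exact .imp_trans (hk hv) h₁

/-- The relation of forced equality. -/
def varSetoid (C : HenkinChain T) : Setoid ℕ where
  r i j := C.ForcesVal (tvar 0 : Tm L 1) ![i] j
  iseqv :=
    { refl := fun i => Eventually.of_forall fun k h hj => .imp_const (.eq_refl _) _
      symm := by
        intro i j h
        filter_upwards [h, eventually_gt_atTop i] with k h₁ hi hj _
        exact (h₁ (fun _ => by simpa) (by simpa using hj 0)).imp_eq_symm
      trans := by
        intro i j l h₁ h₂
        filter_upwards [h₁, h₂, eventually_gt_atTop j] with k h₁ h₂ hj hi hl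
        exact (h₁ hi hj).imp_eq_trans (h₂ (fun _ => by simpa) hl) }

variable (C) in
/-- The domain of the term model: variables up to forced equality. -/
def Domain : Type := Quotient C.varSetoid

variable (C) in
/-- The element denoted by a variable. -/
def elem (i : ℕ) : C.Domain := Quotient.mk C.varSetoid i

/-- A variable denoting a given element. -/
noncomputable def name (x : C.Domain) : ℕ := Quotient.out (s := C.varSetoid) x

@[simp] theorem elem_name (x : C.Domain) : C.elem (name x) = x :=
  Quotient.out_eq (s := C.varSetoid) x

theorem elem_eq_elem {i j : ℕ} : C.elem i = C.elem j ↔ ∀ᶠ k in atTop, ∀ (hi : i < k) (hj : j < k),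
    Provable T ((C.seq k).imp (.equal (tvar ⟨i, hi⟩) (tvar ⟨j, hj⟩))) := by
  refine (Quotient.eq (r := C.varSetoid)).trans ?_
  refine eventually_congr (Eventually.of_forall fun k => ?_)
  exact ⟨fun h hi hj => h (fun _ => by simpa) hj, fun h hi hj => h (hi 0) hj⟩

theorem Forces.congr {n : ℕ} {φ : Fm L n} {v w : Fin n → ℕ} (h : C.Forces φ v)
    (hvw : ∀ i, C.elem (v i) = C.elem (w i)) : C.Forces φ w := by
  filter_upwards [h, eventually_all.2 fun i => elem_eq_elem.1 (hvw i), eventually_lt v]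
    with k hk he hv hw
  exact .leibniz (fun i => he i (hv i) (hw i)) φ (hk hv)

/-- Symbols are evaluated at chosen names of the arguments. The choice does not matter, by Leibniz:
see `Forces.congr`, and `forcesVal_evalTm` for functions. -/
noncomputable instance : L.Structure C.Domain where
  funMap f x := C.elem (exists_forcesVal (C := C) (Term.func f tvar) fun i => name (x i)).choose
  RelMap R x := C.Forces (.rel R tvar) fun i => name (x i)

instance : Nonempty C.Domain := ⟨C.elem 0⟩

theorem ForcesVal.unique {n : ℕ} {t : Tm L n} {v : Fin n → ℕ} {i j : ℕ} (hi : C.ForcesVal t v i)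
    (hj : C.ForcesVal t v j) : C.elem i = C.elem j := by
  rw [elem_eq_elem]
  filter_upwards [hi, hj, eventually_lt v] with k h₁ h₂ hv hi hj
  exact (h₁ hv hi).imp_eq_symm.imp_eq_trans (h₂ hv hj)

theorem forcesVal_evalTm {n : ℕ} (t : Tm L n) (v : Fin n → ℕ) (j : ℕ) (h : C.ForcesVal t v j) :
    evalTm t (fun i => C.elem (v i)) = C.elem j := by
  induction t generalizing j with
  | var x =>
    rcases x with e | i
    · exact e.elim
    · refine elem_eq_elem.2 ?_
      filter_upwards [h, eventually_lt v] with k hk hv _ hj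
      exact hk hv hj
  | @func a f ts ih =>
    choose g hg using fun i => exists_forcesVal (C := C) (ts i) v
    have h₁ : (fun i => evalTm (ts i) fun i => C.elem (v i)) = fun i => C.elem (g i) :=
      funext fun i => ih i _ (hg i)
    let x : Fin a → C.Domain := fun i => C.elem (g i)
    have h₂ := (exists_forcesVal (C := C) (Term.func f tvar) fun i => name (x i)).choose_spec
    change Structure.funMap f (fun i => evalTm (ts i) fun i => C.elem (v i)) = _
    rw [h₁]
    refine ForcesVal.unique h₂ ?_
    have hx : ∀ i, C.elem (name (x i)) = C.elem (g i) := fun i => by simp [x]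
    filter_upwards [h, eventually_all.2 hg, eventually_all.2 fun i => elem_eq_elem.1 (hx i),
      eventually_lt v, eventually_lt g] with k h hg he hv hgk hnk hj
    refine .imp_eq_trans (.imp_eq_symm ?_) (h hv hj)
    -- Leibniz for `x_a = f(x₀, …, x_{a-1})`: the arguments `ts i` are replaced by the chosen names
    -- of their values, while `x_a` keeps standing for `f ts`.
    have := Provable.leibniz (T := T) (θ := C.seq k)
      (σ := Fin.snoc (α := fun _ => Tm L k) (fun i => substTm (vars v hv) (ts i))
        (substTm (vars v hv) (.func f ts)))
      (τ := Fin.snoc (α := fun _ => Tm L k) (vars (fun i => name (x i)) hnk)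
        (substTm (vars v hv) (.func f ts)))
      (fun i => by
        refine Fin.lastCases ?_ (fun i => ?_) i
        · simpa using .imp_const (.eq_refl _) _
        · simpa [vars] using (hg i hv (hgk i)).imp_eq_trans (he i (hnk i) (hgk i)).imp_eq_symm)
      (.equal (tvar (Fin.last a)) (.func f fun i => tvar i.castSucc)) (by
        simp only [substFm, substTm_tvar, substTm_func, Fin.snoc_last, Fin.snoc_castSucc]
        exact .imp_const (.eq_refl _) _)
    simpa only [substFm, substTm_tvar, substTm_func, Fin.snoc_last, Fin.snoc_castSucc] using this

/-- The truth lemma. Every element has a variable as a name, so quantifying over elements is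
quantifying over variables, and `forces_imp` and `forces_all` are the clauses of the definition of
truth. -/
theorem sat_iff_forces {n : ℕ} (φ : Fm L n) : ∀ v : Fin n → ℕ,
    Sat φ (fun i => C.elem (v i)) ↔ C.Forces φ v := by
  induction φ with
  | falsum => exact fun v => ⟨False.elim, not_forces_bot v⟩
  | equal t s =>
    intro v
    obtain ⟨i, hi⟩ := exists_forcesVal (C := C) t v
    obtain ⟨j, hj⟩ := exists_forcesVal (C := C) s v
    change evalTm t _ = evalTm s _ ↔ _
    rw [forcesVal_evalTm t v i hi, forcesVal_evalTm s v j hj, elem_eq_elem]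
    constructor
    · intro h
      filter_upwards [h, hi, hj, eventually_gt_atTop i, eventually_gt_atTop j]
        with k h hi hj hik hjk hv
      exact ((hi hv hik).imp_eq_trans (h hik hjk)).imp_eq_trans (hj hv hjk).imp_eq_symm
    · intro h
      filter_upwards [h, hi, hj, eventually_lt v] with k h hi hj hv hik hjk
      exact ((hi hv hik).imp_eq_symm.imp_eq_trans (h hv)).imp_eq_trans (hj hv hjk)
  | rel R ts =>
    intro v
    choose g hg using fun i => exists_forcesVal (C := C) (ts i) v
    have h₁ : (fun i => evalTm (ts i) fun i => C.elem (v i)) = fun i => C.elem (g i) :=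
      funext fun i => forcesVal_evalTm _ _ _ (hg i)
    change Structure.RelMap R (fun i => evalTm (ts i) fun i => C.elem (v i)) ↔ _
    rw [h₁]
    have h₂ : C.Forces (.rel R tvar) g ↔ C.Forces (.rel R ts) v := by
      constructor
      · intro h
        filter_upwards [h, eventually_all.2 hg, eventually_lt g] with k h hg hgk hv
        exact Provable.leibniz (σ := vars g hgk) (τ := fun i => substTm (vars v hv) (ts i))
          (fun i => (hg i hv (hgk i)).imp_eq_symm) (.rel R tvar) (h hgk)
      · intro h
        filter_upwards [h, eventually_all.2 hg, eventually_lt v] with k h hg hv hgk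
        exact Provable.leibniz (τ := vars g hgk) (σ := fun i => substTm (vars v hv) (ts i))
          (fun i => hg i hv (hgk i)) (.rel R tvar) (h hv)
    rw [← h₂]
    exact ⟨fun h => Forces.congr h fun i => by simp, fun h => Forces.congr h fun i => by simp⟩
  | imp φ ψ ih₁ ih₂ =>
    intro v
    rw [forces_imp, ← ih₁, ← ih₂]
    rfl
  | all χ ih =>
    intro v
    rw [forces_all]
    constructor
    · intro h j
      rw [← ih]
      convert h (C.elem j) using 1
      funext i
      refine Fin.lastCases ?_ (fun i => ?_) i <;> simp
    · intro h x
      have h₁ := (ih _).2 (h (name x))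
      convert h₁ using 1
      funext i
      refine Fin.lastCases ?_ (fun i => ?_) i <;> simp

end HenkinChain

/-- The model lies in `Type` whatever the universes of `L`, its elements being classes of variable
indices. -/
theorem Consistent.exists_model [∀ n, Countable (Fm L n)] (hT : Consistent T) :
    ∃ (M : Type) (_ : L.Structure M) (_ : Nonempty M), ∀ φ ∈ T, M ⊨ φ := by
  obtain ⟨C⟩ := exists_henkinChain hT
  refine ⟨C.Domain, inferInstance, inferInstance, fun φ hφ => ?_⟩
  have h := (HenkinChain.sat_iff_forces (C := C) φ Fin.elim0).2 (.of_provable (Proves.of_mem hφ) _)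
  rwa [Sat, Subsingleton.elim (fun _ => _) (default : Fin 0 → C.Domain)] at h

/-- Gödel's completeness theorem. -/
theorem proves_of_models [∀ n, Countable (Fm L n)] {φ : L.Sentence}
    (h : ∀ (M : Type) [L.Structure M] [Nonempty M], (∀ ψ ∈ T, M ⊨ ψ) → M ⊨ φ) : Proves T φ := by
  by_contra hφ
  have hcons : Consistent (insert φ.not T) := by
    intro hbot
    have := Provable.of_insert hbot
    rw [ofSentence_zero] at this
    exact hφ this.by_contra
  obtain ⟨M, _, _, hM⟩ := hcons.exists_model
  exact hM _ (Set.mem_insert _ _) (h M fun ψ hψ => hM ψ (Set.mem_insert_of_mem _ hψ))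

end Henkin

end G1

namespace G1

open FirstOrder.Language

universe u v w w'

/-! ### Truth of the connectives -/

section Connectives

variable {L : FirstOrder.Language.{u, v}} {M : Type w} [L.Structure M]

theorem sat_imp {n : ℕ} {φ ψ : Fm L n} {v : Fin n → M} :
    Sat (φ.imp ψ) v ↔ (Sat φ v → Sat ψ v) := Iff.rfl

theorem sat_all {n : ℕ} {φ : Fm L (n + 1)} {v : Fin n → M} :
    Sat φ.all v ↔ ∀ a, Sat φ (Fin.snoc v a : Fin (n + 1) → M) := Iff.rfl

theorem sat_ex {n : ℕ} {φ : Fm L (n + 1)} {v : Fin n → M} :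
    Sat φ.ex v ↔ ∃ a, Sat φ (Fin.snoc v a : Fin (n + 1) → M) := BoundedFormula.realize_ex

theorem sat_inf {n : ℕ} {φ ψ : Fm L n} {v : Fin n → M} :
    Sat (φ ⊓ ψ) v ↔ Sat φ v ∧ Sat ψ v := BoundedFormula.realize_inf

theorem sat_equal {n : ℕ} {t s : Tm L n} {v : Fin n → M} :
    Sat (.equal t s) v ↔ evalTm t v = evalTm s v := Iff.rfl

theorem evalTm_func {n k : ℕ} {f : L.Functions k} {ts : Fin k → Tm L n} {v : Fin n → M} :
    evalTm (.func f ts) v = Structure.funMap f fun i => evalTm (ts i) v := rfl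

theorem sat_conj {n : ℕ} {l : List (Fm L n)} {v : Fin n → M} :
    Sat (conj l) v ↔ ∀ φ ∈ l, Sat φ v := by
  induction l with
  | nil => simp [conj, Sat]
  | cons φ l ih =>
    rw [List.forall_mem_cons, ← ih]
    exact sat_inf

end Connectives

namespace Translation

variable {L L' : FirstOrder.Language.{u, v}} (I : Translation L L')

/-! ### Truth of translated formulas -/

section Semantics

variable {M : Type w} [L'.Structure M]

/-- Membership in the domain of the translation. -/
def InDom (x : M) : Prop := Sat I.dom fun _ => x

theorem sat_domAt {n : ℕ} {i : Fin n} {v : Fin n → M} :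
    Sat (I.domAt i) v ↔ I.InDom (v i) := by
  simp [domAt, InDom]

theorem sat_bexs {m : ℕ} (k : ℕ) (φ : Fm L' (m + k)) (v : Fin m → M) :
    Sat (I.bexs k φ) v ↔ ∃ z : Fin k → M, (∀ i, I.InDom (z i)) ∧ Sat φ (Fin.append v z) := by
  induction k with
  | zero =>
    refine ⟨fun h => ⟨Fin.elim0, fun i => i.elim0, ?_⟩, fun ⟨z, _, h⟩ => ?_⟩
    · rw [Fin.append_elim0]; exact h
    · rw [Subsingleton.elim z Fin.elim0, Fin.append_elim0] at h; exact h
  | succ k ih =>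
    rw [bexs, ih]
    constructor
    · rintro ⟨z, hz, h⟩
      obtain ⟨a, ha⟩ := sat_ex.1 h
      rw [sat_inf, sat_domAt, Fin.snoc_last] at ha
      refine ⟨Fin.snoc z a, fun i => ?_, ?_⟩
      · refine Fin.lastCases ?_ (fun i => ?_) i
        · simpa using ha.1
        · simpa using hz i
      · rw [Fin.append_snoc]; exact ha.2
    · rintro ⟨z, hz, h⟩
      refine ⟨Fin.init z, fun i => hz _, sat_ex.2 ⟨z (Fin.last k), ?_⟩⟩
      rw [sat_inf, sat_domAt, Fin.snoc_last]
      refine ⟨hz _, ?_⟩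
      rw [← Fin.snoc_init_self z, Fin.append_snoc] at h
      exact h

theorem sat_balls {m : ℕ} (k : ℕ) (φ : Fm L' (m + k)) (v : Fin m → M) :
    Sat (I.balls k φ) v ↔ ∀ z : Fin k → M, (∀ i, I.InDom (z i)) → Sat φ (Fin.append v z) := by
  induction k with
  | zero =>
    refine ⟨fun h z _ => ?_, fun h => ?_⟩
    · rw [Subsingleton.elim z Fin.elim0, Fin.append_elim0]; exact h
    · have := h Fin.elim0 fun i => i.elim0
      rw [Fin.append_elim0] at this
      exact this
  | succ k ih =>
    rw [balls, ih]
    constructor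
    · intro h z hz
      have h₁ := h (Fin.init z) (fun i => hz _) (z (Fin.last k))
      rw [← Fin.snoc_init_self z, Fin.append_snoc]
      refine h₁ ?_
      refine (I.sat_domAt).2 ?_
      rw [Fin.snoc_last]
      exact hz _
    · intro h z hz a ha
      have ha' := (I.sat_domAt).1 ha
      rw [Fin.snoc_last] at ha'
      have := h (Fin.snoc z a) (fun i => by
        refine Fin.lastCases ?_ (fun i => ?_) i
        · simpa using ha'
        · simpa using hz i)
      rw [Fin.append_snoc] at this
      exact this

/-- `y` is a value of the unravelled term `t`. -/
def Val {n : ℕ} : Tm L n → (Fin n → M) → M → Prop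
  | .var (.inl a), _, _ => a.elim
  | .var (.inr i), v, y => v i = y
  | .func f ts, v, y => ∃ z, (∀ i, I.InDom (z i)) ∧ (∀ i, Val (ts i) v (z i)) ∧
      Sat (I.func f) (Fin.snoc z y : Fin _ → M)

theorem sat_graph {n : ℕ} (t : Tm L n) : ∀ {m : ℕ} (e : Fin n → Fin m) (y : Fin m) (v : Fin m → M),
    Sat (I.graph t e y) v ↔ I.Val t (fun i => v (e i)) (v y) := by
  induction t with
  | var x =>
    rcases x with e | i
    · exact e.elim
    · intros; rfl
  | func f ts ih =>
    intro m e y v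
    rw [graph, sat_bexs, Val]
    refine exists_congr fun z => and_congr_right fun _ => ?_
    rw [sat_inf, sat_conj, List.forall_mem_ofFn_iff, sat_substFm]
    refine and_congr (forall_congr' fun i => ?_) (iff_of_eq (congrArg _ ?_))
    · rw [ih]
      simp
    · funext i
      refine Fin.lastCases ?_ (fun i => ?_) i <;> simp

theorem sat_atom {n k : ℕ} (P : Fm L' k) (ts : Fin k → Tm L n) (v : Fin n → M) :
    Sat (I.atom P ts) v ↔
      ∃ z, (∀ i, I.InDom (z i)) ∧ (∀ i, I.Val (ts i) v (z i)) ∧ Sat P z := by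
  rw [atom, sat_bexs]
  refine exists_congr fun z => and_congr_right fun _ => ?_
  rw [sat_inf, sat_conj, List.forall_mem_ofFn_iff, sat_substFm]
  simp [sat_graph]

/-- For a variable argument the unravelling says `v (σ i) = z i` with the genuine equality of `M`,
so there is only one candidate for `z`. -/
theorem sat_atom_tvar {n k : ℕ} (P : Fm L' k) (σ : Fin k → Fin n) {v : Fin n → M}
    (hv : ∀ i, I.InDom (v i)) :
    Sat (I.atom P fun i => (tvar (σ i) : Tm L n)) v ↔ Sat P fun i => v (σ i) := by
  rw [sat_atom]
  constructor
  · rintro ⟨z, _, h, hP⟩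
    obtain rfl : (fun i => v (σ i)) = z := funext h
    exact hP
  · exact fun h => ⟨_, fun i => hv _, fun i => rfl, h⟩

theorem inDom_snoc {n : ℕ} {v : Fin n → M} (hv : ∀ i, I.InDom (v i)) {a : M} (ha : I.InDom a) :
    ∀ i, I.InDom ((Fin.snoc v a : Fin (n + 1) → M) i) := by
  intro i
  refine Fin.lastCases ?_ (fun i => ?_) i
  · simpa using ha
  · simpa using hv i

theorem sat_onFm_all {n : ℕ} (φ : Fm L (n + 1)) (v : Fin n → M) :
    Sat (I.onFm φ.all) v ↔
      ∀ a, I.InDom a → Sat (I.onFm φ) (Fin.snoc v a : Fin (n + 1) → M) := by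
  refine forall_congr' fun a => imp_congr_left ?_
  refine I.sat_domAt.trans ?_
  rw [Fin.snoc_last]

/-- Interpretations only speak about sentences; the universal closure makes them applicable to
formulas with parameters from the domain. -/
theorem sat_onFm_alls {n : ℕ} (φ : Fm L n) : Sat (I.onFm (n := 0) φ.alls) (default : Fin 0 → M) ↔
    ∀ v : Fin n → M, (∀ i, I.InDom (v i)) → Sat (I.onFm φ) v := by
  induction n with
  | zero =>
    refine ⟨fun h v _ => ?_, fun h => h _ fun i => i.elim0⟩
    rw [Subsingleton.elim v default]
    exact h
  | succ n ih =>
    rw [BoundedFormula.alls, ih]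
    constructor
    · intro h v hv
      rw [← Fin.snoc_init_self v]
      exact (I.sat_onFm_all _ _).1 (h (Fin.init v) fun i => hv _) _ (hv _)
    · intro h v hv
      exact (I.sat_onFm_all _ _).2 fun a ha => h _ (I.inDom_snoc hv ha)

theorem sat_onFm_conj {n : ℕ} {l : List (Fm L n)} {v : Fin n → M} :
    Sat (I.onFm (conj l)) v ↔ ∀ φ ∈ l, Sat (I.onFm φ) v := by
  induction l with
  | nil => simp only [conj, List.foldr_nil, List.not_mem_nil, false_implies, implies_true, iff_true]
           exact id
  | cons φ l ih =>
    rw [List.forall_mem_cons, ← ih]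
    exact sat_inf

theorem sat_total {k : ℕ} (f : L.Functions k) :
    Sat (I.total f) (default : Fin 0 → M) ↔ ∀ a : Fin k → M, (∀ i, I.InDom (a i)) →
      ∃ b, I.InDom b ∧ Sat (I.func f) (Fin.snoc a b : Fin (k + 1) → M) := by
  rw [total, sat_balls]
  refine forall_congr' fun z => imp_congr_right fun _ => ?_
  rw [sat_ex]
  refine exists_congr fun b => ?_
  rw [sat_inf, sat_domAt, Fin.snoc_last, sat_substFm]
  refine and_congr_right fun _ => iff_of_eq (congrArg _ ?_)
  funext i
  refine Fin.lastCases ?_ (fun i => ?_) i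
  · have h : Fin.cast (by omega : k + 1 = 0 + k + 1) (Fin.last k) = Fin.last (0 + k) := by
      ext; simp
    simp only [evalTm_tvar, h, Fin.snoc_last]
  · have h : Fin.cast (by omega : k + 1 = 0 + k + 1) i.castSucc = (Fin.natAdd 0 i).castSucc := by
      ext; simp
    simp only [evalTm_tvar, h, Fin.snoc_castSucc, Fin.append_right]

end Semantics

/-- The `L`-structure `N` is the one defined by the translation `I` in the `L'`-structure `M`;
`proj` maps the elements of the domain formula to the elements of `N` they represent. -/
structure Defines (M : Type w) (N : Type w') [L'.Structure M] [L.Structure N] where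
  proj : M → N
  surj : ∀ y, ∃ x, I.InDom x ∧ proj x = y
  eq_iff : ∀ a b, I.InDom a → I.InDom b → (Sat I.eq ![a, b] ↔ proj a = proj b)
  rel_iff : ∀ {k : ℕ} (R : L.Relations k) (a : Fin k → M), (∀ i, I.InDom (a i)) →
    (Sat (I.rel R) a ↔ Structure.RelMap R fun i => proj (a i))
  func_val : ∀ {k : ℕ} (f : L.Functions k) (a : Fin k → M) (b : M), (∀ i, I.InDom (a i)) →
    I.InDom b → Sat (I.func f) (Fin.snoc a b : Fin (k + 1) → M) →
    Structure.funMap f (fun i => proj (a i)) = proj b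
  func_total : ∀ {k : ℕ} (f : L.Functions k) (a : Fin k → M), (∀ i, I.InDom (a i)) →
    ∃ b, I.InDom b ∧ Sat (I.func f) (Fin.snoc a b : Fin (k + 1) → M)

/-! ### Transfer of truth to the defined structure -/

namespace Defines

variable {I} {M : Type w} {N : Type w'} [L'.Structure M] [L.Structure N] (D : I.Defines M N)
include D

theorem evalTm_of_val {n : ℕ} (t : Tm L n) {v : Fin n → M} (y : M)
    (hy : I.InDom y) (h : I.Val t v y) : evalTm t (fun i => D.proj (v i)) = D.proj y := by
  induction t generalizing y with
  | var x =>
    rcases x with e | i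
    · exact e.elim
    · exact congrArg D.proj h
  | func f ts ih =>
    obtain ⟨z, hz, hts, hf⟩ := h
    rw [← D.func_val f z y hz hy hf, evalTm_func]
    exact congrArg _ (funext fun i => ih i _ (hz i) (hts i))

theorem exists_val {n : ℕ} (t : Tm L n) {v : Fin n → M} (hv : ∀ i, I.InDom (v i)) :
    ∃ y, I.InDom y ∧ I.Val t v y := by
  induction t with
  | var x =>
    rcases x with e | i
    · exact e.elim
    · exact ⟨v i, hv i, rfl⟩
  | func f ts ih =>
    choose z hz hts using ih
    obtain ⟨y, hy, h⟩ := D.func_total f z hz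
    exact ⟨y, hy, z, hz, hts, h⟩

/-- Witnesses of the unravelling are determined up to `proj`, which is all that `Q` sees, and they
exist because the translated functions are total. -/
theorem sat_atom_iff {n k : ℕ} {P : Fm L' k} {Q : (Fin k → N) → Prop}
    (hPQ : ∀ a : Fin k → M, (∀ i, I.InDom (a i)) → (Sat P a ↔ Q fun i => D.proj (a i)))
    (ts : Fin k → Tm L n) {v : Fin n → M} (hv : ∀ i, I.InDom (v i)) :
    Sat (I.atom P ts) v ↔ Q fun i => evalTm (ts i) fun i => D.proj (v i) := by
  rw [sat_atom]
  constructor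
  · rintro ⟨z, hz, hts, h⟩
    have := (hPQ z hz).1 h
    rwa [← funext fun i => D.evalTm_of_val (ts i) (z i) (hz i) (hts i)] at this
  · intro h
    choose z hz hts using fun i => D.exists_val (ts i) hv
    refine ⟨z, hz, hts, (hPQ z hz).2 ?_⟩
    rwa [← funext fun i => D.evalTm_of_val (ts i) (z i) (hz i) (hts i)]

theorem snoc_proj {n : ℕ} (v : Fin n → M) (a : M) :
    (fun i => D.proj ((Fin.snoc v a : Fin (n + 1) → M) i)) =
      (Fin.snoc (fun i => D.proj (v i)) (D.proj a) : Fin (n + 1) → N) := by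
  funext i
  refine Fin.lastCases ?_ (fun i => ?_) i <;> simp

theorem forall_iff {n : ℕ} (v : Fin n → M) {P : (Fin (n + 1) → N) → Prop} :
    (∀ y : N, P (Fin.snoc (fun i => D.proj (v i)) y : Fin (n + 1) → N)) ↔
      ∀ a, I.InDom a → P fun i => D.proj ((Fin.snoc v a : Fin (n + 1) → M) i) := by
  constructor
  · intro h a _
    rw [D.snoc_proj]
    exact h _
  · intro h y
    obtain ⟨a, ha, rfl⟩ := D.surj y
    rw [← D.snoc_proj]
    exact h a ha

/-- A translated formula holds in `M` iff the formula holds in the structure defined in `M`. -/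
theorem sat_onFm {n : ℕ} (φ : Fm L n) : ∀ (v : Fin n → M), (∀ i, I.InDom (v i)) →
    (Sat (I.onFm φ) v ↔ Sat φ fun i => D.proj (v i)) := by
  induction φ with
  | falsum => intros; rfl
  | equal t s =>
    intro v hv
    refine (D.sat_atom_iff (Q := fun a => a 0 = a 1) (fun a ha => ?_) ![t, s] hv).trans Iff.rfl
    rw [← D.eq_iff _ _ (ha 0) (ha 1)]
    refine iff_of_eq (congrArg _ ?_)
    funext i
    fin_cases i <;> rfl
  | rel R ts =>
    intro v hv
    exact D.sat_atom_iff (fun a ha => D.rel_iff R a ha) ts hv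
  | imp φ ψ ih₁ ih₂ => intro v hv; exact imp_congr (ih₁ v hv) (ih₂ v hv)
  | all φ ih =>
    intro v hv
    rw [sat_onFm_all, sat_all, D.forall_iff]
    exact forall_congr' fun a => imp_congr_right fun ha => ih _ (I.inDom_snoc hv ha)

theorem models_onFm (φ : L.Sentence) : M ⊨ I.onFm (n := 0) φ ↔ N ⊨ φ := by
  have := D.sat_onFm φ default fun i => i.elim0
  rwa [Subsingleton.elim (fun _ => _) (default : Fin 0 → N)] at this

end Defines

/-! ### The structure defined by an interpretation -/

section Quotient

variable {I} {T : L.Theory} {S : L'.Theory} {M : Type w} [L'.Structure M] [Nonempty M]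

/-- By completeness, the universal closure of a valid formula is a theorem of `T`, so its
translation is provable in `S`. The properties of the translated equality are obtained by choosing
suitable valid formulas. -/
theorem IsInterpretation.sat_of_valid [∀ n, Countable (Fm L n)] (hI : I.IsInterpretation T S)
    (hM : ∀ ψ ∈ S, M ⊨ ψ) {n : ℕ} {φ : Fm L n}
    (h : ∀ (A : Type) [L.Structure A] [Nonempty A] (v : Fin n → A), Sat φ v)
    (v : Fin n → M) (hv : ∀ i, I.InDom (v i)) : Sat (I.onFm φ) v := by
  refine (I.sat_onFm_alls φ).1 ?_ v hv
  refine Proves.sound hM (hI.2 _ (proves_of_models fun A _ _ _ => ?_))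
  exact BoundedFormula.realize_alls.2 fun v => h A v

/-- An interpretation of `T` in `S` defines an `L`-structure in every model of `S`. -/
theorem IsInterpretation.exists_defines [∀ n, Countable (Fm L n)] (hI : I.IsInterpretation T S)
    (hM : ∀ ψ ∈ S, M ⊨ ψ) :
    ∃ (N : Type w) (_ : L.Structure N) (_ : Nonempty N), Nonempty (I.Defines M N) := by
  classical
  -- Between variables there is nothing to unravel, and the translated equation is `I.eq` itself.
  have heq : ∀ {n : ℕ} (i j : Fin n) (v : Fin n → M), (∀ i, I.InDom (v i)) →
      (Sat (I.onFm (.equal (tvar i) (tvar j))) v ↔ Sat I.eq ![v i, v j]) := by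
    intro n i j v hv
    have h := I.sat_atom_tvar I.eq ![i, j] hv
    have h₁ : (fun k => (tvar (![i, j] k) : Tm L n)) = ![tvar i, tvar j] := by
      funext k; fin_cases k <;> rfl
    have h₂ : (fun k => v (![i, j] k)) = ![v i, v j] := by
      funext k; fin_cases k <;> rfl
    rwa [h₁, h₂] at h
  have hrefl : ∀ a : M, I.InDom a → Sat I.eq ![a, a] := by
    intro a ha
    have := hI.sat_of_valid hM (φ := (.equal (tvar 0) (tvar 0) : Fm L 1))
      (fun A _ _ v => rfl) ![a] (by simpa using ha)
    rwa [heq _ _ _ (by simpa using ha)] at this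
  have hsymm : ∀ a b : M, I.InDom a → I.InDom b → Sat I.eq ![a, b] → Sat I.eq ![b, a] := by
    intro a b ha hb h
    have hv : ∀ i, I.InDom (![a, b] i) := by simp [Fin.forall_fin_two, ha, hb]
    have := hI.sat_of_valid hM
      (φ := (BoundedFormula.imp (.equal (tvar 0) (tvar 1)) (.equal (tvar 1) (tvar 0)) : Fm L 2))
      (fun A _ _ v h => Eq.symm h) ![a, b] hv
    exact (heq _ _ _ hv).1 (this ((heq _ _ _ hv).2 h))
  have htrans : ∀ a b c : M, I.InDom a → I.InDom b → I.InDom c →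
      Sat I.eq ![a, b] → Sat I.eq ![b, c] → Sat I.eq ![a, c] := by
    intro a b c ha hb hc h₁ h₂
    have hv : ∀ i, I.InDom (![a, b, c] i) := by
      intro i; fin_cases i <;> assumption
    have := hI.sat_of_valid hM
      (φ := (BoundedFormula.imp (.equal (tvar 0) (tvar 1)) (BoundedFormula.imp
        (.equal (tvar 1) (tvar 2)) (.equal (tvar 0) (tvar 2))) : Fm L 3))
      (fun A _ _ v h h' => Eq.trans h h') ![a, b, c] hv
    exact (heq _ _ _ hv).1 (this ((heq _ _ _ hv).2 h₁) ((heq _ _ _ hv).2 h₂))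
  -- The congruence axiom for `R` is stated in context `k + k`, with the two argument tuples side by
  -- side.
  have hrel : ∀ {k : ℕ} (R : L.Relations k) (a b : Fin k → M), (∀ i, I.InDom (a i)) →
      (∀ i, I.InDom (b i)) → (∀ i, Sat I.eq ![a i, b i]) → Sat (I.rel R) a → Sat (I.rel R) b := by
    intro k R a b ha hb hab hR
    have hv : ∀ i, I.InDom (Fin.append a b i) := by
      intro i
      refine Fin.addCases (fun i => ?_) (fun i => ?_) i <;>
        simp only [Fin.append_left, Fin.append_right, ha, hb]
    have := hI.sat_of_valid hM
      (φ := (BoundedFormula.imp (conj (List.ofFn fun i : Fin k =>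
          .equal (tvar (Fin.castAdd k i)) (tvar (Fin.natAdd k i))))
        (BoundedFormula.imp (.rel R fun i => tvar (Fin.castAdd k i))
          (.rel R fun i => tvar (Fin.natAdd k i))) : Fm L (k + k)))
      (fun A _ _ v h h' => by
        have h₁ := sat_conj.1 h
        rw [List.forall_mem_ofFn_iff] at h₁
        have h₂ : (fun i => v (Fin.castAdd k i)) = fun i => v (Fin.natAdd k i) := funext h₁
        change Structure.RelMap R (fun i => v (Fin.castAdd k i)) at h'
        rw [h₂] at h'
        exact h') (Fin.append a b) hv
    have h₁ := (I.sat_atom_tvar (I.rel R) (Fin.natAdd k) hv).1 (this (I.sat_onFm_conj.2 (by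
      rw [List.forall_mem_ofFn_iff]
      intro i
      rw [heq _ _ _ hv]
      simpa only [Fin.append_left, Fin.append_right] using hab i)) ((I.sat_atom_tvar (I.rel R) (Fin.castAdd k) hv).2 (by
        simpa only [Fin.append_left] using hR)))
    simpa only [Fin.append_right] using h₁
  -- Only totality of the `F_I` is demanded of an interpretation. That they are single-valued and
  -- congruent modulo `I.eq` comes from a valid formula in context `k + k + 2`: two argument tuples
  -- followed by two values.
  have hfunc : ∀ {k : ℕ} (f : L.Functions k) (a b : Fin k → M) (x y : M), (∀ i, I.InDom (a i)) →
      (∀ i, I.InDom (b i)) → I.InDom x → I.InDom y → (∀ i, Sat I.eq ![a i, b i]) →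
      Sat (I.func f) (Fin.snoc a x : Fin (k + 1) → M) →
      Sat (I.func f) (Fin.snoc b y : Fin (k + 1) → M) → Sat I.eq ![x, y] := by
    intro k f a b x y ha hb hx hy hab hfa hfb
    have hv : ∀ i, I.InDom (Fin.append (Fin.append a b) ![x, y] i) := by
      intro i
      refine Fin.addCases (fun i => ?_) (fun i => ?_) i
      · refine Fin.addCases (fun i => ?_) (fun i => ?_) i <;>
          simp only [Fin.append_left, Fin.append_right, ha, hb]
      · simp only [Fin.append_right]
        fin_cases i <;> assumption
    let p : Fin k → Fin (k + k + 2) := fun i => Fin.castAdd 2 (Fin.castAdd k i)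
    let q : Fin k → Fin (k + k + 2) := fun i => Fin.castAdd 2 (Fin.natAdd k i)
    let r : Fin 2 → Fin (k + k + 2) := fun i => Fin.natAdd (k + k) i
    -- An instance of `F_I` witnesses the translated equation `f(…) = x_j`: both sides are given the
    -- value `z`, so reflexivity of `I.eq` is needed.
    have hval : ∀ (c : Fin k → M) (z : M) (s : Fin k → Fin (k + k + 2)) (j : Fin (k + k + 2)),
        (fun i => Fin.append (Fin.append a b) ![x, y] (s i)) = c →
        Fin.append (Fin.append a b) ![x, y] j = z → (∀ i, I.InDom (c i)) → I.InDom z →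
        Sat (I.func f) (Fin.snoc c z : Fin (k + 1) → M) →
        Sat (I.onFm (.equal (.func f fun i => tvar (s i)) (tvar j)))
          (Fin.append (Fin.append a b) ![x, y]) := by
      rintro c z s j rfl rfl hc hz hf
      refine (I.sat_atom _ _ _).2 ⟨![_, _], ?_, ?_, hrefl _ hz⟩
      · intro i; fin_cases i <;> exact hz
      · intro i
        fin_cases i
        · exact ⟨_, hc, fun i => rfl, hf⟩
        · exact rfl
    have := hI.sat_of_valid hM
      (φ := (BoundedFormula.imp (conj (List.ofFn fun i : Fin k =>
          .equal (tvar (p i)) (tvar (q i))))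
        (BoundedFormula.imp (.equal (.func f fun i => tvar (p i)) (tvar (r 0)))
          (BoundedFormula.imp (.equal (.func f fun i => tvar (q i)) (tvar (r 1)))
          (.equal (tvar (r 0)) (tvar (r 1))))) : Fm L (k + k + 2)))
      (fun A _ _ v h h' h'' => by
        have h₁ := sat_conj.1 h
        rw [List.forall_mem_ofFn_iff] at h₁
        have h₂ : (fun i => v (p i)) = fun i => v (q i) := funext h₁
        change Structure.funMap f (fun i => v (p i)) = v (r 0) at h'
        change Structure.funMap f (fun i => v (q i)) = v (r 1) at h''
        change v (r 0) = v (r 1)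
        rw [← h', ← h'', h₂]) _ hv
    have h₁ := this (I.sat_onFm_conj.2 (by
      rw [List.forall_mem_ofFn_iff]
      intro i
      rw [heq _ _ _ hv]
      simpa only [p, q, Fin.append_left, Fin.append_right] using hab i))
      (hval a x p (r 0) (by simp [p]) (by simp [r]) ha hx hfa)
      (hval b y q (r 1) (by simp only [q, Fin.append_left, Fin.append_right]) (by simp [r]) hb hy hfb)
    simpa [r] using (heq _ _ _ hv).1 h₁
  -- The domain formula is satisfied by some element because `¬ ∀ x, ⊥` is valid.
  obtain ⟨a₀, ha₀⟩ : ∃ a : M, I.InDom a := by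
    by_contra hcon
    have := hI.sat_of_valid hM (φ := (BoundedFormula.imp (BoundedFormula.all .falsum) .falsum :
        Fm L 0)) (fun A _ hA v h => h hA.some) default fun i => i.elim0
    exact this ((I.sat_onFm_all _ _).2 fun a ha => hcon ⟨a, ha⟩)
  let s : Setoid {x : M // I.InDom x} :=
    { r := fun a b => Sat I.eq ![a.1, b.1]
      iseqv :=
        { refl := fun a => hrefl _ a.2
          symm := fun {a b} h => hsymm _ _ a.2 b.2 h
          trans := fun {a b c} h h' => htrans _ _ _ a.2 b.2 c.2 h h' } }
  have htotal : ∀ {k : ℕ} (f : L.Functions k) (a : Fin k → M), (∀ i, I.InDom (a i)) →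
      ∃ b, I.InDom b ∧ Sat (I.func f) (Fin.snoc a b : Fin (k + 1) → M) := fun {k} f =>
    (I.sat_total f).1 (Proves.sound hM (hI.1 k f))
  choose F hF₁ hF₂ using @htotal
  have hout : ∀ x : {x : M // I.InDom x}, Sat I.eq ![(Quotient.mk s x).out.1, x.1] :=
    fun x => Quotient.exact (s := s) (Quotient.out_eq (s := s) (Quotient.mk s x))
  let inst : L.Structure (Quotient s) :=
    { funMap := fun f x => Quotient.mk s
        ⟨F f (fun i => (x i).out.1) fun i => (x i).out.2, hF₁ _ _ _⟩
      RelMap := fun R x => Sat (I.rel R) fun i => (x i).out.1 }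
  -- Off the domain formula the projection takes the arbitrary value `a₀`, which no condition in
  -- `Defines` sees.
  obtain ⟨π, hπ⟩ : ∃ π : M → Quotient s, ∀ a (ha : I.InDom a), π a = Quotient.mk s ⟨a, ha⟩ :=
    ⟨fun x => if hx : I.InDom x then Quotient.mk s ⟨x, hx⟩ else Quotient.mk s ⟨a₀, ha₀⟩,
      fun a ha => dif_pos ha⟩
  refine ⟨Quotient s, inst, ⟨Quotient.mk s ⟨a₀, ha₀⟩⟩, ⟨?_⟩⟩
  refine
    { proj := π
      surj := ?_
      eq_iff := ?_
      rel_iff := ?_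
      func_val := ?_
      func_total := fun {k} f a ha => ⟨_, hF₁ f a ha, hF₂ f a ha⟩ }
  · intro y
    obtain ⟨⟨x, hx⟩, rfl⟩ := Quotient.exists_rep y
    exact ⟨x, hx, hπ x hx⟩
  · intro a b ha hb
    rw [hπ a ha, hπ b hb, Quotient.eq]
    exact Iff.rfl
  · intro k R a ha
    rw [funext fun i => hπ (a i) (ha i)]
    exact ⟨hrel R _ _ ha (fun i => (Subtype.property _)) fun i => hsymm _ _ (Subtype.property _) (ha i)
      (hout ⟨a i, ha i⟩), hrel R _ _ (fun i => (Subtype.property _)) ha fun i => hout ⟨a i, ha i⟩⟩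
  · intro k f a b ha hb h
    rw [funext fun i => hπ (a i) (ha i), hπ b hb]
    exact Quotient.sound (s := s) (hfunc f _ a _ b (fun i => (Subtype.property _)) ha (hF₁ _ _ _) hb
      (fun i => hout ⟨a i, ha i⟩) (hF₂ _ _ _) h)

end Quotient

/-! ### The identity translation -/

section Identity

variable (L) in
/-- The identity translation. -/
def identity : Translation L L where
  dom := ⊤
  eq := .equal (tvar 0) (tvar 1)
  rel R := .rel R tvar
  func f := .equal (.func f fun i => tvar i.castSucc) (tvar (Fin.last _))

/-- The identity translation defines every structure in itself. -/
def identityDefines (M : Type w) [L.Structure M] : (identity L).Defines M M where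
  proj := id
  surj y := ⟨y, id, rfl⟩
  eq_iff _ _ _ _ := Iff.rfl
  rel_iff _ _ _ := Iff.rfl
  func_val f a b _ _ h := by
    have h' : Structure.funMap f (fun i => (Fin.snoc a b : Fin (_ + 1) → M) i.castSucc) =
      (Fin.snoc a b : Fin (_ + 1) → M) (Fin.last _) := h
    simpa using h'
  func_total f a _ := ⟨Structure.funMap f a, id, by
    change Structure.funMap f (fun i => (Fin.snoc a _ : Fin (_ + 1) → M) i.castSucc) =
      (Fin.snoc a _ : Fin (_ + 1) → M) (Fin.last _)
    simp⟩

/-- Every structure is defined in itself by the identity translation, so everything to be derived is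
true in all models of `S`, and completeness gives the derivations. -/
theorem identity_isInterpretation [∀ n, Countable (Fm L n)] {T S : L.Theory} (h : Extends S T) :
    (identity L).IsInterpretation T S := by
  refine ⟨fun k f => proves_of_models fun M _ _ _ => ?_, fun φ hφ =>
    proves_of_models fun M _ _ hM => ?_⟩
  · exact ((identity L).sat_total f).2 fun a ha => (identityDefines M).func_total f a ha
  · exact ((identityDefines M).models_onFm φ).2 (Proves.sound hM (h φ hφ))

end Identity

/-! ### Unnested formulas and their direct translation -/

section Unnested

/-- `I.Unnested φ ψ`: the atomic subformulas of `φ` contain at most one function symbol, and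
`ψ` is obtained from `φ` by translating these atomic formulas and relativizing the quantifiers. -/
inductive Unnested (I : Translation L L') : ∀ {n : ℕ}, Fm L n → Fm L' n → Prop
  | falsum (n : ℕ) : Unnested I (.falsum : Fm L n) .falsum
  | equal {n : ℕ} (i j : Fin n) :
      Unnested I (.equal (tvar i) (tvar j)) (substFm (fun l => tvar (![i, j] l)) I.eq)
  | func {n k : ℕ} (f : L.Functions k) (σ : Fin k → Fin n) (j : Fin n) :
      Unnested I (.equal (.func f fun l => tvar (σ l)) (tvar j))
        (.all ((I.domAt (Fin.last n)).imp (BoundedFormula.imp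
          (substFm (fun l => tvar ((Fin.snoc (fun l => (σ l).castSucc) (Fin.last n) :
            Fin (k + 1) → Fin (n + 1)) l)) (I.func f))
          (substFm (fun l => tvar (![Fin.last n, j.castSucc] l)) I.eq))))
  | rel {n k : ℕ} (R : L.Relations k) (σ : Fin k → Fin n) :
      Unnested I (.rel R fun l => tvar (σ l)) (substFm (fun l => tvar (σ l)) (I.rel R))
  | imp {n : ℕ} {φ₁ φ₂ : Fm L n} {ψ₁ ψ₂ : Fm L' n} : Unnested I φ₁ ψ₁ → Unnested I φ₂ ψ₂ →
      Unnested I (φ₁.imp φ₂) (ψ₁.imp ψ₂)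
  | all {n : ℕ} {φ : Fm L (n + 1)} {ψ : Fm L' (n + 1)} : Unnested I φ ψ →
      Unnested I φ.all (.all ((I.domAt (Fin.last n)).imp ψ))

variable {I}

/-- In the `func` clause the translation says that every value of `F_I` in the domain is equal to
`x_j` in the sense of `I.eq`. Totality provides a value, and `func_val` makes its projection unique,
so this is the same as `f(…) = x_j` in `N`. -/
theorem Defines.sat_unnested {M : Type w} {N : Type w'} [L'.Structure M] [L.Structure N]
    (D : I.Defines M N) {n : ℕ} {φ : Fm L n} {ψ : Fm L' n} (h : I.Unnested φ ψ) :
    ∀ v : Fin n → M, (∀ i, I.InDom (v i)) → (Sat ψ v ↔ Sat φ fun i => D.proj (v i)) := by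
  have hpair : ∀ {n : ℕ} (i j : Fin n) (v : Fin n → M), (∀ i, I.InDom (v i)) →
      (Sat (substFm (fun l => tvar (![i, j] l)) I.eq) v ↔ D.proj (v i) = D.proj (v j)) := by
    intro n i j v hv
    rw [sat_substFm, ← D.eq_iff _ _ (hv i) (hv j)]
    refine iff_of_eq (congrArg _ ?_)
    funext l
    fin_cases l <;> rfl
  induction h with
  | falsum n => intros; rfl
  | equal i j => exact fun v hv => hpair i j v hv
  | @func n k f σ j =>
    intro v hv
    rw [sat_all, sat_equal, evalTm_func]
    have hsnoc : ∀ a : M, (fun l => evalTm (tvar ((Fin.snoc (fun l => (σ l).castSucc) (Fin.last n) :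
        Fin (k + 1) → Fin (n + 1)) l) : Tm L' (n + 1)) (Fin.snoc v a : Fin (n + 1) → M)) =
        (Fin.snoc (fun l => v (σ l)) a : Fin (k + 1) → M) := by
      intro a
      funext l
      refine Fin.lastCases ?_ (fun l => ?_) l <;> simp
    simp only [sat_imp, sat_domAt, Fin.snoc_last, sat_substFm (I.func f), hsnoc]
    constructor
    · intro h
      obtain ⟨b, hb, hf⟩ := D.func_total f (fun l => v (σ l)) fun l => hv _
      have h₁ := (hpair _ _ _ (I.inDom_snoc hv hb)).1 (h b hb hf)
      rw [Fin.snoc_last, Fin.snoc_castSucc] at h₁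
      exact (D.func_val f _ b (fun l => hv _) hb hf).trans h₁
    · intro h a ha hf
      refine (hpair _ _ _ (I.inDom_snoc hv ha)).2 ?_
      rw [Fin.snoc_last, Fin.snoc_castSucc]
      exact (D.func_val f _ a (fun l => hv _) ha hf).symm.trans h
  | rel R σ =>
    intro v hv
    rw [sat_substFm]
    exact D.rel_iff R _ fun i => hv _
  | imp _ _ ih₁ ih₂ => intro v hv; exact imp_congr (ih₁ v hv) (ih₂ v hv)
  | all _ ih =>
    intro v hv
    rw [sat_all, sat_all, D.forall_iff]
    refine forall_congr' fun a => ?_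
    rw [sat_imp, sat_domAt, Fin.snoc_last]
    exact imp_congr_right fun ha => ih _ (I.inDom_snoc hv ha)

theorem exists_unnested_imp {n : ℕ} {φ ψ : Fm L n} (h₁ : ∃ φ', I.Unnested φ φ')
    (h₂ : ∃ ψ', I.Unnested ψ ψ') : ∃ χ, I.Unnested (φ.imp ψ) χ :=
  let ⟨_, h₁⟩ := h₁
  let ⟨_, h₂⟩ := h₂
  ⟨_, .imp h₁ h₂⟩

theorem exists_unnested_not {n : ℕ} {φ : Fm L n} (h : ∃ φ', I.Unnested φ φ') :
    ∃ χ, I.Unnested φ.not χ :=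
  exists_unnested_imp h ⟨_, .falsum n⟩

theorem exists_unnested_inf {n : ℕ} {φ ψ : Fm L n} (h₁ : ∃ φ', I.Unnested φ φ')
    (h₂ : ∃ ψ', I.Unnested ψ ψ') : ∃ χ, I.Unnested (φ ⊓ ψ) χ :=
  exists_unnested_not (exists_unnested_imp h₁ (exists_unnested_not h₂))

theorem exists_unnested_all {n : ℕ} {φ : Fm L (n + 1)} (h : ∃ φ', I.Unnested φ φ') :
    ∃ χ, I.Unnested φ.all χ :=
  let ⟨_, h⟩ := h
  ⟨_, .all h⟩

theorem exists_unnested_top (n : ℕ) : ∃ χ, I.Unnested (⊤ : Fm L n) χ :=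
  exists_unnested_not ⟨_, .falsum n⟩

theorem exists_unnested_bexs {m : ℕ} (k : ℕ) {φ : Fm L (m + k)} (h : ∃ φ', I.Unnested φ φ') :
    ∃ χ, I.Unnested ((identity L).bexs k φ) χ := by
  induction k with
  | zero => exact h
  | succ k ih =>
    exact ih (exists_unnested_not (exists_unnested_all (exists_unnested_not
      (exists_unnested_inf (exists_unnested_top _) h))))

theorem exists_unnested_conj {n : ℕ} {l : List (Fm L n)} (h : ∀ φ ∈ l, ∃ φ', I.Unnested φ φ') :
    ∃ χ, I.Unnested (conj l) χ := by
  induction l with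
  | nil => exact exists_unnested_top n
  | cons φ l ih =>
    exact exists_unnested_inf (h φ (by simp)) (ih fun ψ hψ => h ψ (by simp [hψ]))

theorem exists_unnested_graph {n : ℕ} (t : Tm L n) : ∀ {m : ℕ} (e : Fin n → Fin m) (y : Fin m),
    ∃ χ, I.Unnested ((identity L).graph t e y) χ := by
  induction t with
  | var x =>
    rcases x with e | i
    · exact e.elim
    · exact fun e y => ⟨_, .equal _ _⟩
  | @func k f ts ih =>
    intro m e y
    refine exists_unnested_bexs k (exists_unnested_inf (exists_unnested_conj ?_) ?_)
    · rw [List.forall_mem_ofFn_iff]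
      exact fun i => ih i _ _
    · simp only [identity, substFm, substTm_func, substTm_tvar, Fin.snoc_castSucc, Fin.snoc_last]
      exact ⟨_, .func f _ _⟩

theorem exists_unnested_atom {n k : ℕ} {P : Fm L k} (ts : Fin k → Tm L n)
    (h : ∀ (m : ℕ) (σ : Fin k → Fin m), ∃ χ, I.Unnested (substFm (fun i => tvar (σ i)) P) χ) :
    ∃ χ, I.Unnested ((identity L).atom P ts) χ := by
  refine exists_unnested_bexs k (exists_unnested_inf (exists_unnested_conj ?_) (h _ _))
  rw [List.forall_mem_ofFn_iff]
  exact fun i => exists_unnested_graph _ _ _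

/-- The identity translation turns every formula into an unnested one. -/
theorem exists_unnested_identity {n : ℕ} (φ : Fm L n) :
    ∃ χ, I.Unnested ((identity L).onFm φ) χ := by
  induction φ with
  | falsum => exact ⟨_, .falsum _⟩
  | equal t s => exact exists_unnested_atom _ fun m σ => ⟨_, .equal _ _⟩
  | rel R ts => exact exists_unnested_atom _ fun m σ => ⟨_, .rel R σ⟩
  | imp φ ψ ih₁ ih₂ => exact exists_unnested_imp ih₁ ih₂
  | all φ ih => exact exists_unnested_all (exists_unnested_imp (exists_unnested_top _) ih)

end Unnested

end Translation

end G1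

namespace G1

open FirstOrder.Language Encodable

universe u v w

/-! ### Recursion on codes of terms and formulas -/

section Codes

/-- The list with a given code. -/
def listOf (c : ℕ) : List ℕ := (decode (α := List ℕ) c).getD []

@[simp] theorem listOf_encode (l : List ℕ) : listOf (encode l) = l := by
  simp [listOf]

@[simp] theorem encode_listOf (c : ℕ) : encode (listOf c) = c := by
  rw [listOf, Denumerable.decode_eq_ofNat]
  exact Denumerable.encode_ofNat c

/-- This makes recursion from a compound code to the codes of its arguments well founded. -/
theorem lt_encode_of_mem {l : List ℕ} {x : ℕ} (h : x ∈ l) : x < encode l := by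
  induction l with
  | nil => simp at h
  | cons a l ih =>
    rw [Encodable.encode_list_cons, encode_nat, Nat.lt_succ_iff]
    rcases List.mem_cons.1 h with rfl | h
    · exact Nat.left_le_pair _ _
    · exact (ih h).le.trans (Nat.right_le_pair _ _)

theorem lt_of_mem_listOf {c x : ℕ} (h : x ∈ listOf c) : x < c := by
  simpa using lt_encode_of_mem h

/-- Operations along which values of term codes and formula codes are computed recursively. -/
structure CodeAlgebra (τ σ : Type*) where
  var : ℕ → τ
  func : ℕ → List τ → τ
  falsum : σ
  equal : τ → τ → σ
  rel : ℕ → List τ → σ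
  imp : σ → σ → σ
  all : σ → σ

namespace CodeAlgebra

variable {τ σ : Type*} (A : CodeAlgebra τ σ)

/-- The value of a term code. -/
def term (c : ℕ) : τ :=
  if c % 2 = 0 then A.var (c / 2)
  else A.func (c / 2).unpair.1 ((listOf (c / 2).unpair.2).attach.map fun x => term x.1)
termination_by c
decreasing_by
  have h₁ := lt_of_mem_listOf x.2
  have h₂ := Nat.unpair_right_le (c / 2)
  omega

theorem term_var (i : ℕ) : A.term (2 * i) = A.var i := by
  rw [term, if_pos (by omega)]
  congr 1
  omega

theorem term_func (a b : ℕ) :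
    A.term (2 * Nat.pair a b + 1) = A.func a ((listOf b).map A.term) := by
  have h : (2 * Nat.pair a b + 1) / 2 = Nat.pair a b := by omega
  rw [term, if_neg (by omega), h, Nat.unpair_pair, List.attach_map_val (f := A.term)]

/-- The value of a formula code. -/
def form : ℕ → σ
  | 0 => A.falsum
  | c + 1 =>
    -- Here `c` is the code minus one, so the residues 0, 1, 2, 3 stand for equations, relations,
    -- implications and quantifiers.
    if c % 4 = 0 then A.equal (A.term (c / 4).unpair.1) (A.term (c / 4).unpair.2)
    else if c % 4 = 1 then A.rel (c / 4).unpair.1 ((listOf (c / 4).unpair.2).map A.term)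
    else if c % 4 = 2 then A.imp (form (c / 4).unpair.1) (form (c / 4).unpair.2)
    else A.all (form (c / 4))
termination_by c => c
decreasing_by
  all_goals
    have h₁ := Nat.unpair_left_le (c / 4)
    have h₂ := Nat.unpair_right_le (c / 4)
    omega

theorem form_falsum : A.form 0 = A.falsum := by rw [form]

theorem form_equal (a b : ℕ) :
    A.form (4 * Nat.pair a b + 1) = A.equal (A.term a) (A.term b) := by
  have h : 4 * Nat.pair a b / 4 = Nat.pair a b := by omega
  rw [form, if_pos (by omega), h, Nat.unpair_pair]

theorem form_rel (a b : ℕ) :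
    A.form (4 * Nat.pair a b + 2) = A.rel a ((listOf b).map A.term) := by
  have h : (4 * Nat.pair a b + 1) / 4 = Nat.pair a b := by omega
  rw [form, if_neg (by omega), if_pos (by omega), h, Nat.unpair_pair]

theorem form_imp (a b : ℕ) :
    A.form (4 * Nat.pair a b + 3) = A.imp (A.form a) (A.form b) := by
  have h : (4 * Nat.pair a b + 2) / 4 = Nat.pair a b := by omega
  rw [form, if_neg (by omega), if_neg (by omega), if_pos (by omega), h, Nat.unpair_pair]

theorem form_all (a : ℕ) : A.form (4 * a + 4) = A.all (A.form a) := by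
  have h : (4 * a + 3) / 4 = a := by omega
  rw [form, if_neg (by omega), if_neg (by omega), if_neg (by omega), h]

theorem term_codeTm_func {L : FirstOrder.Language.{u, v}} [Arithmetization L] {n k : ℕ}
    (f : L.Functions k) (ts : Fin k → Tm L n) :
    A.term (codeTm (.func f ts)) =
      A.func (Arithmetization.funcCode f) (List.ofFn fun i => A.term (codeTm (ts i))) := by
  rw [codeTm, term_func, listOf_encode, List.map_ofFn]
  rfl

theorem form_code_rel {L : FirstOrder.Language.{u, v}} [Arithmetization L] {n k : ℕ}
    (R : L.Relations k) (ts : Fin k → Tm L n) :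
    A.form (code (.rel R ts)) =
      A.rel (Arithmetization.relCode R) (List.ofFn fun i => A.term (codeTm (ts i))) := by
  rw [code, form_rel, listOf_encode, List.map_ofFn]
  rfl

end CodeAlgebra

theorem computable_mod (k : ℕ) : Computable fun c : ℕ => c % k :=
  (Primrec.nat_mod.comp Primrec.id (Primrec.const k)).to_comp

theorem computable_div (k : ℕ) : Computable fun c : ℕ => c / k :=
  (Primrec.nat_div.comp Primrec.id (Primrec.const k)).to_comp

theorem computable_beq {α : Type*} [Primcodable α] {f g : α → ℕ} (hf : Computable f)
    (hg : Computable g) : Computable fun a => decide (f a = g a) :=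
  (PrimrecRel.decide Primrec.eq).to_comp.comp hf hg

theorem computable_ite {α σ : Type*} [Primcodable α] [Primcodable σ] {p : α → Prop}
    [DecidablePred p] {f g : α → σ} (hp : Computable fun a => decide (p a)) (hf : Computable f)
    (hg : Computable g) : Computable fun a => if p a then f a else g a :=
  (Computable.cond hp hf hg).of_eq fun a => by by_cases h : p a <;> simp [h]

/-- A family of algebras with uniformly computable operations. -/
structure ComputableAlgebra {α τ σ : Type*} [Primcodable α] [Primcodable τ] [Primcodable σ]
    (A : α → CodeAlgebra τ σ) : Prop where
  var : Computable fun p : α × ℕ => (A p.1).var p.2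
  func : Computable fun p : α × ℕ × List τ => (A p.1).func p.2.1 p.2.2
  falsum : Computable fun a => (A a).falsum
  equal : Computable fun p : α × τ × τ => (A p.1).equal p.2.1 p.2.2
  rel : Computable fun p : α × ℕ × List τ => (A p.1).rel p.2.1 p.2.2
  imp : Computable fun p : α × σ × σ => (A p.1).imp p.2.1 p.2.2
  all : Computable fun p : α × σ => (A p.1).all p.2

namespace ComputableAlgebra

variable {α τ σ : Type*} [Primcodable α] [Primcodable τ] [Primcodable σ]
  [Inhabited τ] [Inhabited σ] {A : α → CodeAlgebra τ σ}

/-- Course-of-values recursion, run for terms and formulas at once because the value of an atomic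
formula needs the values of smaller term codes. The history `H` lists the values at all codes below
`H.length`, the code being treated. -/
theorem computable_pair (hA : ComputableAlgebra A) :
    Computable₂ fun a c => ((A a).term c, (A a).form c) := by
  let S := List (τ × σ)
  let tm : S → ℕ → τ := fun H x => (H.getI x).1
  let fm : S → ℕ → σ := fun H x => (H.getI x).2
  let g : α → S → τ × σ := fun a H =>
    (if H.length % 2 = 0 then (A a).var (H.length / 2)
      else (A a).func (H.length / 2).unpair.1 ((listOf (H.length / 2).unpair.2).map (tm H)),
    if H.length = 0 then (A a).falsum else
      if (H.length - 1) % 4 = 0 then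
        (A a).equal (tm H ((H.length - 1) / 4).unpair.1) (tm H ((H.length - 1) / 4).unpair.2)
      else if (H.length - 1) % 4 = 1 then
        (A a).rel ((H.length - 1) / 4).unpair.1
          ((listOf ((H.length - 1) / 4).unpair.2).map (tm H))
      else if (H.length - 1) % 4 = 2 then
        (A a).imp (fm H ((H.length - 1) / 4).unpair.1) (fm H ((H.length - 1) / 4).unpair.2)
      else (A a).all (fm H ((H.length - 1) / 4)))
  have hget : Primrec₂ fun (H : S) (x : ℕ) => H.getI x := Primrec.list_getI
  have htm : Computable₂ tm := (Primrec.fst.comp hget).to_comp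
  have hfm : Computable₂ fm := (Primrec.snd.comp hget).to_comp
  have hmap : Computable₂ fun (H : S) (c : ℕ) => (listOf c).map (tm H) := by
    refine (Primrec.list_map (f := fun p : S × ℕ => listOf p.2) (g := fun p x => tm p.1 x)
      ?_ ?_).to_comp
    · exact Primrec.option_getD.comp (Primrec.decode.comp Primrec.snd) (Primrec.const [])
    · exact (Primrec.fst.comp (hget.comp (Primrec.fst.comp Primrec.fst) Primrec.snd))
  have hlen : Computable fun p : α × S => p.2.length := Computable.list_length.comp .snd
  have hlen' : Computable fun p : α × S => p.2.length - 1 := Computable.pred.comp hlen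
  have h4 : Computable fun p : α × S => (p.2.length - 1) / 4 := (computable_div 4).comp hlen'
  have h4u := Computable.unpair.comp h4
  have h2 : Computable fun p : α × S => p.2.length / 2 := (computable_div 2).comp hlen
  have h2u := Computable.unpair.comp h2
  have hg : Computable₂ g := by
    refine Computable.pair ?_ ?_
    · refine computable_ite (computable_beq ((computable_mod 2).comp hlen) (.const 0)) ?_ ?_
      · exact hA.var.comp (Computable.pair .fst h2)
      · exact hA.func.comp (Computable.pair .fst (Computable.pair (Computable.fst.comp h2u)
          (hmap.comp .snd (Computable.snd.comp h2u))))
    · refine computable_ite (computable_beq hlen (.const 0)) (hA.falsum.comp .fst) ?_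
      refine computable_ite (computable_beq ((computable_mod 4).comp hlen') (.const 0)) ?_ ?_
      · exact hA.equal.comp (Computable.pair .fst (Computable.pair
          (htm.comp .snd (Computable.fst.comp h4u)) (htm.comp .snd (Computable.snd.comp h4u))))
      refine computable_ite (computable_beq ((computable_mod 4).comp hlen') (.const 1)) ?_ ?_
      · exact hA.rel.comp (Computable.pair .fst (Computable.pair (Computable.fst.comp h4u)
          (hmap.comp .snd (Computable.snd.comp h4u))))
      refine computable_ite (computable_beq ((computable_mod 4).comp hlen') (.const 2)) ?_ ?_
      · exact hA.imp.comp (Computable.pair .fst (Computable.pair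
          (hfm.comp .snd (Computable.fst.comp h4u)) (hfm.comp .snd (Computable.snd.comp h4u))))
      · exact hA.all.comp (Computable.pair .fst (hfm.comp .snd h4))
  refine Computable.nat_strong_rec (g := fun a H => some (g a H)) _
    (Computable.option_some.comp hg) fun a c => ?_
  congr 1
  -- Only smaller codes are looked up, so the default value of `getI` is never used.
  have hH : ∀ x < c, ((List.range c).map fun c => ((A a).term c, (A a).form c)).getI x =
      ((A a).term x, (A a).form x) := by
    intro x hx
    rw [List.getI_eq_getElem _ (by simpa using hx)]
    simp
  have htm' : ∀ x < c, tm ((List.range c).map fun c => ((A a).term c, (A a).form c)) x =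
      (A a).term x := fun x hx => by simp only [tm, hH x hx]
  have hfm' : ∀ x < c, fm ((List.range c).map fun c => ((A a).term c, (A a).form c)) x =
      (A a).form x := fun x hx => by simp only [fm, hH x hx]
  have hmap' : ∀ b < c, (listOf b).map
      (tm ((List.range c).map fun c => ((A a).term c, (A a).form c))) =
      (listOf b).map (A a).term := fun b hb =>
    List.map_congr_left fun x hx => htm' x ((lt_of_mem_listOf hx).trans hb)
  simp only [g, List.length_map, List.length_range]
  refine Prod.ext ?_ ?_
  · simp only
    conv_rhs => rw [CodeAlgebra.term]
    split_ifs with h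
    · rfl
    · have := Nat.unpair_right_le (c / 2)
      rw [hmap' _ (by omega), List.attach_map_val (f := (A a).term)]
  · simp only
    cases c with
    | zero => rw [if_pos rfl, CodeAlgebra.form]
    | succ c =>
      have h₁ := Nat.unpair_left_le (c / 4)
      have h₂ := Nat.unpair_right_le (c / 4)
      rw [if_neg (Nat.succ_ne_zero c), Nat.add_sub_cancel, CodeAlgebra.form, htm' _ (by omega),
        htm' _ (by omega), hmap' _ (by omega), hfm' _ (by omega), hfm' _ (by omega),
        hfm' _ (by omega)]

theorem computable_term (hA : ComputableAlgebra A) : Computable₂ fun a c => (A a).term c :=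
  Computable.fst.comp hA.computable_pair

theorem computable_form (hA : ComputableAlgebra A) : Computable₂ fun a c => (A a).form c :=
  Computable.snd.comp hA.computable_pair

end ComputableAlgebra

end Codes

end G1

namespace G1

open FirstOrder.Language Encodable

universe u v w

/-! ### The constructors of formulas on codes -/

section Constructors

/-- The code of an implication. -/
def impCode (a b : ℕ) : ℕ := 4 * Nat.pair a b + 3

/-- The code of a universal quantification. -/
def allCode (a : ℕ) : ℕ := 4 * a + 4

/-- The code of an equation. -/
def equalCode (a b : ℕ) : ℕ := 4 * Nat.pair a b + 1

/-- The code of an atomic formula with a relation symbol. -/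
def relAppCode (a : ℕ) (l : List ℕ) : ℕ := 4 * Nat.pair a (encode l) + 2

/-- The code of a compound term. -/
def funcAppCode (a : ℕ) (l : List ℕ) : ℕ := 2 * Nat.pair a (encode l) + 1

theorem primrec_affine_pair (k r : ℕ) : Primrec₂ fun a b : ℕ => k * Nat.pair a b + r :=
  Primrec.nat_add.comp (Primrec.nat_mul.comp (Primrec.const k) Primrec₂.natPair) (Primrec.const r)

theorem computable_impCode : Computable₂ impCode := (primrec_affine_pair 4 3).to_comp

theorem computable_equalCode : Computable₂ equalCode := (primrec_affine_pair 4 1).to_comp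

theorem computable_allCode : Computable allCode :=
  (Primrec.nat_add.comp (Primrec.nat_mul.comp (Primrec.const 4) Primrec.id)
    (Primrec.const 4)).to_comp

theorem computable_relAppCode : Computable₂ relAppCode :=
  ((primrec_affine_pair 4 2).comp Primrec.fst (Primrec.encode.comp Primrec.snd)).to_comp

theorem computable_funcAppCode : Computable₂ funcAppCode :=
  ((primrec_affine_pair 2 1).comp Primrec.fst (Primrec.encode.comp Primrec.snd)).to_comp

variable {L : FirstOrder.Language.{u, v}} [Arithmetization L]

theorem code_imp {n : ℕ} (φ ψ : Fm L n) : code (φ.imp ψ) = impCode (code φ) (code ψ) := rfl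

theorem code_all {n : ℕ} (φ : Fm L (n + 1)) : code φ.all = allCode (code φ) := rfl

theorem code_equal {n : ℕ} (t s : Tm L n) :
    code (.equal t s : Fm L n) = equalCode (codeTm t) (codeTm s) := rfl

theorem codeTm_tvar {n : ℕ} (i : Fin n) : codeTm (tvar i : Tm L n) = 2 * (i : ℕ) := rfl

end Constructors

/-! ### Substitution on codes -/

section SubstitutionCodes

/-- Substitution of the term with code `V i` for the variable `x_i`, bound or free. -/
def substAlgebra (V : ℕ → ℕ) : CodeAlgebra ℕ ℕ where
  var := V
  func := funcAppCode
  falsum := 0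
  equal := equalCode
  rel := relAppCode
  imp := impCode
  all := allCode

theorem computable_substAlgebra {α : Type*} [Primcodable α] {V : α → ℕ → ℕ}
    (hV : Computable₂ V) : ComputableAlgebra fun a => substAlgebra (V a) where
  var := hV
  func := computable_funcAppCode.comp (Computable.fst.comp .snd) (Computable.snd.comp .snd)
  falsum := .const 0
  equal := computable_equalCode.comp (Computable.fst.comp .snd) (Computable.snd.comp .snd)
  rel := computable_relAppCode.comp (Computable.fst.comp .snd) (Computable.snd.comp .snd)
  imp := computable_impCode.comp (Computable.fst.comp .snd) (Computable.snd.comp .snd)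
  all := computable_allCode.comp .snd

variable {L : FirstOrder.Language.{u, v}} [Arithmetization L]

theorem substAlgebra_term {V : ℕ → ℕ} {m n : ℕ} {σ : Fin m → Tm L n}
    (hσ : ∀ i, codeTm (σ i) = V i) (t : Tm L m) :
    (substAlgebra V).term (codeTm t) = codeTm (substTm σ t) := by
  induction t with
  | var x =>
    rcases x with e | i
    · exact e.elim
    · exact ((substAlgebra V).term_var i).trans (hσ i).symm
  | func f ts ih =>
    rw [CodeAlgebra.term_codeTm_func, substTm_func, codeTm]
    simp only [ih]
    rfl

theorem codeTm_relabel_castSucc {n : ℕ} (t : Tm L n) :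
    codeTm (t.relabel (Sum.map id Fin.castSucc) : Tm L (n + 1)) = codeTm t := by
  induction t with
  | var x =>
    rcases x with e | i
    · exact e.elim
    · rfl
  | func f ts ih => simp only [Term.relabel, codeTm, ih]

/-- Variables are numbered by level, so terms keep their codes when a quantifier is entered. The
second condition on `V` already prescribes where all bound variables go, from level `j ≥ m` to `j -
m + n`; hence one map `V` serves under all quantifiers. -/
theorem substAlgebra_form {V : ℕ → ℕ} {m : ℕ} (φ : Fm L m) : ∀ {n : ℕ} {σ : Fin m → Tm L n},
    (∀ i, codeTm (σ i) = V i) → (∀ j, m ≤ j → V j = 2 * (j - m + n)) →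
    (substAlgebra V).form (code φ) = code (substFm σ φ) := by
  induction φ with
  | falsum => intros; exact CodeAlgebra.form_falsum _
  | equal t s =>
    intro n σ hσ hV
    rw [code, CodeAlgebra.form_equal, substAlgebra_term hσ, substAlgebra_term hσ]
    rfl
  | rel R ts =>
    intro n σ hσ hV
    rw [CodeAlgebra.form_code_rel, substFm, code]
    simp only [substAlgebra_term hσ]
    rfl
  | imp φ ψ ih₁ ih₂ =>
    intro n σ hσ hV
    rw [code, CodeAlgebra.form_imp, ih₁ hσ hV, ih₂ hσ hV]
    rfl
  | @all m φ ih =>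
    intro n σ hσ hV
    rw [code, CodeAlgebra.form_all, ih (n := n + 1) (σ := liftSubst σ)]
    · rfl
    · intro i
      refine Fin.lastCases ?_ (fun i => ?_) i
      · rw [liftSubst_last, codeTm_tvar, Fin.val_last, Fin.val_last, hV m le_rfl]
        omega
      · rw [liftSubst, Fin.snoc_castSucc, codeTm_relabel_castSucc, hσ]
        rfl
    · intro j hj
      rw [hV j (by omega)]
      omega

/-- The variable map renaming `x_i` to `x_{l[i]}`, with values in a context of length `n`. -/
def renameMap (p : ℕ × List ℕ) (i : ℕ) : ℕ :=
  if i < p.2.length then 2 * p.2.getI i else 2 * (i - p.2.length + p.1)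

/-- The code of a formula after renaming `x_i` to `x_{l[i]}`. -/
def renameCode (n : ℕ) (l : List ℕ) (c : ℕ) : ℕ := (substAlgebra (renameMap (n, l))).form c

theorem computable_renameCode :
    Computable fun p : ℕ × List ℕ × ℕ => renameCode p.1 p.2.1 p.2.2 := by
  have h : Computable₂ renameMap := by
    have hlen : Primrec fun q : (ℕ × List ℕ) × ℕ => q.1.2.length :=
      Primrec.list_length.comp (Primrec.snd.comp Primrec.fst)
    refine Primrec.to_comp (Primrec.ite (Primrec.nat_lt.comp Primrec.snd hlen) ?_ ?_)
    · exact Primrec.nat_mul.comp (Primrec.const 2)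
        (Primrec.list_getI.comp (Primrec.snd.comp Primrec.fst) Primrec.snd)
    · exact Primrec.nat_mul.comp (Primrec.const 2) (Primrec.nat_add.comp
        (Primrec.nat_sub.comp Primrec.snd hlen) (Primrec.fst.comp Primrec.fst))
  exact (computable_substAlgebra h).computable_form.comp
    (Computable.pair .fst (Computable.fst.comp .snd)) (Computable.snd.comp .snd)

theorem code_rename {m n : ℕ} (ρ : Fin m → Fin n) (φ : Fm L m) :
    code (substFm (fun i => tvar (ρ i)) φ) =
      renameCode n (List.ofFn fun i => (ρ i : ℕ)) (code φ) := by
  refine (substAlgebra_form φ (fun i => ?_) fun j hj => ?_).symm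
  · rw [codeTm_tvar, renameMap, if_pos (by simp), List.getI_eq_getElem _ (by simp)]
    simp
  · simp [renameMap, hj]

theorem code_ofSentence (n : ℕ) (φ : L.Sentence) :
    code (ofSentence n φ) = renameCode n [] (code (n := 0) φ) := by
  have h : (fun i : Fin 0 => i.elim0 : Fin 0 → Tm L n) =
      fun i => tvar ((fun i : Fin 0 => i.elim0 : Fin 0 → Fin n) i) := funext fun i => i.elim0
  rw [ofSentence, h, code_rename]
  simp

theorem code_weaken {n : ℕ} (φ : Fm L n) :
    code (weaken φ) = renameCode (n + 1) (List.range n) (code φ) := by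
  rw [weaken, code_rename]
  congr 1
  apply List.ext_getElem <;> simp

/-- The variable map substituting the term with code `t` for `x_n`. -/
def instMap (p : ℕ × ℕ) (i : ℕ) : ℕ :=
  -- Bound variables, with `i > n`, move down by one since the context shrinks from `n + 1` to `n`.
  if i < p.1 then 2 * i else if i = p.1 then p.2 else 2 * (i - 1)

/-- The code of a formula after substituting the term with code `t` for `x_n`. -/
def instCode (n t c : ℕ) : ℕ := (substAlgebra (instMap (n, t))).form c

theorem computable_instCode :
    Computable fun p : ℕ × ℕ × ℕ => instCode p.1 p.2.1 p.2.2 := by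
  have h : Computable₂ instMap := by
    have hfst : Primrec fun q : (ℕ × ℕ) × ℕ => q.1.1 := Primrec.fst.comp Primrec.fst
    refine Primrec.to_comp (Primrec.ite (Primrec.nat_lt.comp Primrec.snd hfst)
      (Primrec.nat_mul.comp (Primrec.const 2) Primrec.snd)
      (Primrec.ite (Primrec.eq.comp Primrec.snd hfst) (Primrec.snd.comp Primrec.fst) ?_))
    exact Primrec.nat_mul.comp (Primrec.const 2) (Primrec.pred.comp Primrec.snd)
  exact (computable_substAlgebra h).computable_form.comp
    (Computable.pair .fst (Computable.fst.comp .snd)) (Computable.snd.comp .snd)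

theorem code_inst {n : ℕ} (φ : Fm L (n + 1)) (t : Tm L n) :
    code (inst φ t) = instCode n (codeTm t) (code φ) := by
  refine (substAlgebra_form φ (fun i => ?_) fun j hj => ?_).symm
  · refine Fin.lastCases ?_ (fun i => ?_) i
    · simp [instMap]
    · simp [instMap, codeTm_tvar]
  · have h₁ : ¬ j < n := by omega
    have h₂ : j ≠ n := by omega
    simp only [instMap, h₁, h₂, if_false]
    omega

end SubstitutionCodes

/-! ### Decidability of well-formedness, and injectivity of the coding -/

section WellFormed

/-- The conjunction of the flags and the maximum of the bounds of a list. -/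
def combineInfo (l : List (Bool × ℕ)) : Bool × ℕ :=
  l.foldr (fun p q => (p.1 && q.1, max p.2 q.2)) (true, 0)

/-- The flag is set and the bound is at most `n`. -/
def InfoOk (n : ℕ) (p : Bool × ℕ) : Prop := p.1 = true ∧ p.2 ≤ n

theorem infoOk_combineInfo {n : ℕ} {l : List (Bool × ℕ)} :
    InfoOk n (combineInfo l) ↔ ∀ p ∈ l, InfoOk n p := by
  induction l with
  | nil => simp [combineInfo, InfoOk]
  | cons p l ih =>
    rw [List.forall_mem_cons, ← ih]
    simp only [combineInfo, InfoOk, List.foldr_cons, Bool.and_eq_true, max_le_iff]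
    tauto

variable (L : FirstOrder.Language.{u, v}) [Arithmetization L]

/-- Computes whether the arities are respected, and the length of the shortest context in which
the free variables are contained. -/
def infoAlgebra : CodeAlgebra (Bool × ℕ) (Bool × ℕ) where
  var i := (true, i + 1)
  -- Arities are compared through `encode`, since `computable_beq` tests equality of numbers.
  func a l := (decide (encode (Arithmetization.funcArity L a) = encode (some l.length)) &&
    (combineInfo l).1, (combineInfo l).2)
  falsum := (true, 0)
  equal p q := combineInfo [p, q]
  rel a l := (decide (encode (Arithmetization.relArity L a) = encode (some l.length)) &&
    (combineInfo l).1, (combineInfo l).2)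
  imp p q := combineInfo [p, q]
  -- With truncated subtraction, `b - 1 ≤ n` iff `b ≤ n + 1`: the quantifier binds the last variable
  -- of the context.
  all p := (p.1, p.2 - 1)

theorem computable_combineInfo : Computable combineInfo := by
  refine (Primrec.list_foldr (f := fun l : List (Bool × ℕ) => l) (g := fun _ => (true, 0))
    (h := fun _ p => (p.1.1 && p.2.1, max p.1.2 p.2.2)) Primrec.id (Primrec.const _) ?_).to_comp
  refine Primrec.pair (Primrec.and.comp ?_ ?_) (Primrec.nat_max.comp ?_ ?_)
  · exact Primrec.fst.comp (Primrec.fst.comp Primrec.snd)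
  · exact Primrec.fst.comp (Primrec.snd.comp Primrec.snd)
  · exact Primrec.snd.comp (Primrec.fst.comp Primrec.snd)
  · exact Primrec.snd.comp (Primrec.snd.comp Primrec.snd)

theorem computable_arityCheck {ar : ℕ → Option ℕ} (har : Computable ar) :
    Computable fun p : Unit × ℕ × List (Bool × ℕ) =>
      ((decide (encode (ar p.2.1) = encode (some p.2.2.length)) && (combineInfo p.2.2).1,
        (combineInfo p.2.2).2) : Bool × ℕ) := by
  have hl : Computable fun p : Unit × ℕ × List (Bool × ℕ) => p.2.2 := Computable.snd.comp .snd
  have hc := computable_combineInfo.comp hl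
  refine Computable.pair (Primrec.and.to_comp.comp (computable_beq ?_ ?_) (Computable.fst.comp hc))
    (Computable.snd.comp hc)
  · exact Computable.encode.comp (har.comp (Computable.fst.comp .snd))
  · exact Computable.encode.comp (Computable.option_some.comp (Computable.list_length.comp hl))

theorem computable_infoAlgebra : ComputableAlgebra fun _ : Unit => infoAlgebra L := by
  have hpair : Computable fun p : Unit × (Bool × ℕ) × (Bool × ℕ) =>
      combineInfo [p.2.1, p.2.2] :=
    computable_combineInfo.comp (Computable.list_cons.comp (Computable.fst.comp .snd)
      (Computable.list_cons.comp (Computable.snd.comp .snd) (.const [])))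
  exact
    { var := Computable.pair (.const true) (Computable.succ.comp .snd)
      func := computable_arityCheck Arithmetization.funcArity_computable
      falsum := .const _
      equal := hpair
      rel := computable_arityCheck Arithmetization.relArity_computable
      imp := hpair
      all := Computable.pair (Computable.fst.comp .snd)
        (Computable.pred.comp (Computable.snd.comp .snd)) }

/-- Whether a number is the code of a term in the context of length `n`. -/
def isTmCode (n c : ℕ) : Bool :=
  ((infoAlgebra L).term c).1 && decide (((infoAlgebra L).term c).2 ≤ n)

/-- Whether a number is the code of a formula in the context of length `n`. -/
def isFmCode (n c : ℕ) : Bool :=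
  ((infoAlgebra L).form c).1 && decide (((infoAlgebra L).form c).2 ≤ n)

theorem computable_isTmCode : Computable₂ (isTmCode L) := by
  have h : Computable fun p : ℕ × ℕ => (infoAlgebra L).term p.2 :=
    (computable_infoAlgebra L).computable_term.comp (.const ()) .snd
  exact Primrec.and.to_comp.comp (Computable.fst.comp h)
    ((PrimrecRel.decide Primrec.nat_le).to_comp.comp (Computable.snd.comp h) .fst)

theorem computable_isFmCode : Computable₂ (isFmCode L) := by
  have h : Computable fun p : ℕ × ℕ => (infoAlgebra L).form p.2 :=
    (computable_infoAlgebra L).computable_form.comp (.const ()) .snd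
  exact Primrec.and.to_comp.comp (Computable.fst.comp h)
    ((PrimrecRel.decide Primrec.nat_le).to_comp.comp (Computable.snd.comp h) .fst)

variable {L}

theorem infoOk_func {n a : ℕ} {l : List (Bool × ℕ)} : InfoOk n ((infoAlgebra L).func a l) ↔
    Arithmetization.funcArity L a = some l.length ∧ ∀ p ∈ l, InfoOk n p := by
  rw [← infoOk_combineInfo]
  simp only [infoAlgebra, InfoOk, Bool.and_eq_true, decide_eq_true_eq, encode_inj, and_assoc]

theorem infoOk_rel {n a : ℕ} {l : List (Bool × ℕ)} : InfoOk n ((infoAlgebra L).rel a l) ↔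
    Arithmetization.relArity L a = some l.length ∧ ∀ p ∈ l, InfoOk n p := by
  rw [← infoOk_combineInfo]
  simp only [infoAlgebra, InfoOk, Bool.and_eq_true, decide_eq_true_eq, encode_inj, and_assoc]

theorem infoOk_term_codeTm {n : ℕ} (t : Tm L n) : InfoOk n ((infoAlgebra L).term (codeTm t)) := by
  induction t with
  | var x =>
    rcases x with e | i
    · exact e.elim
    · rw [codeTm, CodeAlgebra.term_var]
      exact ⟨rfl, i.2⟩
  | func f ts ih =>
    rw [CodeAlgebra.term_codeTm_func, infoOk_func, List.length_ofFn]
    exact ⟨(Arithmetization.funcArity_eq_some _ _).2 ⟨f, rfl⟩, (List.forall_mem_ofFn_iff).2 ih⟩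

theorem infoOk_form_code {n : ℕ} (φ : Fm L n) : InfoOk n ((infoAlgebra L).form (code φ)) := by
  induction φ with
  | falsum => rw [code, CodeAlgebra.form_falsum]; exact ⟨rfl, Nat.zero_le _⟩
  | equal t s =>
    rw [code, CodeAlgebra.form_equal]
    exact infoOk_combineInfo.2 (by simp [infoOk_term_codeTm])
  | rel R ts =>
    rw [CodeAlgebra.form_code_rel, infoOk_rel, List.length_ofFn]
    exact ⟨(Arithmetization.relArity_eq_some _ _).2 ⟨R, rfl⟩,
      (List.forall_mem_ofFn_iff).2 fun i => infoOk_term_codeTm (ts i)⟩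
  | imp φ ψ ih₁ ih₂ =>
    rw [code, CodeAlgebra.form_imp]
    exact infoOk_combineInfo.2 (by simp [ih₁, ih₂])
  | all φ ih =>
    rw [code, CodeAlgebra.form_all]
    exact ⟨ih.1, Nat.sub_le_of_le_add ih.2⟩

theorem exists_tuple_of_list {β : Type*} (l : List ℕ) (f : β → ℕ) (h : ∀ x ∈ l, ∃ b, f b = x) :
    ∃ g : Fin l.length → β, (List.ofFn fun i => f (g i)) = l := by
  choose g hg using fun i : Fin l.length => h l[i] (List.getElem_mem _)
  exact ⟨g, by simp only [hg]; exact List.ofFn_getElem⟩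

/-- The arity check produces a symbol with the given code whose arity is the length of the list of
arguments; the arguments have smaller codes. -/
theorem exists_tm_of_infoOk {n : ℕ} (c : ℕ) (h : InfoOk n ((infoAlgebra L).term c)) :
    ∃ t : Tm L n, codeTm t = c := by
  induction c using Nat.strong_induction_on with
  | _ c ih =>
    rcases Nat.even_or_odd' c with ⟨b, rfl | rfl⟩
    · rw [CodeAlgebra.term_var] at h
      exact ⟨tvar ⟨b, h.2⟩, rfl⟩
    · obtain ⟨a, d, rfl⟩ : ∃ a d, b = Nat.pair a d := ⟨_, _, (Nat.pair_unpair b).symm⟩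
      rw [CodeAlgebra.term_func, infoOk_func, List.length_map] at h
      obtain ⟨f, hf⟩ := (Arithmetization.funcArity_eq_some _ _).1 h.1
      obtain ⟨ts, hts⟩ := exists_tuple_of_list (listOf d) (codeTm : Tm L n → ℕ) fun x hx =>
        ih x (by
          have := lt_of_mem_listOf hx
          have := Nat.right_le_pair a d
          omega) (h.2 _ (List.mem_map_of_mem hx))
      refine ⟨.func f ts, ?_⟩
      rw [codeTm, hts, hf, encode_listOf]

theorem exists_fm_of_infoOk (c : ℕ) : ∀ {n : ℕ}, InfoOk n ((infoAlgebra L).form c) →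
    ∃ φ : Fm L n, code φ = c := by
  induction c using Nat.strong_induction_on with
  | _ c ih =>
    intro n h
    have hcases : c = 0 ∨ ∃ b, c = 4 * b + 1 ∨ c = 4 * b + 2 ∨ c = 4 * b + 3 ∨ c = 4 * b + 4 := by
      rcases Nat.eq_zero_or_pos c with h | h
      · exact .inl h
      · exact .inr ⟨(c - 1) / 4, by omega⟩
    rcases hcases with rfl | ⟨b, hb⟩
    · exact ⟨.falsum, rfl⟩
    obtain ⟨a, d, hab⟩ : ∃ a d, b = Nat.pair a d := ⟨_, _, (Nat.pair_unpair b).symm⟩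
    have ha := Nat.left_le_pair a d
    have hd := Nat.right_le_pair a d
    rcases hb with rfl | rfl | rfl | rfl
    · subst hab
      rw [CodeAlgebra.form_equal] at h
      have h₁ := infoOk_combineInfo.1 h
      obtain ⟨t, ht⟩ := exists_tm_of_infoOk (L := L) (n := n) a (h₁ _ (by simp))
      obtain ⟨s, hs⟩ := exists_tm_of_infoOk (L := L) (n := n) d (h₁ _ (by simp))
      exact ⟨.equal t s, by rw [code, ht, hs]⟩
    · subst hab
      rw [CodeAlgebra.form_rel, infoOk_rel, List.length_map] at h
      obtain ⟨R, hR⟩ := (Arithmetization.relArity_eq_some _ _).1 h.1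
      obtain ⟨ts, hts⟩ := exists_tuple_of_list (listOf d) (codeTm : Tm L n → ℕ) fun x hx =>
        exists_tm_of_infoOk x (h.2 _ (List.mem_map_of_mem hx))
      refine ⟨.rel R ts, ?_⟩
      rw [code, hts, hR, encode_listOf]
    · subst hab
      rw [CodeAlgebra.form_imp] at h
      have h₁ := infoOk_combineInfo.1 h
      obtain ⟨φ, hφ⟩ := ih a (by omega) (n := n) (h₁ _ (by simp))
      obtain ⟨ψ, hψ⟩ := ih d (by omega) (n := n) (h₁ _ (by simp))
      exact ⟨.imp φ ψ, by rw [code, hφ, hψ]⟩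
    · rw [CodeAlgebra.form_all] at h
      obtain ⟨φ, hφ⟩ := ih b (by omega) (n := n + 1) ⟨h.1, Nat.le_add_of_sub_le h.2⟩
      exact ⟨.all φ, by rw [code, hφ]⟩

theorem isTmCode_iff {n c : ℕ} : isTmCode L n c = true ↔ ∃ t : Tm L n, codeTm t = c := by
  simp only [isTmCode, Bool.and_eq_true, decide_eq_true_eq]
  exact ⟨exists_tm_of_infoOk c, by rintro ⟨t, rfl⟩; exact infoOk_term_codeTm t⟩

theorem isFmCode_iff {n c : ℕ} : isFmCode L n c = true ↔ ∃ φ : Fm L n, code φ = c := by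
  simp only [isFmCode, Bool.and_eq_true, decide_eq_true_eq]
  exact ⟨exists_fm_of_infoOk c, by rintro ⟨φ, rfl⟩; exact infoOk_form_code φ⟩

/-- The code determines the arity through `funcArity`; together with injectivity in each arity it
determines the symbol. -/
theorem funcCode_inj {j k : ℕ} {f : L.Functions j} {g : L.Functions k}
    (h : Arithmetization.funcCode f = Arithmetization.funcCode g) : j = k := by
  have h₁ := (Arithmetization.funcArity_eq_some (L := L) _ _).2 ⟨f, rfl⟩
  have h₂ := (Arithmetization.funcArity_eq_some (L := L) _ _).2 ⟨g, rfl⟩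
  rw [h, h₂] at h₁
  exact (Option.some.inj h₁).symm

theorem relCode_inj {j k : ℕ} {R : L.Relations j} {Q : L.Relations k}
    (h : Arithmetization.relCode R = Arithmetization.relCode Q) : j = k := by
  have h₁ := (Arithmetization.relArity_eq_some (L := L) _ _).2 ⟨R, rfl⟩
  have h₂ := (Arithmetization.relArity_eq_some (L := L) _ _).2 ⟨Q, rfl⟩
  rw [h, h₂] at h₁
  exact (Option.some.inj h₁).symm

theorem codeTm_injective {n : ℕ} : Function.Injective (codeTm : Tm L n → ℕ) := by
  intro t
  induction t with
  | var x =>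
    rcases x with e | i
    · exact e.elim
    · intro s h
      rcases s with x | ⟨g, ss⟩
      · rcases x with e | j
        · exact e.elim
        · simp only [codeTm] at h
          have : i = j := Fin.ext (by omega)
          rw [this]
      · simp only [codeTm] at h
        omega
  | @func k f ts ih =>
    intro s h
    rcases s with x | ⟨g, ss⟩
    · rcases x with e | j
      · exact e.elim
      · simp only [codeTm] at h
        omega
    · simp only [codeTm, Nat.add_right_cancel_iff, Nat.mul_left_cancel_iff (Nat.zero_lt_two),
        Nat.pair_eq_pair, encode_inj] at h
      obtain rfl := funcCode_inj h.1
      obtain rfl := Arithmetization.funcCode_injective _ h.1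
      have h₂ := List.ofFn_injective h.2
      rw [show ts = ss from funext fun i => ih i (congrFun h₂ i)]

/-- Codes do not record the context, so this is true for fixed `n` only. For that reason the
enumerations of formulas in varying contexts carry `n` as a separate component. -/
theorem code_injective {n : ℕ} : Function.Injective (code : Fm L n → ℕ) := by
  intro φ
  induction φ with
  | falsum =>
    intro ψ h
    cases ψ <;> simp only [code] at h <;> first | rfl | omega
  | equal t s =>
    intro ψ h
    cases ψ <;> simp only [code] at h <;> try omega
    have h' := Nat.pair_eq_pair.1 (Nat.mul_left_cancel (Nat.succ_pos 3) (Nat.add_right_cancel h))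
    rw [codeTm_injective h'.1, codeTm_injective h'.2]
  | rel R ts =>
    intro ψ h
    cases ψ <;> simp only [code] at h <;> try omega
    have h' := Nat.pair_eq_pair.1 (Nat.mul_left_cancel (Nat.succ_pos 3) (Nat.add_right_cancel h))
    obtain rfl := relCode_inj h'.1
    obtain rfl := Arithmetization.relCode_injective _ h'.1
    have h₂ := List.ofFn_injective (encode_injective h'.2)
    exact congrArg _ (funext fun i => codeTm_injective (congrFun h₂ i))
  | imp φ₁ φ₂ ih₁ ih₂ =>
    intro ψ h
    cases ψ <;> simp only [code] at h <;> try omega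
    have h' := Nat.pair_eq_pair.1 (Nat.mul_left_cancel (Nat.succ_pos 3) (Nat.add_right_cancel h))
    rw [ih₁ h'.1, ih₂ h'.2]
  | all φ ih =>
    intro ψ h
    cases ψ <;> simp only [code] at h <;> try omega
    rw [ih (Nat.mul_left_cancel (Nat.succ_pos 3) (Nat.add_right_cancel h))]

instance countable_fm (n : ℕ) : Countable (Fm L n) := code_injective.countable

end WellFormed

end G1

namespace G1

open FirstOrder.Language Encodable

universe u v w

/-! ### Enumerable sets and inductive generation -/

section Enumerable

variable {α β γ : Type*} [Primcodable α] [Primcodable β] [Primcodable γ]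

/-- The set is enumerated by a computable sequence (with gaps). -/
def IsEnumerable (X : Set α) : Prop :=
  ∃ f : ℕ → Option α, Computable f ∧ ∀ a, a ∈ X ↔ ∃ p, f p = some a

theorem IsEnumerable.of_partial_range {f : β → Option α} (hf : Computable f) :
    IsEnumerable {a | ∃ b, f b = some a} := by
  refine ⟨fun p => (decode (α := β) p).bind f,
    Computable.option_bind Computable.decode (hf.comp .snd), fun a => ?_⟩
  constructor
  · rintro ⟨b, hb⟩
    exact ⟨encode b, by simpa using hb⟩
  · rintro ⟨p, hp⟩
    obtain ⟨b, -, hb⟩ := Option.bind_eq_some_iff.1 hp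
    exact ⟨b, hb⟩

theorem IsEnumerable.of_check {c : β → Bool} {f : β → α} (hc : Computable c) (hf : Computable f) :
    IsEnumerable {a | ∃ b, c b = true ∧ f b = a} := by
  have h := IsEnumerable.of_partial_range (f := fun b => if c b = true then some (f b) else none)
    (computable_ite (hc.of_eq fun b => by simp) (Computable.option_some.comp hf) (.const none))
  convert h using 4
  simp

theorem IsEnumerable.union {X Y : Set α} (hX : IsEnumerable X) (hY : IsEnumerable Y) :
    IsEnumerable (X ∪ Y) := by
  obtain ⟨f, hf, hfX⟩ := hX
  obtain ⟨g, hg, hgY⟩ := hY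
  refine ⟨fun p => if p % 2 = 0 then f (p / 2) else g (p / 2),
    computable_ite (computable_beq (computable_mod 2) (.const 0)) (hf.comp (computable_div 2))
      (hg.comp (computable_div 2)), fun a => ?_⟩
  rw [Set.mem_union, hfX, hgY]
  constructor
  · rintro (⟨p, hp⟩ | ⟨p, hp⟩)
    · exact ⟨2 * p, by simpa using hp⟩
    · refine ⟨2 * p + 1, ?_⟩
      have h₁ : (2 * p + 1) / 2 = p := by omega
      have h₂ : ¬ (2 * p + 1) % 2 = 0 := by omega
      simpa only [h₁, h₂, if_false] using hp
  · rintro ⟨p, hp⟩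
    simp only at hp
    split_ifs at hp
    · exact .inl ⟨_, hp⟩
    · exact .inr ⟨_, hp⟩

theorem IsEnumerable.prod {X : Set α} {Y : Set β} (hX : IsEnumerable X) (hY : IsEnumerable Y) :
    IsEnumerable (X ×ˢ Y) := by
  obtain ⟨f, hf, hfX⟩ := hX
  obtain ⟨g, hg, hgY⟩ := hY
  refine ⟨fun p => (f p.unpair.1).bind fun a => (g p.unpair.2).map fun b => (a, b), ?_, ?_⟩
  · refine Computable.option_bind (hf.comp (Computable.fst.comp .unpair)) ?_
    refine Computable.option_map (hg.comp (Computable.snd.comp (Computable.unpair.comp .fst))) ?_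
    exact Computable.pair (Computable.snd.comp .fst) .snd
  · rintro ⟨a, b⟩
    rw [Set.mem_prod, hfX, hgY]
    constructor
    · rintro ⟨⟨p, hp⟩, ⟨q, hq⟩⟩
      exact ⟨Nat.pair p q, by simp [hp, hq]⟩
    · rintro ⟨p, hp⟩
      simp only [Option.bind_eq_some_iff, Option.map_eq_some_iff, Prod.mk.injEq] at hp
      obtain ⟨a, ha, b, hb, rfl, rfl⟩ := hp
      exact ⟨⟨_, ha⟩, ⟨_, hb⟩⟩

theorem IsEnumerable.partial_image {X : Set α} (hX : IsEnumerable X) {g : α → Option β}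
    (hg : Computable g) : IsEnumerable {b | ∃ a ∈ X, g a = some b} := by
  obtain ⟨f, hf, hfX⟩ := hX
  refine ⟨fun p => (f p).bind g, Computable.option_bind hf (hg.comp .snd), fun b => ?_⟩
  simp only [Set.mem_ofPred_eq, hfX, Option.bind_eq_some_iff]
  exact ⟨fun ⟨a, ⟨p, hp⟩, h⟩ => ⟨p, a, hp, h⟩, fun ⟨p, a, hp, h⟩ => ⟨a, ⟨p, hp⟩, h⟩⟩

theorem IsEnumerable.preimage {X : Set ℕ} (hX : IsEnumerable X) {g : α → ℕ} (hg : Computable g) :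
    IsEnumerable (g ⁻¹' X) := by
  obtain ⟨f, hf, hfX⟩ := hX
  have h := IsEnumerable.of_check (β := ℕ × α)
    (c := fun q => decide (encode (f q.1) = encode (some (g q.2)))) (f := Prod.snd)
    (computable_beq (Computable.encode.comp (hf.comp .fst))
      (Computable.encode.comp (Computable.option_some.comp (hg.comp .snd)))) .snd
  convert h using 1
  ext a
  rw [Set.mem_preimage, hfX]
  simp only [decide_eq_true_eq, encode_inj, Set.mem_ofPred_eq]
  exact ⟨fun ⟨p, hp⟩ => ⟨(p, a), hp, rfl⟩, fun ⟨q, hq, h⟩ => ⟨q.1, h ▸ hq⟩⟩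

theorem IsEnumerable.rePred {X : Set α} (hX : IsEnumerable X) : REPred fun a => a ∈ X := by
  obtain ⟨f, hf, hfX⟩ := hX
  have h : Partrec fun a : α => Nat.rfindOpt fun p =>
      if encode (f p) = encode (some a) then some () else none :=
    Partrec.rfindOpt (computable_ite (computable_beq (Computable.encode.comp (hf.comp .snd))
      (Computable.encode.comp (Computable.option_some.comp .fst))) (.const _) (.const _))
  refine h.dom_re.of_eq fun a => ?_
  rw [Nat.rfindOpt_dom, hfX]
  simp only [encode_inj, Option.mem_def, Option.ite_none_right_eq_some, and_true]
  exact exists_congr fun p => exists_const Unit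

/-- Post's theorem. -/
theorem computablePred_of_isEnumerable {X : Set α} (hX : IsEnumerable X) (hX' : IsEnumerable Xᶜ) :
    ComputablePred fun a => a ∈ X :=
  ComputablePred.computable_iff_re_compl_re'.2 ⟨hX.rePred, hX'.rePred⟩

/-- The set generated from `B` by two partial binary operations. -/
inductive Generated (B : Set α) (r : Bool → α → α → Option α) : α → Prop
  | base {a : α} : a ∈ B → Generated B r a
  | step {a b c : α} (t : Bool) : Generated B r a → Generated B r b → r t a b = some c →
      Generated B r c

/-- The sequence enumerating a generated set. -/
def generatedSeq (f : ℕ → Option α) (r : Bool → α → α → Option α) (p : ℕ) : Option α :=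
  -- Even indices list the base. An odd index is a rule application: `p / 4` pairs two earlier
  -- indices, and the residue 1 or 3 modulo 4 selects the operation.
  if h : p % 2 = 0 then f (p / 2)
  else (generatedSeq f r (p / 4).unpair.1).bind fun a =>
    (generatedSeq f r (p / 4).unpair.2).bind fun b => r (decide (p % 4 = 1)) a b
termination_by p
decreasing_by
  all_goals
    have h₁ := Nat.unpair_left_le (p / 4)
    have h₂ := Nat.unpair_right_le (p / 4)
    omega

/-- One step of the computation of `generatedSeq`, from the list of the previous values. -/
def generatedStep (f : ℕ → Option α) (r : Bool → α → α → Option α) (H : List (Option α)) :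
    Option α :=
  if H.length % 2 = 0 then f (H.length / 2)
  else (H.getI (H.length / 4).unpair.1).bind fun a =>
    (H.getI (H.length / 4).unpair.2).bind fun b => r (decide (H.length % 4 = 1)) a b

theorem generatedStep_map {δ : Type*} (f : ℕ → Option δ) (r : Bool → δ → δ → Option δ) (p : ℕ) :
    generatedStep f r ((List.range p).map (generatedSeq f r)) = generatedSeq f r p := by
  have hH : ∀ x < p, ((List.range p).map (generatedSeq f r)).getI x = generatedSeq f r x := by
    intro x hx
    rw [List.getI_eq_getElem _ (by simpa using hx)]
    simp
  have h₁ := Nat.unpair_left_le (p / 4)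
  have h₂ := Nat.unpair_right_le (p / 4)
  rw [generatedStep, List.length_map, List.length_range, generatedSeq]
  split_ifs with h
  · rfl
  · rw [hH _ (by omega), hH _ (by omega)]

theorem computable_generatedStep {f : ℕ → Option α} {r : Bool → α → α → Option α}
    (hf : Computable f) (hr : Computable fun q : Bool × α × α => r q.1 q.2.1 q.2.2) :
    Computable (generatedStep f r) := by
  have hlen : Computable fun H : List (Option α) => H.length := Computable.list_length
  have hget : Computable₂ fun (H : List (Option α)) (x : ℕ) => H.getI x :=
    Primrec.list_getI.to_comp
  have h4 : Computable fun H : List (Option α) => (H.length / 4).unpair :=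
    Computable.unpair.comp ((computable_div 4).comp hlen)
  have hleft : Computable fun H : List (Option α) => H.getI (H.length / 4).unpair.1 :=
    hget.comp .id (Computable.fst.comp h4)
  have hright : Computable fun H : List (Option α) => H.getI (H.length / 4).unpair.2 :=
    hget.comp .id (Computable.snd.comp h4)
  have ht : Computable fun H : List (Option α) => decide (H.length % 4 = 1) :=
    computable_beq ((computable_mod 4).comp hlen) (.const 1)
  have hop : Computable₂ fun (q : List (Option α) × α) (b : α) =>
      r (decide (q.1.length % 4 = 1)) q.2 b :=
    hr.comp (Computable.pair (ht.comp (Computable.fst.comp .fst))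
      (Computable.pair (Computable.snd.comp .fst) .snd))
  have hin : Computable₂ fun (H : List (Option α)) (a : α) =>
      (H.getI (H.length / 4).unpair.2).bind fun b => r (decide (H.length % 4 = 1)) a b :=
    Computable.option_bind (hright.comp .fst) hop
  exact computable_ite (computable_beq ((computable_mod 2).comp hlen) (.const 0))
    (hf.comp ((computable_div 2).comp hlen)) (Computable.option_bind hleft hin)

theorem computable_generatedSeq {f : ℕ → Option α} {r : Bool → α → α → Option α}
    (hf : Computable f) (hr : Computable fun q : Bool × α × α => r q.1 q.2.1 q.2.2) :
    Computable (generatedSeq f r) := by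
  have hg : Computable₂ fun (_ : Unit) (H : List (Option α)) => some (generatedStep f r H) :=
    Computable.option_some.comp ((computable_generatedStep hf hr).comp .snd)
  have key : Computable₂ fun (_ : Unit) (p : ℕ) => generatedSeq f r p :=
    Computable.nat_strong_rec _ hg fun _ p => congrArg some (generatedStep_map f r p)
  exact key.comp (.const ()) .id

theorem IsEnumerable.generated {B : Set α} (hB : IsEnumerable B) {r : Bool → α → α → Option α}
    (hr : Computable fun q : Bool × α × α => r q.1 q.2.1 q.2.2) :
    IsEnumerable {a | Generated B r a} := by
  obtain ⟨f, hf, hfB⟩ := hB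
  refine ⟨generatedSeq f r, computable_generatedSeq hf hr, fun a => ⟨fun h => ?_, ?_⟩⟩
  · replace h : Generated B r a := h
    induction h with
    | base ha =>
      obtain ⟨p, hp⟩ := (hfB _).1 ha
      refine ⟨2 * p, ?_⟩
      rw [generatedSeq, dif_pos (by omega)]
      simpa using hp
    | step t ha hb hr ih₁ ih₂ =>
      obtain ⟨p, hp⟩ := ih₁
      obtain ⟨q, hq⟩ := ih₂
      refine ⟨4 * Nat.pair p q + (if t = true then 1 else 3), ?_⟩
      rw [generatedSeq, dif_neg (by split_ifs <;> omega)]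
      have h₁ : (4 * Nat.pair p q + (if t = true then 1 else 3)) / 4 = Nat.pair p q := by
        split_ifs <;> omega
      have h₂ : decide ((4 * Nat.pair p q + (if t = true then 1 else 3)) % 4 = 1) = t := by
        cases t <;> simp
      rw [h₁, h₂, Nat.unpair_pair, hp, hq]
      exact hr
  · rintro ⟨p, hp⟩
    induction p using Nat.strong_induction_on generalizing a with
    | _ p ih =>
      rw [generatedSeq] at hp
      have h₁ := Nat.unpair_left_le (p / 4)
      have h₂ := Nat.unpair_right_le (p / 4)
      split_ifs at hp with h
      · exact Generated.base ((hfB _).2 ⟨_, hp⟩)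
      · simp only [Option.bind_eq_some_iff] at hp
        obtain ⟨b, hb, c, hc, hr⟩ := hp
        exact Generated.step _ (ih _ (by omega) _ hb) (ih _ (by omega) _ hc) hr

end Enumerable

/-! ### Enumeration of the theorems of a recursive theory -/

section Theorems

variable {L : FirstOrder.Language.{u, v}} [Arithmetization L]

/-- The codes of the logical axioms and of the instances of axioms of `A`, with their contexts. -/
def axiomCodes (A : L.Theory) : Set (ℕ × ℕ) :=
  {p | ∃ φ ∈ A, code (ofSentence p.1 φ) = p.2} ∪
  ({p | ∃ φ ψ : Fm L p.1, code (φ.imp (ψ.imp φ)) = p.2} ∪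
  ({p | ∃ φ ψ χ : Fm L p.1,
    code ((φ.imp (ψ.imp χ)).imp ((φ.imp ψ).imp (φ.imp χ))) = p.2} ∪
  ({p | ∃ φ : Fm L p.1, code (φ.not.not.imp φ) = p.2} ∪
  ({p | ∃ (φ : Fm L (p.1 + 1)) (t : Tm L p.1), code (φ.all.imp (inst φ t)) = p.2} ∪
  ({p | ∃ (φ : Fm L p.1) (ψ : Fm L (p.1 + 1)),
    code (((weaken φ).imp ψ).all.imp (φ.imp ψ.all)) = p.2} ∪
  ({p | code (BoundedFormula.equal (tvar (Fin.last p.1)) (tvar (Fin.last p.1)) :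
    Fm L (p.1 + 1)).ex = p.2} ∪
  ({p | ∃ t : Tm L p.1, code (.equal t t : Fm L p.1) = p.2} ∪
  {p | ∃ (φ : Fm L (p.1 + 1)) (t s : Tm L p.1),
    code ((.equal t s : Fm L p.1).imp ((inst φ t).imp (inst φ s))) = p.2})))))))

/-- The inference rules on codes. -/
def ruleCode (t : Bool) (p q : ℕ × ℕ) : Option (ℕ × ℕ) :=
  if t = true then
    if p.1 = q.1 then
      -- For the code of an implication, `p.2 / 4` is the pair of antecedent and consequent; the
      -- test verifies that the antecedent is `q.2`.
      if p.2 = impCode q.2 (p.2 / 4).unpair.2 then some (p.1, (p.2 / 4).unpair.2) else none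
    else none
  -- Generalization ignores `q` and needs a last variable to bind.
  else if p.1 = 0 then none else some (p.1 - 1, allCode p.2)

theorem computable_ruleCode :
    Computable fun q : Bool × (ℕ × ℕ) × (ℕ × ℕ) => ruleCode q.1 q.2.1 q.2.2 := by
  have hp : Computable fun q : Bool × (ℕ × ℕ) × (ℕ × ℕ) => q.2.1 := Computable.fst.comp .snd
  have hq : Computable fun q : Bool × (ℕ × ℕ) × (ℕ × ℕ) => q.2.2 := Computable.snd.comp .snd
  have hp₁ := Computable.fst.comp hp
  have hp₂ := Computable.snd.comp hp
  have hb := Computable.snd.comp (Computable.unpair.comp ((computable_div 4).comp hp₂))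
  refine computable_ite (Computable.fst.of_eq fun q => by simp) ?_ ?_
  · refine computable_ite (computable_beq hp₁ (Computable.fst.comp hq)) ?_ (.const none)
    refine computable_ite (computable_beq hp₂
      (computable_impCode.comp (Computable.snd.comp hq) hb)) ?_ (.const none)
    exact Computable.option_some.comp (Computable.pair hp₁ hb)
  · refine computable_ite (computable_beq hp₁ (.const 0)) (.const none) ?_
    exact Computable.option_some.comp (Computable.pair (Computable.pred.comp hp₁)
      (computable_allCode.comp hp₂))

theorem ruleCode_mp (n a b : ℕ) : ruleCode true (n, impCode a b) (n, a) = some (n, b) := by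
  have h : impCode a b / 4 = Nat.pair a b := by simp only [impCode]; omega
  simp [ruleCode, h]

theorem ruleCode_gen (n a : ℕ) (q : ℕ × ℕ) :
    ruleCode false (n + 1, a) q = some (n, allCode a) := by
  simp [ruleCode]

theorem isEnumerable_checked {β : Type*} [Primcodable β] {c : ℕ × β → Bool} {f : ℕ × β → ℕ}
    (hc : Computable c) (hf : Computable f) :
    IsEnumerable {p : ℕ × ℕ | ∃ b, c (p.1, b) = true ∧ f (p.1, b) = p.2} := by
  have h := IsEnumerable.of_check hc (Computable.pair Computable.fst hf)
  convert h using 1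
  ext ⟨n, a⟩
  simp only [Set.mem_ofPred_eq, Prod.exists, Prod.mk.injEq]
  exact ⟨fun ⟨b, h₁, h₂⟩ => ⟨n, b, h₁, rfl, h₂⟩, fun ⟨m, b, h₁, h₂, h₃⟩ => ⟨b, h₂ ▸ ⟨h₁, h₃⟩⟩⟩

/-- In every logical scheme the parameters range over a decidable set of codes, and the instance is
computed from them. For the axioms in `A`, recursiveness of `A` is the check. -/
theorem isEnumerable_axiomCodes {A : L.Theory} (hA : RecursiveSet A) :
    IsEnumerable (axiomCodes A) := by
  have hn {β : Type} [Primcodable β] : Computable fun q : ℕ × β => q.1 := .fst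
  have hs {β : Type} [Primcodable β] : Computable fun q : ℕ × β => q.1 + 1 :=
    Computable.succ.comp .fst
  have ha₂ : Computable fun q : ℕ × ℕ × ℕ => q.2.1 := Computable.fst.comp .snd
  have hb₂ : Computable fun q : ℕ × ℕ × ℕ => q.2.2 := Computable.snd.comp .snd
  have ha₃ : Computable fun q : ℕ × ℕ × ℕ × ℕ => q.2.1 := Computable.fst.comp .snd
  have hb₃ : Computable fun q : ℕ × ℕ × ℕ × ℕ => q.2.2.1 :=
    Computable.fst.comp (Computable.snd.comp .snd)
  have hc₃ : Computable fun q : ℕ × ℕ × ℕ × ℕ => q.2.2.2 :=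
    Computable.snd.comp (Computable.snd.comp .snd)
  have hfm := computable_isFmCode L
  have htm := computable_isTmCode L
  have himp := computable_impCode
  have hand := Primrec.and.to_comp
  refine .union ?_ (.union ?_ (.union ?_ (.union ?_ (.union ?_ (.union ?_ (.union ?_
    (.union ?_ ?_)))))))
  · obtain ⟨_, hA⟩ := hA
    convert isEnumerable_checked (hA.comp (.snd : Computable (Prod.snd : ℕ × ℕ → ℕ)))
      (computable_renameCode.comp (Computable.pair .fst (Computable.pair (.const []) .snd))) using 1
    ext ⟨n, d⟩
    simp only [Set.mem_ofPred_eq, decide_eq_true_eq, code_ofSentence]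
    exact ⟨fun ⟨φ, h, h'⟩ => ⟨_, ⟨φ, h, rfl⟩, h'⟩, fun ⟨_, ⟨φ, h, rfl⟩, h'⟩ => ⟨φ, h, h'⟩⟩
  · convert isEnumerable_checked (hand.comp (hfm.comp hn ha₂) (hfm.comp hn hb₂))
      (himp.comp ha₂ (himp.comp hb₂ ha₂)) using 1
    ext ⟨n, d⟩
    simp only [Set.mem_ofPred_eq, Bool.and_eq_true, isFmCode_iff]
    constructor
    · rintro ⟨φ, ψ, h⟩
      exact ⟨(code φ, code ψ), ⟨⟨φ, rfl⟩, ⟨ψ, rfl⟩⟩, h⟩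
    · rintro ⟨⟨_, _⟩, ⟨⟨φ, rfl⟩, ⟨ψ, rfl⟩⟩, h⟩
      exact ⟨φ, ψ, h⟩
  · convert isEnumerable_checked
      (hand.comp (hfm.comp hn ha₃) (hand.comp (hfm.comp hn hb₃) (hfm.comp hn hc₃)))
      (himp.comp (himp.comp ha₃ (himp.comp hb₃ hc₃))
        (himp.comp (himp.comp ha₃ hb₃) (himp.comp ha₃ hc₃))) using 1
    ext ⟨n, d⟩
    simp only [Set.mem_ofPred_eq, Bool.and_eq_true, isFmCode_iff]
    constructor
    · rintro ⟨φ, ψ, χ, h⟩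
      exact ⟨(code φ, code ψ, code χ), ⟨⟨φ, rfl⟩, ⟨ψ, rfl⟩, ⟨χ, rfl⟩⟩, h⟩
    · rintro ⟨⟨_, _, _⟩, ⟨⟨φ, rfl⟩, ⟨ψ, rfl⟩, ⟨χ, rfl⟩⟩, h⟩
      exact ⟨φ, ψ, χ, h⟩
  · convert isEnumerable_checked (β := ℕ) (hfm.comp hn .snd)
      (himp.comp (himp.comp (himp.comp .snd (.const 0)) (.const 0)) .snd) using 1
    ext ⟨n, d⟩
    simp only [Set.mem_ofPred_eq, isFmCode_iff]
    constructor
    · rintro ⟨φ, h⟩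
      exact ⟨code φ, ⟨φ, rfl⟩, h⟩
    · rintro ⟨_, ⟨φ, rfl⟩, h⟩
      exact ⟨φ, h⟩
  · convert isEnumerable_checked (hand.comp (hfm.comp hs ha₂) (htm.comp hn hb₂))
      (himp.comp (computable_allCode.comp ha₂)
        (computable_instCode.comp (Computable.pair hn (Computable.pair hb₂ ha₂)))) using 1
    ext ⟨n, d⟩
    simp only [Set.mem_ofPred_eq, Bool.and_eq_true, isFmCode_iff, isTmCode_iff, code_imp, code_all,
      code_inst]
    constructor
    · rintro ⟨φ, t, h⟩
      exact ⟨(code φ, codeTm t), ⟨⟨φ, rfl⟩, ⟨t, rfl⟩⟩, h⟩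
    · rintro ⟨⟨_, _⟩, ⟨⟨φ, rfl⟩, ⟨t, rfl⟩⟩, h⟩
      exact ⟨φ, t, h⟩
  · convert isEnumerable_checked (hand.comp (hfm.comp hn ha₂) (hfm.comp hs hb₂))
      (himp.comp (computable_allCode.comp (himp.comp (computable_renameCode.comp (Computable.pair
          hs (Computable.pair (Primrec.list_range.to_comp.comp hn) ha₂))) hb₂))
        (himp.comp ha₂ (computable_allCode.comp hb₂))) using 1
    ext ⟨n, d⟩
    simp only [Set.mem_ofPred_eq, Bool.and_eq_true, isFmCode_iff, code_imp, code_all,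
      code_weaken]
    constructor
    · rintro ⟨φ, ψ, h⟩
      exact ⟨(code φ, code ψ), ⟨⟨φ, rfl⟩, ⟨ψ, rfl⟩⟩, h⟩
    · rintro ⟨⟨_, _⟩, ⟨⟨φ, rfl⟩, ⟨ψ, rfl⟩⟩, h⟩
      exact ⟨φ, ψ, h⟩
  · have h2n : Computable fun q : ℕ × Unit => 2 * q.1 :=
      (Primrec.nat_mul.comp (Primrec.const 2) Primrec.fst).to_comp
    convert isEnumerable_checked (β := Unit) (.const true)
      (himp.comp (computable_allCode.comp (himp.comp (computable_equalCode.comp h2n h2n)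
        (.const 0))) (.const 0)) using 1
    ext ⟨n, d⟩
    simp only [Set.mem_ofPred_eq, true_and, exists_const]
    exact Iff.rfl
  · convert isEnumerable_checked (β := ℕ) (htm.comp hn .snd)
      (computable_equalCode.comp .snd .snd) using 1
    ext ⟨n, d⟩
    simp only [Set.mem_ofPred_eq, isTmCode_iff]
    constructor
    · rintro ⟨t, h⟩
      exact ⟨codeTm t, ⟨t, rfl⟩, h⟩
    · rintro ⟨_, ⟨t, rfl⟩, h⟩
      exact ⟨t, h⟩
  · convert isEnumerable_checked
      (hand.comp (hfm.comp hs ha₃) (hand.comp (htm.comp hn hb₃) (htm.comp hn hc₃)))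
      (himp.comp (computable_equalCode.comp hb₃ hc₃) (himp.comp
        (computable_instCode.comp (Computable.pair hn (Computable.pair hb₃ ha₃)))
        (computable_instCode.comp (Computable.pair hn (Computable.pair hc₃ ha₃))))) using 1
    ext ⟨n, d⟩
    simp only [Set.mem_ofPred_eq, Bool.and_eq_true, isFmCode_iff, isTmCode_iff, code_imp,
      code_equal, code_inst]
    constructor
    · rintro ⟨φ, t, s, h⟩
      exact ⟨(code φ, codeTm t, codeTm s), ⟨⟨φ, rfl⟩, ⟨t, rfl⟩, ⟨s, rfl⟩⟩, h⟩
    · rintro ⟨⟨_, _, _⟩, ⟨⟨φ, rfl⟩, ⟨t, rfl⟩, ⟨s, rfl⟩⟩, h⟩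
      exact ⟨φ, t, s, h⟩

theorem exists_provable_of_mem_axiomCodes {A : L.Theory} {p : ℕ × ℕ} (h : p ∈ axiomCodes A) :
    ∃ φ : Fm L p.1, Provable A φ ∧ code φ = p.2 := by
  rcases h with ⟨φ, h, h'⟩ | ⟨φ, ψ, h⟩ | ⟨φ, ψ, χ, h⟩ | ⟨φ, h⟩ | ⟨φ, t, h⟩ | ⟨φ, ψ, h⟩ | h |
    ⟨t, h⟩ | ⟨φ, t, s, h⟩
  · exact ⟨_, .ax _ h, h'⟩
  · exact ⟨_, .imp_intro φ ψ, h⟩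
  · exact ⟨_, .imp_distrib φ ψ χ, h⟩
  · exact ⟨_, .not_not_elim φ, h⟩
  · exact ⟨_, .all_elim φ t, h⟩
  · exact ⟨_, .all_distrib φ ψ, h⟩
  · exact ⟨_, .exists_self _, h⟩
  · exact ⟨_, .eq_refl t, h⟩
  · exact ⟨_, .eq_subst φ t s, h⟩

theorem generated_iff_provable {A : L.Theory} {p : ℕ × ℕ} :
    Generated (axiomCodes A) ruleCode p ↔ ∃ φ : Fm L p.1, Provable A φ ∧ code φ = p.2 := by
  constructor
  · intro h
    induction h with
    | base h => exact exists_provable_of_mem_axiomCodes h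
    | @step p q s t _ _ hr ih₁ ih₂ =>
      obtain ⟨n, c⟩ := p
      obtain ⟨m, d⟩ := q
      obtain ⟨φ, hφ, h₁⟩ := ih₁
      obtain ⟨ψ, hψ, h₂⟩ := ih₂
      simp only at φ ψ hφ hψ h₁ h₂
      cases t with
      | true =>
        simp only [ruleCode, if_true] at hr
        split_ifs at hr with h₃ h₄
        subst h₃
        obtain rfl := Option.some.inj hr
        rw [h₄] at h₁
        -- A formula whose code has the residue of an implication is an implication, so the
        -- extracted number really codes a formula in the same context.
        have h₆ : ∃ χ : Fm L n, code χ = (c / 4).unpair.2 := by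
          cases φ <;> simp only [code, impCode] at h₁ <;> try omega
          exact ⟨_, (Nat.pair_eq_pair.1 (Nat.mul_left_cancel (Nat.succ_pos 3)
            (Nat.add_right_cancel h₁))).2⟩
        obtain ⟨χ, hχ⟩ := h₆
        refine ⟨χ, .mp (φ := ψ) ?_ hψ, hχ⟩
        rwa [← code_injective (h₁.trans (by rw [code_imp, h₂, hχ]) : code φ = code (ψ.imp χ))]
      | false =>
        simp only [ruleCode, Bool.false_eq_true, if_false] at hr
        split_ifs at hr with h₃
        obtain ⟨k, rfl⟩ := Nat.exists_eq_succ_of_ne_zero h₃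
        obtain rfl := Option.some.inj hr
        exact ⟨.all φ, .gen hφ, by rw [code_all, h₁]⟩
  · rintro ⟨φ, hφ, h⟩
    suffices key : ∀ {n : ℕ} {φ : Fm L n}, Provable A φ →
        Generated (axiomCodes A) ruleCode (n, code φ) by
      have := key hφ
      rwa [h] at this
    clear φ hφ h
    intro n φ hφ
    induction hφ with
    | ax n h => exact .base (.inl ⟨_, h, rfl⟩)
    | imp_intro φ ψ => exact .base (.inr (.inl ⟨_, _, rfl⟩))
    | imp_distrib φ ψ χ => exact .base (.inr (.inr (.inl ⟨_, _, _, rfl⟩)))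
    | not_not_elim φ => exact .base (.inr (.inr (.inr (.inl ⟨_, rfl⟩))))
    | all_elim φ t => exact .base (.inr (.inr (.inr (.inr (.inl ⟨_, _, rfl⟩)))))
    | all_distrib φ ψ => exact .base (.inr (.inr (.inr (.inr (.inr (.inl ⟨_, _, rfl⟩))))))
    | exists_self n => exact .base (.inr (.inr (.inr (.inr (.inr (.inr (.inl rfl)))))))
    | eq_refl t => exact .base (.inr (.inr (.inr (.inr (.inr (.inr (.inr (.inl ⟨_, rfl⟩))))))))
    | eq_subst φ t s =>
      exact .base (.inr (.inr (.inr (.inr (.inr (.inr (.inr (.inr ⟨_, _, _, rfl⟩))))))))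
    | mp _ _ ih₁ ih₂ => exact .step true ih₁ ih₂ (ruleCode_mp _ _ _)
    -- The rule has two arguments but ignores the second, so the premise is supplied twice.
    | gen _ ih => exact .step false ih ih (ruleCode_gen _ _ _)

/-- The theorems of a recursive set of axioms can be enumerated. -/
theorem isEnumerable_theorems {A : L.Theory} (hA : RecursiveSet A) :
    IsEnumerable {c : ℕ | ∃ φ : L.Sentence, Proves A φ ∧ code (n := 0) φ = c} := by
  have h := ((isEnumerable_axiomCodes hA).generated computable_ruleCode).partial_image
    (g := fun p : ℕ × ℕ => if p.1 = 0 then some p.2 else none)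
    (computable_ite (computable_beq .fst (.const 0)) (Computable.option_some.comp .snd)
      (.const none))
  convert h using 1
  ext c
  simp only [Set.mem_ofPred_eq, generated_iff_provable]
  constructor
  · rintro ⟨φ, hφ, rfl⟩
    exact ⟨(0, code (n := 0) φ), ⟨φ, hφ, rfl⟩, by simp⟩
  · rintro ⟨⟨n, d⟩, ⟨φ, hφ, h⟩, h'⟩
    split_ifs at h' with h₀
    simp only at h₀ h φ hφ h'
    subst h₀
    obtain rfl := Option.some.inj h'
    exact ⟨φ, hφ, h⟩

/-- A set of sentences which contains exactly one of `φ` and `¬ φ` is recursive if it can be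
enumerated. -/
theorem recursiveSet_of_isEnumerable {X : Set L.Sentence}
    (hX : IsEnumerable {c : ℕ | ∃ φ ∈ X, code (n := 0) φ = c})
    (hneg : ∀ φ : L.Sentence, φ.not ∈ X ↔ φ ∉ X) : RecursiveSet X := by
  refine computablePred_of_isEnumerable (X := {c : ℕ | ∃ φ ∈ X, code (n := 0) φ = c}) hX ?_
  -- A number lies outside the set of codes iff it codes no sentence or it codes a sentence whose
  -- negation is in `X`.
  have h₁ : IsEnumerable {c : ℕ | ∃ b : ℕ, (!isFmCode L 0 b) = true ∧ b = c} :=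
    .of_check (Primrec.not.to_comp.comp ((computable_isFmCode L).comp (.const 0) .id)) .id
  have h₂ := hX.preimage (computable_impCode.comp .id (.const 0))
  convert h₁.union h₂ using 1
  ext c
  simp only [Set.mem_compl_iff, Set.mem_ofPred_eq, Set.mem_union, Set.mem_preimage,
    exists_eq_right, Bool.not_eq_true', ← Bool.not_eq_true, isFmCode_iff]
  by_cases hc : ∃ φ : Fm L 0, code φ = c
  · obtain ⟨φ, rfl⟩ := hc
    have h₃ : (∃ ψ ∈ X, code (n := 0) ψ = code φ) ↔ φ ∈ X :=
      ⟨fun ⟨ψ, hψ, h⟩ => code_injective h ▸ hψ, fun h => ⟨φ, h, rfl⟩⟩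
    have h₄ : (∃ ψ ∈ X, code (n := 0) ψ = impCode (id (code φ)) 0) ↔ φ.not ∈ X :=
      ⟨fun ⟨ψ, hψ, h⟩ => (code_injective h : ψ = φ.not) ▸ hψ, fun h => ⟨_, h, rfl⟩⟩
    rw [h₃, h₄]
    have h₅ := hneg φ
    have h₆ : ∃ ψ : Fm L 0, code ψ = code φ := ⟨φ, rfl⟩
    tauto
  · have h₃ : ¬ ∃ φ ∈ X, code (n := 0) φ = c := fun ⟨φ, _, h⟩ => hc ⟨φ, h⟩
    tauto

end Theorems

end G1

namespace G1

open FirstOrder.Language Encodable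

universe u v w

/-! ### Effectiveness of the identity translation -/

section IdentityRecursive

variable {L : FirstOrder.Language.{u, v}} [Arithmetization L]

theorem computable_double : Computable fun i : ℕ => 2 * i :=
  (Primrec.nat_mul.comp (Primrec.const 2) Primrec.id).to_comp

theorem computable_map_double : Computable fun l : List ℕ => l.map fun i => 2 * i :=
  (Primrec.list_map (g := fun _ i => 2 * i) Primrec.id
    (Primrec.nat_mul.comp (Primrec.const 2) Primrec.snd)).to_comp

theorem code_rel_tvar {n k : ℕ} (R : L.Relations k) (σ : Fin k → Fin n) :
    code (.rel R fun l => tvar (σ l)) = relAppCode (Arithmetization.relCode R)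
      ((List.ofFn fun l => (σ l : ℕ)).map fun i => 2 * i) := by
  rw [List.map_ofFn]
  rfl

theorem code_func_tvar {n k : ℕ} (f : L.Functions k) (σ : Fin k → Fin n) (j : Fin n) :
    code (.equal (.func f fun l => tvar (σ l)) (tvar j)) =
      equalCode (funcAppCode (Arithmetization.funcCode f)
        ((List.ofFn fun l => (σ l : ℕ)).map fun i => 2 * i)) (2 * (j : ℕ)) := by
  rw [List.map_ofFn]
  rfl

theorem ofFn_val (k : ℕ) : (List.ofFn fun i : Fin k => (i : ℕ)) = List.range k := by
  apply List.ext_getElem <;> simp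

/-- The arity, computed from the code of a symbol, gives the list of variables. The default arity 0
is used only for numbers that code no symbol. -/
theorem identity_isRecursive : (Translation.identity L).IsRecursive := by
  constructor
  · refine ⟨fun c => relAppCode c
      ((List.range ((Arithmetization.relArity L c).getD 0)).map fun i => 2 * i), ?_, fun k R => ?_⟩
    · exact computable_relAppCode.comp .id (computable_map_double.comp
        (Primrec.list_range.to_comp.comp
          (Computable.option_getD Arithmetization.relArity_computable (.const 0))))
    · have h := code_rel_tvar R (id : Fin k → Fin k)
      rw [show (Translation.identity L).rel R = .rel R fun l => tvar (id l) from rfl, h]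
      simp only [(Arithmetization.relArity_eq_some _ _).2 ⟨R, rfl⟩, Option.getD_some, ← ofFn_val]
      rfl
  · have hk : Computable fun c => (Arithmetization.funcArity L c).getD 0 :=
      Computable.option_getD Arithmetization.funcArity_computable (.const 0)
    refine ⟨fun c => equalCode (funcAppCode c
      ((List.range ((Arithmetization.funcArity L c).getD 0)).map fun i => 2 * i))
      (2 * (Arithmetization.funcArity L c).getD 0), ?_, fun k f => ?_⟩
    · exact computable_equalCode.comp (computable_funcAppCode.comp .id
        (computable_map_double.comp (Primrec.list_range.to_comp.comp hk)))
        (computable_double.comp hk)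
    · have h := code_func_tvar f (Fin.castSucc : Fin k → Fin (k + 1)) (Fin.last k)
      rw [show (Translation.identity L).func f =
        .equal (.func f fun l => tvar l.castSucc) (tvar (Fin.last k)) from rfl, h]
      simp only [(Arithmetization.funcArity_eq_some _ _).2 ⟨f, rfl⟩, Option.getD_some, ← ofFn_val]
      rfl

theorem interpretable_of_extends {T S : L.Theory} (h : Extends S T) : Interpretable T S :=
  ⟨Translation.identity L, identity_isRecursive, Translation.identity_isInterpretation h⟩

end IdentityRecursive

/-! ### Recursive complete extensions of decidable theories -/

section Lindenbaum

variable {L : FirstOrder.Language.{u, v}} [Arithmetization L] (S : L.Theory)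

open Classical in
/-- The conjunction of the sentences with code less than `c` which are added to `S` in the
construction of a complete extension. -/
noncomputable def lindenbaumSeq : ℕ → L.Sentence
  | 0 => ⊤
  | c + 1 =>
    if h : ∃ φ : L.Sentence, code (n := 0) φ = c ∧ ¬ Proves S ((lindenbaumSeq c).imp φ.not) then
      lindenbaumSeq c ⊓ h.choose
    else lindenbaumSeq c

/-- The complete extension of `S` in which sentences are decided in the order of their codes. -/
def lindenbaumExtension : L.Theory :=
  {φ | ¬ Proves S ((lindenbaumSeq S (code (n := 0) φ)).imp φ.not)}

variable {S}

/-- By injectivity of the coding, the sentence chosen at this stage can only be `φ`. -/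
theorem lindenbaumSeq_of_mem {φ : L.Sentence} (h : φ ∈ lindenbaumExtension S) :
    lindenbaumSeq S (code (n := 0) φ + 1) = lindenbaumSeq S (code (n := 0) φ) ⊓ φ := by
  have hex : ∃ ψ : L.Sentence, code (n := 0) ψ = code (n := 0) φ ∧
      ¬ Proves S ((lindenbaumSeq S (code (n := 0) φ)).imp ψ.not) := ⟨φ, rfl, h⟩
  rw [lindenbaumSeq, dif_pos hex, code_injective hex.choose_spec.1]

theorem lindenbaumSeq_succ_cases (c : ℕ) :
    (∃ φ ∈ lindenbaumExtension S, code (n := 0) φ = c) ∨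
      lindenbaumSeq S (c + 1) = lindenbaumSeq S c := by
  by_cases h : ∃ φ : L.Sentence, code (n := 0) φ = c ∧
      ¬ Proves S ((lindenbaumSeq S c).imp φ.not)
  · obtain ⟨φ, rfl, hφ⟩ := h
    exact .inl ⟨φ, hφ, rfl⟩
  · rw [lindenbaumSeq, dif_neg h]
    exact .inr rfl

theorem lindenbaumSeq_mono {i j : ℕ} (h : i ≤ j) :
    Proves S ((lindenbaumSeq S j).imp (lindenbaumSeq S i)) := by
  induction j, h using Nat.le_induction with
  | base => exact Provable.imp_self _
  | succ j _ ih =>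
    rcases lindenbaumSeq_succ_cases (S := S) j with ⟨φ, hφ, rfl⟩ | h
    · rw [lindenbaumSeq_of_mem hφ]
      exact Provable.imp_trans (.and_left _ _) ih
    · rwa [h]

theorem lindenbaumSeq_consistent (hS : Consistent S) (c : ℕ) :
    ¬ Proves S ((lindenbaumSeq S c).imp ⊥) := by
  induction c with
  | zero => exact fun h => hS (Provable.mp h (.imp_self _))
  | succ c ih =>
    rcases lindenbaumSeq_succ_cases (S := S) c with ⟨φ, hφ, rfl⟩ | h
    · rw [lindenbaumSeq_of_mem hφ]
      exact fun h => hφ (Provable.curry h)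
    · rwa [h]

/-- Each new axiom follows over `S` from a member of the increasing chain, so a contradiction would
already be derived in `S` from a single member, all of which are consistent with `S`. -/
theorem consistent_lindenbaumExtension (hS : Consistent S) :
    Consistent (lindenbaumExtension S) := by
  intro h
  obtain ⟨i, hi⟩ := Provable.directed_deduction (T := S) (lindenbaumSeq S)
    (fun i j => lindenbaumSeq_mono) (fun φ hφ => ⟨code (n := 0) φ + 1, by
      rw [lindenbaumSeq_of_mem hφ]
      exact Provable.and_right _ _⟩) h
  rw [ofSentence_zero] at hi
  exact lindenbaumSeq_consistent hS i hi

/-- A theorem of `S` is never refuted by a member of the chain, so it is added when its code comes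
up. -/
theorem extends_lindenbaumExtension (hS : Consistent S) : Extends (lindenbaumExtension S) S :=
  fun _ hφ => Proves.of_mem fun h =>
    lindenbaumSeq_consistent hS _ (Provable.imp_mp h (Provable.imp_const hφ _))

theorem not_incomplete_lindenbaumExtension (hS : Consistent S) :
    ¬ Incomplete (lindenbaumExtension S) := by
  rintro ⟨φ, h₁, h₂⟩
  have h₁' : φ ∉ lindenbaumExtension S := fun h => h₁ (Proves.of_mem h)
  have h₂' : φ.not ∉ lindenbaumExtension S := fun h => h₂ (Proves.of_mem h)
  simp only [lindenbaumExtension, Set.mem_ofPred_eq, not_not] at h₁' h₂'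
  -- If both `φ` and `¬φ` were rejected, the chain at a stage beyond both codes would imply `¬φ` and
  -- `¬¬φ`.
  let k := max (code (n := 0) φ) (code (n := 0) φ.not)
  refine lindenbaumSeq_consistent hS k (Provable.imp_mp (φ := φ.not) ?_ ?_)
  · exact Provable.imp_trans (lindenbaumSeq_mono (le_max_right _ _)) h₂'
  · exact Provable.imp_trans (lindenbaumSeq_mono (le_max_left _ _)) h₁'

theorem recursiveSet_lindenbaumExtension (hS : DecidableTheory S) :
    RecursiveSet (lindenbaumExtension S) := by
  obtain ⟨_, hS⟩ := hS
  let dec : ℕ → Bool := fun c => decide (∃ φ ∈ {φ : L.Sentence | Proves S φ}, code (n := 0) φ = c)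
  have hdec : Computable dec := hS
  have hdec_code : ∀ φ : L.Sentence, dec (code (n := 0) φ) = true ↔ Proves S φ := by
    intro φ
    simp only [dec, decide_eq_true_eq]
    exact ⟨fun ⟨ψ, hψ, h⟩ => code_injective h ▸ hψ, fun h => ⟨φ, h, rfl⟩⟩
  -- With `d` the code of the current conjunction, `c` is accepted iff it codes a sentence whose
  -- negation does not follow from that conjunction in `S`.
  let test : ℕ → ℕ → Bool := fun c d => isFmCode L 0 c && !dec (impCode d (impCode c 0))
  let step : ℕ → ℕ → ℕ := fun c d =>
    -- This is the code of the conjunction, which unfolds to `¬(d → ¬c)`; 0 is the code of falsum.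
    if test c d = true then impCode (impCode d (impCode c 0)) 0 else d
  have himp := computable_impCode
  have htest : Computable₂ test := by
    refine Primrec.and.to_comp.comp ((computable_isFmCode L).comp (.const 0) .fst)
      (Primrec.not.to_comp.comp (hdec.comp (himp.comp .snd (himp.comp .fst (.const 0)))))
  have hstep : Computable₂ step :=
    computable_ite (htest.of_eq fun _ => by simp)
      (himp.comp (himp.comp .snd (himp.comp .fst (.const 0))) (.const 0)) .snd
  -- `impCode 0 0` is the code of `⊤`, that is, `⊥ → ⊥`.
  let seq : ℕ → ℕ := fun c => Nat.rec (impCode 0 0) (fun c d => step c d) c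
  have hseq : Computable seq := by
    refine Computable.nat_rec (f := fun c : ℕ => c) (g := fun _ => impCode 0 0)
      (h := fun _ p => step p.1 p.2) .id (.const _) ?_
    exact hstep.comp (Computable.fst.comp .snd) (Computable.snd.comp .snd)
  have htest_iff : ∀ c (θ : L.Sentence), test c (code (n := 0) θ) = true ↔
      ∃ φ : L.Sentence, code (n := 0) φ = c ∧ ¬ Proves S (θ.imp φ.not) := by
    intro c θ
    simp only [test, Bool.and_eq_true, isFmCode_iff, Bool.not_eq_true', ← Bool.not_eq_true]
    constructor
    · rintro ⟨⟨φ, rfl⟩, h⟩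
      exact ⟨φ, rfl, fun h' => h ((hdec_code _).2 h')⟩
    · rintro ⟨φ, rfl, h⟩
      exact ⟨⟨φ, rfl⟩, fun h' => h ((hdec_code (θ.imp φ.not)).1 h')⟩
  have hcode : ∀ c, seq c = code (n := 0) (lindenbaumSeq S c) := by
    intro c
    induction c with
    | zero => rfl
    | succ c ih =>
      change step c (seq c) = _
      rw [ih]
      by_cases h : ∃ φ : L.Sentence, code (n := 0) φ = c ∧
          ¬ Proves S ((lindenbaumSeq S c).imp φ.not)
      · rw [show step c _ = _ from if_pos ((htest_iff c _).2 h)]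
        obtain ⟨φ, rfl, hφ⟩ := h
        rw [lindenbaumSeq_of_mem hφ]
        rfl
      · rw [show step c _ = _ from if_neg fun h' => h ((htest_iff c _).1 h'), lindenbaumSeq,
          dif_neg h]
  classical
  refine ⟨inferInstance, ((htest.comp .id hseq).of_eq fun c => ?_)⟩
  rw [Bool.eq_iff_iff, decide_eq_true_iff, hcode, htest_iff]
  constructor
  · rintro ⟨φ, rfl, h⟩
    exact ⟨φ, h, rfl⟩
  · rintro ⟨φ, h, rfl⟩
    exact ⟨φ, rfl, h⟩

theorem EssentiallyIncomplete.essentiallyUndecidable {T : L.Theory}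
    (h : EssentiallyIncomplete T) : EssentiallyUndecidable T := by
  intro S _ hS hST hdec
  exact not_incomplete_lindenbaumExtension hS (h _
    ⟨_, recursiveSet_lindenbaumExtension hdec, fun _ => Iff.rfl⟩
    (consistent_lindenbaumExtension hS)
    fun φ hφ => extends_lindenbaumExtension hS φ (hST φ hφ))

end Lindenbaum

/-! ### Enumeration of unnested formulas with their translations -/

section UnnestedCodes

theorem code_domAt {L L' : FirstOrder.Language.{u, v}} [Arithmetization L'] (I : Translation L L')
    {n : ℕ} (i : Fin n) : code (I.domAt i) =
      renameCode n [(i : ℕ)] (code I.dom) := by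
  rw [Translation.domAt, code_rename]
  rfl

variable {L L' : FirstOrder.Language.{u, v}} [Arithmetization L] [Arithmetization L']

/-- Whether all members of the list are less than `n`. -/
def allLt (n : ℕ) (l : List ℕ) : Bool := l.foldr (fun x b => decide (x < n) && b) true

theorem allLt_iff {n : ℕ} {l : List ℕ} : allLt n l = true ↔ ∀ x ∈ l, x < n := by
  induction l with
  | nil => simp [allLt]
  | cons x l ih =>
    rw [List.forall_mem_cons, ← ih]
    simp [allLt]

theorem computable_allLt : Computable₂ allLt := by
  refine (Primrec.list_foldr (f := fun p : ℕ × List ℕ => p.2) (g := fun _ => true)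
    (h := fun p q => decide (q.1 < p.1) && q.2) Primrec.snd (Primrec.const true) ?_).to_comp
  exact Primrec.and.comp ((PrimrecRel.decide Primrec.nat_lt).comp
    (Primrec.fst.comp Primrec.snd) (Primrec.fst.comp Primrec.fst))
    (Primrec.snd.comp Primrec.snd)

theorem exists_fin_tuple {n : ℕ} {l : List ℕ} (h : ∀ x ∈ l, x < n) :
    ∃ σ : Fin l.length → Fin n, (List.ofFn fun i => (σ i : ℕ)) = l :=
  exists_tuple_of_list l Fin.val fun x hx => ⟨⟨x, h x hx⟩, rfl⟩

variable (I : Translation L L')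

/-- The codes of translated unnested atomic formulas, with their contexts. -/
def unnestedAtomCodes : Set (ℕ × ℕ × ℕ) :=
  {p | (0, 0) = p.2} ∪
  ({p | ∃ i j : Fin p.1, (code (.equal (tvar i) (tvar j) : Fm L p.1),
    code (substFm (fun l => tvar (![i, j] l)) I.eq : Fm L' p.1)) = p.2} ∪
  ({p | ∃ (k : ℕ) (R : L.Relations k) (σ : Fin k → Fin p.1),
    (code (.rel R fun l => tvar (σ l)), code (substFm (fun l => tvar (σ l)) (I.rel R))) = p.2} ∪
  {p | ∃ (k : ℕ) (f : L.Functions k) (σ : Fin k → Fin p.1) (j : Fin p.1),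
    (code (.equal (.func f fun l => tvar (σ l)) (tvar j)),
      code (.all ((I.domAt (Fin.last p.1)).imp (BoundedFormula.imp
          (substFm (fun l => tvar ((Fin.snoc (fun l => (σ l).castSucc) (Fin.last p.1) :
            Fin (k + 1) → Fin (p.1 + 1)) l)) (I.func f))
          (substFm (fun l => tvar (![Fin.last p.1, j.castSucc] l)) I.eq))))) = p.2}))

theorem code_substFm_pair {n : ℕ} (i j : Fin n) (φ : Fm L' 2) :
    code (substFm (fun l => tvar (![i, j] l)) φ) =
      renameCode n [(i : ℕ), (j : ℕ)] (code φ) := by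
  rw [code_rename]
  rfl

theorem ofFn_snoc_castSucc_last {n k : ℕ} (σ : Fin k → Fin n) :
    (List.ofFn fun l => (((Fin.snoc (fun l => (σ l).castSucc) (Fin.last n) :
      Fin (k + 1) → Fin (n + 1)) l : Fin (n + 1)) : ℕ)) =
      (List.ofFn fun l => (σ l : ℕ)) ++ [n] := by
  rw [List.ofFn_succ']
  simp

/-- This is where effectiveness of the translation enters: `g` and `h` compute the formula assigned
to a symbol. Symbols are searched for through their codes, arguments as lists of variable indices of
the right length and below `n`. -/
theorem isEnumerable_unnestedAtomCodes (hI : I.IsRecursive) :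
    IsEnumerable (unnestedAtomCodes I) := by
  obtain ⟨⟨g, hg, hgR⟩, ⟨h, hh, hhf⟩⟩ := hI
  have hlt := (PrimrecRel.decide Primrec.nat_lt).to_comp
  have hand := Primrec.and.to_comp
  have hren := computable_renameCode
  refine .union ?_ (.union ?_ (.union ?_ ?_))
  · convert IsEnumerable.of_check (α := ℕ × ℕ × ℕ) (β := ℕ) (.const true)
      (Computable.pair .id (.const (0, 0))) using 1
    ext ⟨n, a, b⟩
    simp
  · have hi : Computable fun q : ℕ × ℕ × ℕ => q.2.1 := Computable.fst.comp .snd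
    have hj : Computable fun q : ℕ × ℕ × ℕ => q.2.2 := Computable.snd.comp .snd
    convert IsEnumerable.of_check (α := ℕ × ℕ × ℕ) (β := ℕ × ℕ × ℕ)
      (hand.comp (hlt.comp hi .fst) (hlt.comp hj .fst))
      (Computable.pair .fst (Computable.pair
        (computable_equalCode.comp (computable_double.comp hi) (computable_double.comp hj))
        (hren.comp (Computable.pair .fst (Computable.pair (Computable.list_cons.comp hi
          (Computable.list_cons.comp hj (.const []))) (.const (code I.eq))))))) using 1
    ext ⟨n, d⟩
    simp only [Set.mem_ofPred_eq, Bool.and_eq_true, decide_eq_true_eq, code_substFm_pair,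
      code_equal, codeTm_tvar, Prod.mk.injEq]
    constructor
    · rintro ⟨i, j, h⟩
      exact ⟨(n, i, j), ⟨i.2, j.2⟩, rfl, h⟩
    · rintro ⟨⟨m, i, j⟩, ⟨hi, hj⟩, rfl, h⟩
      exact ⟨⟨i, hi⟩, ⟨j, hj⟩, h⟩
  · have hc : Computable fun q : ℕ × ℕ × List ℕ => q.2.1 := Computable.fst.comp .snd
    have hl : Computable fun q : ℕ × ℕ × List ℕ => q.2.2 := Computable.snd.comp .snd
    convert IsEnumerable.of_check (α := ℕ × ℕ × ℕ) (β := ℕ × ℕ × List ℕ)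
      (hand.comp (computable_beq
        (Computable.encode.comp ((Arithmetization.relArity_computable (L := L)).comp hc))
        (Computable.encode.comp (Computable.option_some.comp (Computable.list_length.comp hl))))
        (computable_allLt.comp .fst hl))
      (Computable.pair .fst (Computable.pair
        (computable_relAppCode.comp hc (computable_map_double.comp hl))
        (hren.comp (Computable.pair .fst (Computable.pair hl (hg.comp hc)))))) using 1
    ext ⟨n, d⟩
    simp only [Set.mem_ofPred_eq, Bool.and_eq_true, decide_eq_true_eq, encode_inj, allLt_iff,
      code_rel_tvar, code_rename, Prod.mk.injEq, ← hgR]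
    constructor
    · rintro ⟨k, R, σ, h⟩
      refine ⟨(n, Arithmetization.relCode R, List.ofFn fun l => (σ l : ℕ)), ⟨?_, ?_⟩, rfl, h⟩
      · rw [List.length_ofFn]
        exact (Arithmetization.relArity_eq_some _ _).2 ⟨R, rfl⟩
      · rw [List.forall_mem_ofFn_iff]
        exact fun i => (σ i).2
    · rintro ⟨⟨m, c, l⟩, ⟨hc, hl⟩, rfl, h⟩
      simp only at hc hl h
      obtain ⟨R, rfl⟩ := (Arithmetization.relArity_eq_some _ _).1 hc
      obtain ⟨σ, hσ⟩ := exists_fin_tuple hl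
      exact ⟨_, R, σ, by rw [hσ]; exact h⟩
  · have hc : Computable fun q : ℕ × ℕ × List ℕ × ℕ => q.2.1 := Computable.fst.comp .snd
    have hl : Computable fun q : ℕ × ℕ × List ℕ × ℕ => q.2.2.1 :=
      Computable.fst.comp (Computable.snd.comp .snd)
    have hj : Computable fun q : ℕ × ℕ × List ℕ × ℕ => q.2.2.2 :=
      Computable.snd.comp (Computable.snd.comp .snd)
    have hs : Computable fun q : ℕ × ℕ × List ℕ × ℕ => q.1 + 1 := Computable.succ.comp .fst
    have hsingle : Computable fun q : ℕ × ℕ × List ℕ × ℕ => [q.1] :=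
      Computable.list_cons.comp .fst (.const [])
    convert IsEnumerable.of_check (α := ℕ × ℕ × ℕ) (β := ℕ × ℕ × List ℕ × ℕ)
      (hand.comp (hand.comp (computable_beq
        (Computable.encode.comp ((Arithmetization.funcArity_computable (L := L)).comp hc))
        (Computable.encode.comp (Computable.option_some.comp (Computable.list_length.comp hl))))
        (computable_allLt.comp .fst hl)) (hlt.comp hj .fst))
      (Computable.pair .fst (Computable.pair
        (computable_equalCode.comp
          (computable_funcAppCode.comp hc (computable_map_double.comp hl))
          (computable_double.comp hj))
        (computable_allCode.comp (computable_impCode.comp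
          (hren.comp (Computable.pair hs (Computable.pair hsingle (.const (code I.dom)))))
          (computable_impCode.comp
            (hren.comp (Computable.pair hs (Computable.pair
              (Computable.list_append.comp hl hsingle) (hh.comp hc))))
            (hren.comp (Computable.pair hs (Computable.pair (Computable.list_cons.comp .fst
              (Computable.list_cons.comp hj (.const []))) (.const (code I.eq)))))))))) using 1
    ext ⟨n, d⟩
    simp only [Set.mem_ofPred_eq, Bool.and_eq_true, decide_eq_true_eq, encode_inj, allLt_iff,
      code_func_tvar, code_all, code_imp, code_domAt, code_rename (m := _ + 1), ofFn_snoc_castSucc_last, Prod.mk.injEq, ← hhf, Fin.val_last]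
    constructor
    · rintro ⟨k, f, σ, j, h⟩
      refine ⟨(n, Arithmetization.funcCode f, List.ofFn fun l => (σ l : ℕ), j),
        ⟨⟨?_, ?_⟩, j.2⟩, rfl, h⟩
      · rw [List.length_ofFn]
        exact (Arithmetization.funcArity_eq_some _ _).2 ⟨f, rfl⟩
      · rw [List.forall_mem_ofFn_iff]
        exact fun i => (σ i).2
    · rintro ⟨⟨m, c, l, j⟩, ⟨⟨hc, hl⟩, hj⟩, rfl, h⟩
      simp only at hc hl h
      obtain ⟨f, rfl⟩ := (Arithmetization.funcArity_eq_some _ _).1 hc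
      obtain ⟨σ, hσ⟩ := exists_fin_tuple hl
      exact ⟨_, f, σ, ⟨j, hj⟩, by rw [hσ]; exact h⟩

/-- The translation of implications and quantifiers on codes. -/
def unnestedRule (δ : ℕ) (t : Bool) (p q : ℕ × ℕ × ℕ) : Option (ℕ × ℕ × ℕ) :=
  if t = true then
    if p.1 = q.1 then some (p.1, impCode p.2.1 q.2.1, impCode p.2.2 q.2.2) else none
  else if p.1 = 0 then none
  -- The quantifier binds the last variable `x_{p.1 - 1}` of the context, and `renameCode p.1 [p.1 -
  -- 1] δ` codes the domain formula at that variable.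
  else some (p.1 - 1, allCode p.2.1, allCode (impCode (renameCode p.1 [p.1 - 1] δ) p.2.2))

theorem computable_unnestedRule (δ : ℕ) :
    Computable fun q : Bool × (ℕ × ℕ × ℕ) × (ℕ × ℕ × ℕ) => unnestedRule δ q.1 q.2.1 q.2.2 := by
  have hp : Computable fun q : Bool × (ℕ × ℕ × ℕ) × (ℕ × ℕ × ℕ) => q.2.1 :=
    Computable.fst.comp .snd
  have hq : Computable fun q : Bool × (ℕ × ℕ × ℕ) × (ℕ × ℕ × ℕ) => q.2.2 :=
    Computable.snd.comp .snd
  have hp₁ := Computable.fst.comp hp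
  have hp₂ := Computable.fst.comp (Computable.snd.comp hp)
  have hp₃ := Computable.snd.comp (Computable.snd.comp hp)
  have hq₂ := Computable.fst.comp (Computable.snd.comp hq)
  have hq₃ := Computable.snd.comp (Computable.snd.comp hq)
  have hpred := Computable.pred.comp hp₁
  refine computable_ite (Computable.fst.of_eq fun q => by simp) ?_ ?_
  · refine computable_ite (computable_beq hp₁ (Computable.fst.comp hq)) ?_ (.const none)
    exact Computable.option_some.comp (Computable.pair hp₁ (Computable.pair
      (computable_impCode.comp hp₂ hq₂) (computable_impCode.comp hp₃ hq₃)))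
  · refine computable_ite (computable_beq hp₁ (.const 0)) (.const none) ?_
    exact Computable.option_some.comp (Computable.pair hpred (Computable.pair
      (computable_allCode.comp hp₂) (computable_allCode.comp (computable_impCode.comp
        (computable_renameCode.comp (Computable.pair hp₁ (Computable.pair
          (Computable.list_cons.comp hpred (.const [])) (.const δ)))) hp₃))))

theorem generated_iff_unnested {p : ℕ × ℕ × ℕ} :
    Generated (unnestedAtomCodes I) (unnestedRule (code I.dom)) p ↔
      ∃ (φ : Fm L p.1) (ψ : Fm L' p.1), I.Unnested φ ψ ∧ (code φ, code ψ) = p.2 := by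
  constructor
  · intro h
    induction h with
    | base h =>
      rcases h with h | ⟨i, j, h⟩ | ⟨k, R, σ, h⟩ | ⟨k, f, σ, j, h⟩
      · exact ⟨_, _, .falsum _, h⟩
      · exact ⟨_, _, .equal i j, h⟩
      · exact ⟨_, _, .rel R σ, h⟩
      · exact ⟨_, _, .func f σ j, h⟩
    | @step p q s t _ _ hr ih₁ ih₂ =>
      obtain ⟨n, a⟩ := p
      obtain ⟨m, b⟩ := q
      obtain ⟨φ₁, ψ₁, h₁, e₁⟩ := ih₁
      obtain ⟨φ₂, ψ₂, h₂, e₂⟩ := ih₂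
      simp only at φ₁ ψ₁ φ₂ ψ₂ h₁ h₂ e₁ e₂
      subst e₁ e₂
      cases t with
      | true =>
        simp only [unnestedRule, if_true] at hr
        split_ifs at hr with h₃
        subst h₃
        obtain rfl := Option.some.inj hr
        exact ⟨_, _, .imp h₁ h₂, rfl⟩
      | false =>
        simp only [unnestedRule, Bool.false_eq_true, if_false] at hr
        split_ifs at hr with h₃
        obtain ⟨k, rfl⟩ := Nat.exists_eq_succ_of_ne_zero h₃
        obtain rfl := Option.some.inj hr
        refine ⟨_, _, .all h₁, ?_⟩
        simp only [code_all, code_imp, code_domAt]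
        rfl
  · rintro ⟨φ, ψ, h, e⟩
    suffices key : ∀ {n : ℕ} {φ : Fm L n} {ψ : Fm L' n}, I.Unnested φ ψ →
        Generated (unnestedAtomCodes I) (unnestedRule (code I.dom)) (n, code φ, code ψ) by
      have := key h
      rwa [e] at this
    clear φ ψ h e
    intro n φ ψ h
    induction h with
    | falsum n => exact .base (.inl rfl)
    | equal i j => exact .base (.inr (.inl ⟨i, j, rfl⟩))
    | rel R σ => exact .base (.inr (.inr (.inl ⟨_, R, σ, rfl⟩)))
    | func f σ j => exact .base (.inr (.inr (.inr ⟨_, f, σ, j, rfl⟩)))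
    | imp _ _ ih₁ ih₂ => exact .step true ih₁ ih₂ (by simp [unnestedRule, code_imp])
    | all _ ih =>
      exact .step false ih ih (by simp [unnestedRule, code_all, code_imp, code_domAt])

theorem isEnumerable_unnested (hI : I.IsRecursive) :
    IsEnumerable {p : ℕ × ℕ × ℕ | ∃ (φ : Fm L p.1) (ψ : Fm L' p.1),
      I.Unnested φ ψ ∧ (code φ, code ψ) = p.2} := by
  simp only [← generated_iff_unnested]
  exact (isEnumerable_unnestedAtomCodes I hI).generated (computable_unnestedRule _)

end UnnestedCodes

/-! ### The theory of the defined structure, and the equivalence -/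

section Main

variable {L L' : FirstOrder.Language.{u, v}} [Arithmetization L] [Arithmetization L']

/-- The implications from an unnested form to the original sentence are found among these. -/
theorem isEnumerable_logicalTheorems :
    IsEnumerable {c : ℕ | ∃ φ : L.Sentence, Proves (∅ : L.Theory) φ ∧ code (n := 0) φ = c} := by
  refine isEnumerable_theorems ⟨fun _ => isFalse (by simp), ?_⟩
  exact (Computable.const false).of_eq fun c => by simp

/-- The theory of a structure which is defined in a model of a complete recursively
axiomatizable theory by a recursive translation is recursive. -/
theorem recursiveSet_of_defines {I : Translation L L'} (hI : I.IsRecursive) {S : L'.Theory}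
    (hS : RecursivelyAxiomatizable S) {M N : Type} [L'.Structure M] [L.Structure N] [Nonempty N]
    (hM : ∀ ψ : L'.Sentence, M ⊨ ψ ↔ Proves S ψ) (D : I.Defines M N) :
    RecursiveSet {φ : L.Sentence | N ⊨ φ} := by
  obtain ⟨A, hA, hAS⟩ := hS
  -- The theory of a structure contains exactly one of `φ` and `¬φ`, so an enumeration suffices.
  refine recursiveSet_of_isEnumerable ?_ fun φ => Iff.rfl
  have hsat : ∀ {φ : L.Sentence} {ψ : L'.Sentence}, I.Unnested (n := 0) φ ψ →
      (M ⊨ ψ ↔ N ⊨ φ) := by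
    intro φ ψ h
    have := D.sat_unnested h default fun i => i.elim0
    rwa [Subsingleton.elim (fun _ => _) (default : Fin 0 → N)] at this
  -- The search runs over unnested pairs `(φ', ψ)`, logical theorems and theorems of `A`. It outputs
  -- `φ` when the pair is in context 0, the logical theorem is `φ' → φ` and the theorem of `A` is
  -- `ψ`.
  have hE := ((isEnumerable_unnested I hI).prod
    ((isEnumerable_logicalTheorems (L := L)).prod (isEnumerable_theorems hA))).partial_image
    (g := fun q : (ℕ × ℕ × ℕ) × ℕ × ℕ =>
      if q.1.1 = 0 then
        if q.1.2.2 = q.2.2 then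
          if q.2.1 = impCode q.1.2.1 (q.2.1 / 4).unpair.2 then some (q.2.1 / 4).unpair.2 else none
        else none
      else none) (by
    have hn : Computable fun q : (ℕ × ℕ × ℕ) × ℕ × ℕ => q.1.1 := Computable.fst.comp .fst
    have ha : Computable fun q : (ℕ × ℕ × ℕ) × ℕ × ℕ => q.1.2.1 :=
      Computable.fst.comp (Computable.snd.comp .fst)
    have hb : Computable fun q : (ℕ × ℕ × ℕ) × ℕ × ℕ => q.1.2.2 :=
      Computable.snd.comp (Computable.snd.comp .fst)
    have hd : Computable fun q : (ℕ × ℕ × ℕ) × ℕ × ℕ => q.2.1 := Computable.fst.comp .snd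
    have he : Computable fun q : (ℕ × ℕ × ℕ) × ℕ × ℕ => q.2.2 := Computable.snd.comp .snd
    have hc : Computable fun q : (ℕ × ℕ × ℕ) × ℕ × ℕ => (q.2.1 / 4).unpair.2 :=
      Computable.snd.comp (Computable.unpair.comp ((computable_div 4).comp hd))
    exact computable_ite (computable_beq hn (.const 0)) (computable_ite (computable_beq hb he)
      (computable_ite (computable_beq hd (computable_impCode.comp ha hc))
        (Computable.option_some.comp hc) (.const none)) (.const none)) (.const none))
  convert hE using 1
  ext c
  simp only [Set.mem_ofPred_eq, Set.mem_prod]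
  constructor
  · rintro ⟨φ, hφ, rfl⟩
    -- The unnested form of `φ` is its image under the identity translation, equivalent to `φ` in
    -- all structures; completeness turns this into a logical theorem.
    obtain ⟨ψ, hψ⟩ := Translation.exists_unnested_identity (I := I) (n := 0) φ
    let φ' : L.Sentence := (Translation.identity L).onFm (n := 0) φ
    have hlog : Proves (∅ : L.Theory) (φ'.imp φ) := proves_of_models fun K _ _ _ =>
      ((Translation.identityDefines K).models_onFm φ).1
    have hN : N ⊨ φ' := ((Translation.identityDefines N).models_onFm φ).2 hφ
    have hSψ : Proves A ψ := (hAS ψ).2 ((hM ψ).1 ((hsat hψ).2 hN))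
    refine ⟨((0, code (n := 0) φ', code (n := 0) ψ), impCode (code (n := 0) φ') (code (n := 0) φ),
      code (n := 0) ψ), ⟨⟨_, _, hψ, rfl⟩, ⟨_, hlog, rfl⟩, ⟨_, hSψ, rfl⟩⟩, ?_⟩
    have h : impCode (code (n := 0) φ') (code (n := 0) φ) / 4 =
        Nat.pair (code (n := 0) φ') (code (n := 0) φ) := by simp only [impCode]; omega
    simp [h]
  · rintro ⟨⟨⟨n, a, b⟩, d, e⟩, ⟨⟨φ', ψ, hψ, h₁⟩, ⟨χ, hχ, h₂⟩, ⟨ψ', hψ', h₃⟩⟩, h⟩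
    simp only at φ' ψ hψ h₁ h₂ h₃ h
    split_ifs at h with h₄ h₅ h₆
    subst h₄
    obtain ⟨rfl, rfl⟩ := Prod.mk.inj h₁
    obtain rfl := code_injective (h₃.trans h₅.symm)
    -- By `h₆` the logical theorem has the code of an implication, so its consequent is a sentence.
    have hd : ∃ φ : L.Sentence, code (n := 0) φ = (d / 4).unpair.2 := by
      rw [h₆] at h₂
      cases χ <;> simp only [code, impCode] at h₂ <;> try omega
      exact ⟨_, (Nat.pair_eq_pair.1 (Nat.mul_left_cancel (Nat.succ_pos 3)
        (Nat.add_right_cancel h₂))).2⟩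
    obtain ⟨φ, hφ⟩ := hd
    obtain rfl : χ = BoundedFormula.imp φ' φ :=
      code_injective (h₂.trans (h₆.trans (by rw [code_imp, hφ])))
    refine ⟨φ, ?_, hφ.trans (Option.some.inj h)⟩
    have hN : N ⊨ (φ' : L.Sentence) := (hsat hψ).1 ((hM _).2 ((hAS _).1 hψ'))
    exact Proves.sound (M := N) (by simp) hχ hN

theorem EssentiallyUndecidable.g1Holds {T : L.Theory} (h : EssentiallyUndecidable T) :
    G1Holds T := by
  intro L' _ S hS hcons ⟨I, hrec, hI⟩
  by_contra hcomplete
  have hcomp : ∀ φ : L'.Sentence, Proves S φ ∨ Proves S φ.not := fun φ => by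
    by_contra hφ
    exact hcomplete ⟨φ, not_or.1 hφ⟩
  obtain ⟨M, _, _, hM⟩ := hcons.exists_model
  obtain ⟨N, _, _, ⟨D⟩⟩ := hI.exists_defines hM
  -- As `S` is complete, a sentence true in one model is provable: otherwise its negation would be,
  -- and would be true as well.
  have hM' : ∀ ψ : L'.Sentence, M ⊨ ψ ↔ Proves S ψ := fun ψ =>
    ⟨fun hψ => (hcomp ψ).resolve_right fun h' => Proves.sound hM h' hψ, Proves.sound hM⟩
  -- The theory of `N` is deductively closed, so its recursiveness makes it both recursively
  -- axiomatizable and decidable.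
  have hth : ∀ φ : L.Sentence, Proves {φ : L.Sentence | N ⊨ φ} φ ↔ N ⊨ φ := fun φ =>
    ⟨Proves.sound fun _ h => h, fun h => Proves.of_mem h⟩
  have hdec := recursiveSet_of_defines hrec hS hM' D
  refine h {φ | N ⊨ φ} ⟨_, hdec, fun _ => Iff.rfl⟩ (fun hbot => (hth _).1 hbot)
    (fun φ hφ => (hth φ).2 ((D.models_onFm φ).1 (Proves.sound hM (hI.2 φ hφ)))) ?_
  simpa only [DecidableTheory, hth] using hdec

theorem G1Holds.essentiallyIncomplete {T : L.Theory} (h : G1Holds T) : EssentiallyIncomplete T :=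
  fun S hS hcons hST => h L S hS hcons (interpretable_of_extends hST)

end Main

end G1

theorem mainTheorem6 {L : FirstOrder.Language} [G1.Arithmetization L]
    (T : L.Theory) (hT : G1.RecursivelyAxiomatizable T) (hcon : G1.Consistent T) :
    List.TFAE [G1.G1Holds T, G1.EssentiallyIncomplete T, G1.EssentiallyUndecidable T] := by
  tfae_have 1 → 2 := G1.G1Holds.essentiallyIncomplete
  tfae_have 2 → 3 := G1.EssentiallyIncomplete.essentiallyUndecidable
  tfae_have 3 → 1 := G1.EssentiallyUndecidable.g1Holds
  tfae_finish
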